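/- Let $\mathrm{SAff}_2(\mathbb R)=\mathrm{SL}_2(\mathbb R)\ltimes\mathbb R^2$ be the group of pairs $(g,w)$, $w=(w_1,w_2)$ a row vector, with $(g,w)(g',w')=(gg',wg'+w')$, and let $\mathrm{SAff}_2(\mathbb Z)=\mathrm{SL}_2(\mathbb Z)\ltimes\mathbb Z^2$. Up to a null set the stratum $\mathcal H(0,0)$ of area one tori with two marked points is $\mathrm{SAff}_2(\mathbb Z)\backslash\mathrm{SAff}_2(\mathbb R)$ (the class of $(g,w)$ is the torus $\mathbb R^2/\Lambda$, $\Lambda=\mathbb Z^2g$, with marked points $0$ and $w$), and $\mathcal H(0)=\mathrm{SL}_2(\mathbb Z)\backslash\mathrm{SL}_2(\mathbb R)$. Both carry their right-invariant (Masur–Veech) measure, unique up to scaling; the one on $\mathcal H(0,0)$ is induced by the Haar measure, which is proportional to $y^{-2}\,dx\,dy\,dp\,dq\,d\theta$ in the coordinates $$(1,(p,q))\begin{pmatrix}1&x\\0&1\end{pmatrix}\begin{pmatrix}\sqrt y&0\\0&1/\sqrt y\end{pmatrix}\begin{pmatrix}\cos\theta&\sin\theta\\-\sin\theta&\cos\theta\end{pmatrix}.$$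 *Genuine part.* Pullback along the map $\mathcal H(0,0)\to\mathcal H(0)$ forgetting the second point embeds $L^2(\mathcal H(0))$ into $L^2(\mathcal H(0,0))$; put $L^2(\mathcal H(0,0))^{\mathrm{gen}}=L^2(\mathcal H(0))^\perp$. *Cusp forms.* For $k\in\mathbb Z$, a function $\phi:\mathbb H\times\mathbb C\to\mathbb C$ is affine modular-invariant of weight $k$ if $\phi|_k\gamma=\phi$ for all $\gamma\in\mathrm{SAff}_2(\mathbb Z)$, where $$\Big(\phi\big|_k\big(\begin{pmatrix}a&b\\c&d\end{pmatrix},w_1,w_2\big)\Big)(\tau,z)=(c\tau+d)^{-k}\,\phi\Big(\frac{a\tau+b}{c\tau+d},\frac{z+w_1\tau+w_2}{c\tau+d}\Big).$$ Its lift is the function $g\mapsto(\phi|_kg)(i,0)$ on $\mathrm{SAff}_2(\mathbb Z)\backslash\mathrm{SAff}_2(\mathbb R)$; $\phi$ is genuine if its lift lies in $L^2(\mathcal H(0,0))^{\mathrm{gen}}$. With $e(t)=e^{2\pi it}$, put $$c^{H0}(\phi;n,m;y)=\frac1y\int_0^y\int_0^1\int_0^1\phi(x+iy,u+iv)\,e(-nx)\,e(-mv/y)\,dx\,du\,dv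 .$$ A genuine $\phi$ is a cusp form if $c^{H0}(\phi;0,m;y)=0$ for all $m\in\mathbb Z$ and almost all $y>0$ (for continuous $\phi$, equivalently, for all $y>0$). Let $L^2(\mathcal H(0,0))^{\mathrm{gen}}_{\mathrm{cusp}}$ be the closure of the linear span of the lifts of genuine cusp forms of all weights $k\in\mathbb Z$. *Siegel–Veech transforms.* For $M\ge1$ and $f\in C^\infty_{c,0}(\mathbb R^2)$, that is, $f:\mathbb R^2\to\mathbb C$ smooth, compactly supported, with $\int_{\mathbb R^2}f=0$, let $$\mathrm{SV}_{\mathrm{rel},M}(f)(\Lambda,z)=\sum_{w\in z+\frac1M\Lambda}f(w),\qquad \mathcal{SV}_{\mathrm{rel},M}=\overline{\mathrm{span}}\{\mathrm{SV}_{\mathrm{rel},M}(f):f\in C_{c,0}^\infty(\mathbb R^2)\}.$$ **Theorem.** For all $M\ge1$ and $f\in C^\infty_{c,0}(\mathbb R^2)$ one has $\mathrm{SV}_{\mathrm{rel},M}(f)\in L^2(\mathcal H(0,0))$, and there is an orthogonal decomposition $$L^2(\mathcal H(0,0))^{\mathrm{gen}}=L^2(\mathcal H(0,0))^{\mathrm{gen}}_{\mathrm{cusp}}\oplus\overline{\mathrm{span}}\Big(\bigcup_{M=1}^\infty\mathcal{SV}_{\mathrm{rel},M}\Big).$$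 -/

import Mathlib

open MeasureTheory Set UpperHalfPlane
open scoped MatrixGroups ContDiff

noncomputable section

namespace TwoPointTori

/-! ### The special affine group -/

/-- The special affine group `SAff₂(R) = SL₂(R) ⋉ R²`: pairs `(g, w)` with `g ∈ SL₂(R)` and `w` a
row vector, with composition law `(g, w) (g', w') = (g g', w g' + w')`. -/
@[ext]
structure SAff (R : Type) [CommRing R] where
  lin : SL(2, R)
  trans : Fin 2 → R

namespace SAff

section Group

variable {R : Type} [CommRing R]

instance : Mul (SAff R) :=
  ⟨fun g h => ⟨g.lin * h.lin, Matrix.vecMul g.trans (h.lin : Matrix (Fin 2) (Fin 2) R) + h.trans⟩⟩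

instance : One (SAff R) := ⟨⟨1, 0⟩⟩

instance : Inv (SAff R) :=
  ⟨fun g => ⟨g.lin⁻¹,
    -Matrix.vecMul g.trans ((g.lin⁻¹ : SL(2, R)) : Matrix (Fin 2) (Fin 2) R)⟩⟩

@[simp] theorem mul_lin (g h : SAff R) : (g * h).lin = g.lin * h.lin := rfl

@[simp] theorem mul_trans (g h : SAff R) :
    (g * h).trans = Matrix.vecMul g.trans (h.lin : Matrix (Fin 2) (Fin 2) R) + h.trans := rfl

@[simp] theorem one_lin : (1 : SAff R).lin = 1 := rfl

@[simp] theorem one_trans : (1 : SAff R).trans = 0 := rfl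

@[simp] theorem inv_lin (g : SAff R) : (g⁻¹).lin = g.lin⁻¹ := rfl

@[simp] theorem inv_trans (g : SAff R) : (g⁻¹).trans =
    -Matrix.vecMul g.trans ((g.lin⁻¹ : SL(2, R)) : Matrix (Fin 2) (Fin 2) R) := rfl

instance : Group (SAff R) :=
  Group.ofLeftAxioms
    (fun a b c => by
      ext1
      · simp [mul_assoc]
      · simp [Matrix.add_vecMul, Matrix.vecMul_vecMul, add_assoc])
    (fun a => by ext1 <;> simp)
    (fun a => by
      ext1
      · simp
      · rw [mul_trans, inv_trans, Matrix.neg_vecMul, Matrix.vecMul_vecMul,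
          ← Matrix.SpecialLinearGroup.coe_mul]
        simp)

/-- The inclusion `SL₂(R) → SAff₂(R)`, `g ↦ (g, 0)`. -/
def ofSL (g : SL(2, R)) : SAff R := ⟨g, 0⟩

/-- The translation `(1, w)`. -/
def ofVec (w : Fin 2 → R) : SAff R := ⟨1, w⟩

end Group

/-- The inclusion `SAff₂(ℤ) → SAff₂(ℝ)`. -/
def intCast : SAff ℤ →* SAff ℝ :=
  MonoidHom.mk' (fun γ => ⟨Matrix.SpecialLinearGroup.map (Int.castRingHom ℝ) γ.lin,
      fun i => (γ.trans i : ℝ)⟩)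
    (fun a b => by
      ext1
      · simp
      · ext i
        simp [Matrix.vecMul, dotProduct, Fin.sum_univ_two])

/-- The lattice `SAff₂(ℤ)` as a subgroup of `SAff₂(ℝ)`. -/
def lattice : Subgroup (SAff ℝ) := intCast.range

end SAff

/-- The lattice `SL₂(ℤ)` as a subgroup of `SL₂(ℝ)`. -/
def slLattice : Subgroup SL(2, ℝ) :=
  (Matrix.SpecialLinearGroup.map (n := Fin 2) (Int.castRingHom ℝ)).range

/-! ### The Borel structures -/

/-- The Borel `σ`-algebra of `SL₂(ℝ)`, generated by the matrix entries. -/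
instance : MeasurableSpace SL(2, ℝ) :=
  MeasurableSpace.comap (fun g : SL(2, ℝ) => fun (i j : Fin 2) => g i j) inferInstance

/-- The Borel `σ`-algebra of `SAff₂(ℝ)`, that of the product `SL₂(ℝ) × ℝ²`. -/
instance : MeasurableSpace (SAff ℝ) :=
  MeasurableSpace.comap (fun g : SAff ℝ => (g.lin, g.trans)) inferInstance

/-! ### The strata `H(0)` and `H(0,0)` -/

/-- The stratum `H(0) = SL₂(ℤ) \ SL₂(ℝ)` of area one tori with one marked point; the class of `g`
is the torus `ℝ² / ℤ² g`. -/
abbrev H0 : Type := MulAction.orbitRel.Quotient slLattice SL(2, ℝ)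

/-- The homogeneous space `SAff₂(ℤ) \ SAff₂(ℝ)`, i.e. (up to the null set where the two points
coincide) the stratum `H(0,0)` of area one tori with two marked points; the class of `(g, w)` is
the torus `ℝ² / ℤ² g` with the marked points `0` and `w`. -/
abbrev H00 : Type := MulAction.orbitRel.Quotient SAff.lattice (SAff ℝ)

/-- The quotient map `SAff₂(ℝ) → H(0,0)`. -/
def H00.mk (g : SAff ℝ) : H00 := Quotient.mk'' g

/-- The quotient map `SL₂(ℝ) → H(0)`. -/
def H0.mk (g : SL(2, ℝ)) : H0 := Quotient.mk'' g

/-- Descent of a left `SAff₂(ℤ)`-invariant function on `SAff₂(ℝ)` to `H(0,0)`. -/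
def H00.descend {α : Type} (F : SAff ℝ → α)
    (hF : ∀ (γ : SAff ℤ) (g : SAff ℝ), F (SAff.intCast γ * g) = F g) : H00 → α :=
  Quotient.lift F (by
    rintro a b ⟨⟨_, γ, rfl⟩, rfl⟩
    exact hF γ b)

@[simp] theorem H00.descend_mk {α : Type} (F : SAff ℝ → α)
    (hF : ∀ (γ : SAff ℤ) (g : SAff ℝ), F (SAff.intCast γ * g) = F g) (g : SAff ℝ) :
    H00.descend F hF (H00.mk g) = F g := rfl

/-- The map `H(0,0) → H(0)` forgetting the second marked point. -/
def forget : H00 → H0 :=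
  H00.descend (fun g => H0.mk g.lin) (fun γ g => by
    refine Quotient.sound ⟨⟨_, γ.lin, rfl⟩, rfl⟩)

/-! ### The invariant measure -/

/-- The rotation matrix with rows `(cos θ, sin θ)` and `(-sin θ, cos θ)`. -/
def rot (θ : ℝ) : SL(2, ℝ) :=
  ⟨!![Real.cos θ, Real.sin θ; -Real.sin θ, Real.cos θ], by
    rw [Matrix.det_fin_two_of]
    nlinarith [Real.sin_sq_add_cos_sq θ]⟩

/-- The Iwasawa coordinates of `SAff₂(ℝ)`: to `τ = x + iy`, `(p, q)` and `θ` they assign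
`(1, p, q) · n(x) · a(√y) · k(θ)`. The matrix `τ.toSL2R` is `n(x) a(√y)`, with rows
`(√y, x/√y)` and `(0, 1/√y)`. -/
def iwasawa (t : ℍ × (Fin 2 → ℝ) × ℝ) : SAff ℝ :=
  SAff.ofVec t.2.1 * SAff.ofSL t.1.toSL2R * SAff.ofSL (rot t.2.2)

/-- The fundamental domain for `SAff₂(ℤ)` in Iwasawa coordinates: `τ` in the standard fundamental
domain of the modular group, `(p, q) ∈ [0,1)²`, and `θ ∈ [0, π)` since `-1` acts on `θ` as a shift
by `π`. -/
def fundDomain : Set (ℍ × (Fin 2 → ℝ) × ℝ) :=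
  ModularGroup.fd ×ˢ ((univ.pi fun _ => Ico 0 1) ×ˢ Ico 0 Real.pi)

/-- The invariant (Masur–Veech) measure on `H(0,0)`: the image of the restriction to a fundamental
domain of the Haar measure, which is `dx dy dp dq dθ / y²` in Iwasawa coordinates
(the volume of `ℍ` is `dx dy / y²`). -/
def muMV : Measure H00 :=
  Measure.map (fun t => H00.mk (iwasawa t)) (volume.restrict fundDomain)

/-- The invariant measure on `H(0)`, the image of the one on `H(0,0)`
(the torus fibres have volume one). -/
def muMV0 : Measure H0 := Measure.map forget muMV

theorem measurable_iwasawa : Measurable iwasawa := by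
  rw [measurable_comap_iff]
  have hL : Measurable fun t : ℍ × (Fin 2 → ℝ) × ℝ => t.1.toSL2R * rot t.2.2 := by
    rw [measurable_comap_iff]
    have hre : Measurable fun t : ℍ × (Fin 2 → ℝ) × ℝ => t.1.re :=
      UpperHalfPlane.continuous_re.measurable.comp measurable_fst
    have him : Measurable fun t : ℍ × (Fin 2 → ℝ) × ℝ => t.1.im :=
      UpperHalfPlane.continuous_im.measurable.comp measurable_fst
    have hE : (fun t : ℍ × (Fin 2 → ℝ) × ℝ => fun i j : Fin 2 => (t.1.toSL2R * rot t.2.2) i j) =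
        fun t => !![√t.1.im * Real.cos t.2.2 + t.1.re / √t.1.im * -Real.sin t.2.2,
          √t.1.im * Real.sin t.2.2 + t.1.re / √t.1.im * Real.cos t.2.2;
          1 / √t.1.im * -Real.sin t.2.2, 1 / √t.1.im * Real.cos t.2.2] := by
      ext t i j
      rw [Matrix.SpecialLinearGroup.coe_mul, coe_toSL2R]
      fin_cases i <;> fin_cases j <;> simp [Matrix.mul_apply, Fin.sum_univ_two, rot]
    change Measurable (fun t : ℍ × (Fin 2 → ℝ) × ℝ =>
      fun i j : Fin 2 => (t.1.toSL2R * rot t.2.2) i j)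
    rw [hE]
    have hθ : Measurable fun t : ℍ × (Fin 2 → ℝ) × ℝ => t.2.2 := measurable_snd.comp measurable_snd
    have hs := hθ.sin
    have hc := hθ.cos
    have hq := him.sqrt
    refine measurable_pi_lambda _ fun i => measurable_pi_lambda _ fun j => ?_
    fin_cases i <;> fin_cases j
    · exact (hq.mul hc).add ((hre.div hq).mul hs.neg)
    · exact (hq.mul hs).add ((hre.div hq).mul hc)
    · exact (measurable_const.div hq).mul hs.neg
    · exact (measurable_const.div hq).mul hc
  have hE : ∀ i j : Fin 2, Measurable fun t : ℍ × (Fin 2 → ℝ) × ℝ =>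
      (t.1.toSL2R * rot t.2.2) i j := by
    intro i j
    have h : Measurable fun g : SL(2, ℝ) => fun (i j : Fin 2) => g i j :=
      comap_measurable _
    exact (measurable_pi_apply j).comp ((measurable_pi_apply i).comp (h.comp hL))
  have hv : ∀ i, Measurable fun t : ℍ × (Fin 2 → ℝ) × ℝ => t.2.1 i := by
    intro i; fun_prop
  refine Measurable.prodMk ?_ (measurable_pi_lambda _ fun i => ?_)
  · simpa [iwasawa, SAff.ofVec, SAff.ofSL, Function.comp_def] using hL
  · have : (fun t : ℍ × (Fin 2 → ℝ) × ℝ => (iwasawa t).trans i) = fun t =>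
        t.2.1 0 * (t.1.toSL2R * rot t.2.2) 0 i + t.2.1 1 * (t.1.toSL2R * rot t.2.2) 1 i := by
      ext t
      simp only [iwasawa, SAff.ofVec, SAff.ofSL, SAff.mul_trans, Matrix.vecMul_vecMul, add_zero,
        ← Matrix.SpecialLinearGroup.coe_mul]
      simp [Matrix.vecMul, dotProduct, Fin.sum_univ_two]
    have h2 := ((hv 0).mul (hE 0 i)).add ((hv 1).mul (hE 1 i))
    change Measurable fun t => (iwasawa t).trans i
    rw [this]
    exact h2

theorem measurable_H00_mk : Measurable H00.mk := fun _ hs => hs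

theorem measurable_forget : Measurable forget := by
  have h1 : Measurable fun g : SAff ℝ => H0.mk g.lin := by
    have h2 : Measurable H0.mk := fun _ hs => hs
    have h3 : Measurable fun g : SAff ℝ => (g.lin, g.trans) := comap_measurable _
    exact h2.comp (measurable_fst.comp h3)
  intro s hs
  exact h1 hs

/-! ### The genuine part -/

/-- The Hilbert space `L²(H(0,0))`. -/
abbrev L2H00 : Type := Lp ℂ 2 muMV

/-- The isometric embedding `L²(H(0)) → L²(H(0,0))` by pullback. -/
def pullback : Lp ℂ 2 muMV0 →ₗᵢ[ℂ] L2H00 :=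
  Lp.compMeasurePreservingₗᵢ ℂ forget ⟨measurable_forget, rfl⟩

/-- The genuine part `L²(H(0,0))^gen`, the orthogonal complement of `L²(H(0))`. -/
def genuinePart : Submodule ℂ L2H00 := (LinearMap.range pullback.toLinearMap)ᗮ

/-! ### Affine modular-invariant functions and cusp forms -/

/-- The weight `k` slash action of `SAff₂(ℝ)` on functions on the Jacobi half space `ℍ × ℂ`. -/
def slash (k : ℤ) (φ : ℍ → ℂ → ℂ) (g : SAff ℝ) (τ : ℍ) (z : ℂ) : ℂ :=
  denom g.lin τ ^ (-k) * φ (g.lin • τ) ((z + g.trans 0 * τ + g.trans 1) / denom g.lin τ)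

/-- Affine modular-invariant functions of weight `k`. -/
def IsAffineModular (k : ℤ) (φ : ℍ → ℂ → ℂ) : Prop :=
  ∀ γ : SAff ℤ, slash k φ (SAff.intCast γ) = φ

theorem slash_mul (k : ℤ) (φ : ℍ → ℂ → ℂ) (g h : SAff ℝ) :
    slash k φ (g * h) = slash k (slash k φ g) h := by
  funext τ z
  have hc : denom (g.lin * h.lin : SL(2, ℝ)) τ =
      denom g.lin ↑(h.lin • τ) * denom h.lin τ := by
    rw [coe_specialLinearGroup_apply, map_mul]
    have := denom_cocycle (g.lin : GL (Fin 2) ℝ) h.lin τ.im_ne_zero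
    simpa [num, denom] using this
  have h0 := denom_ne_zero (h.lin : GL (Fin 2) ℝ) τ
  have hcoe : ((h.lin • τ : ℍ) : ℂ) * denom h.lin τ = h.lin 0 0 * τ + h.lin 0 1 := by
    rw [coe_specialLinearGroup_apply]
    simp only [denom] at h0 ⊢
    exact div_mul_cancel₀ _ h0
  simp only [slash, SAff.mul_lin, hc, mul_smul, mul_zpow]
  have hz : (z + ((g * h).trans 0 : ℝ) * τ + ((g * h).trans 1 : ℝ)) /
        (denom g.lin ↑(h.lin • τ) * denom h.lin τ) =
      ((z + h.trans 0 * τ + h.trans 1) / denom h.lin τ + g.trans 0 * ↑(h.lin • τ) + g.trans 1) /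
        denom g.lin ↑(h.lin • τ) := by
    rw [mul_comm (denom _ _), ← div_div]
    congr 1
    rw [div_eq_iff h0, add_mul, add_mul, div_mul_cancel₀ _ h0, mul_assoc, hcoe]
    simp [Matrix.vecMul, dotProduct, Fin.sum_univ_two, denom]
    ring
  rw [hz]
  ring

/-- The lift to `H(0,0)` of an affine modular-invariant function of weight `k`, that is the
function on `SAff₂(ℝ)` with value `(φ |ₖ g)(i, 0)` at `g`. -/
def lift (k : ℤ) (φ : ℍ → ℂ → ℂ) (hφ : IsAffineModular k φ) : H00 → ℂ :=
  H00.descend (fun g => slash k φ g I 0) (fun γ g => by rw [slash_mul, hφ γ])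

/-- `e(t) = exp(2πit)`. -/
def e (t : ℝ) : ℂ := Complex.exp (2 * Real.pi * Complex.I * t)

/-- The Fourier–Heisenberg coefficient `c^H(φ; n, r; y, s)`, where `y = Im τ` and `s = v / y`
for the coordinates `τ = x + iy`, `z = u + iv`. -/
def cH (φ : ℍ → ℂ → ℂ) (n r : ℤ) (y s : ℝ) : ℂ :=
  ∫ u in (0 : ℝ)..1, ∫ x in (0 : ℝ)..1,
    φ (ofComplex (x + y * Complex.I)) (u + (s * y : ℝ) * Complex.I) * e (-(n * x) - r * u)

/-- The Fourier–Heisenberg coefficient `c^{H0}(φ; n, m; y)`. -/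
def cH0 (φ : ℍ → ℂ → ℂ) (n m : ℤ) (y : ℝ) : ℂ :=
  (1 / y : ℂ) * ∫ v in (0 : ℝ)..y, cH φ n 0 y (v / y) * e (-(m * (v / y)))

/-- Vanishing of the coefficients `c^{H0}(φ; 0, m; y)` for all `m ∈ ℤ` and almost all `y > 0`.
(The functions are considered up to null sets; for continuous `φ` vanishing for almost all `y` is
vanishing for all `y > 0`.) -/
def HasVanishingCoefficients (φ : ℍ → ℂ → ℂ) : Prop :=
  ∀ m : ℤ, ∀ᵐ y ∂(volume.restrict (Ioi (0 : ℝ))), cH0 φ 0 m y = 0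

/-- The lifts, as elements of `L²(H(0,0))^gen`, of the genuine cusp forms of any weight. -/
def cuspFormLifts : Set L2H00 :=
  {F | F ∈ genuinePart ∧ ∃ (k : ℤ) (φ : ℍ → ℂ → ℂ) (hφ : IsAffineModular k φ),
    HasVanishingCoefficients φ ∧ F =ᵐ[muMV] lift k φ hφ}

/-- The cuspidal part `L²(H(0,0))^gen_cusp`, the closure of the space of lifts of
genuine cusp forms. -/
def cuspPart : Submodule ℂ L2H00 := (Submodule.span ℂ cuspFormLifts).topologicalClosure

/-! ### Siegel–Veech transforms -/

/-- The configuration `z + (1/M) Λ ⊆ ℝ²` attached to `(Λ, z) ∈ H(0,0)`. -/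
def config (M : ℕ+) : H00 → Set (Fin 2 → ℝ) :=
  H00.descend (fun g => range fun l : Fin 2 → ℤ =>
      g.trans + (M : ℝ)⁻¹ • Matrix.vecMul (fun i => (l i : ℝ)) (g.lin : Matrix (Fin 2) (Fin 2) ℝ))
    (fun γ g => by
      have key : ∀ (γ : SAff ℤ) (g : SAff ℝ) (l : Fin 2 → ℤ), ∃ l' : Fin 2 → ℤ,
          (SAff.intCast γ * g).trans + (M : ℝ)⁻¹ • Matrix.vecMul (fun i => (l i : ℝ))
            ((SAff.intCast γ * g).lin : Matrix (Fin 2) (Fin 2) ℝ) =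
          g.trans + (M : ℝ)⁻¹ • Matrix.vecMul (fun i => (l' i : ℝ))
            (g.lin : Matrix (Fin 2) (Fin 2) ℝ) := by
        intro γ g l
        have hM : ((M : ℕ) : ℝ) ≠ 0 := by positivity
        refine ⟨(M : ℤ) • γ.trans + Matrix.vecMul l (γ.lin : Matrix (Fin 2) (Fin 2) ℤ), ?_⟩
        ext i
        simp [SAff.intCast, Matrix.vecMul, dotProduct, Fin.sum_univ_two, Matrix.mul_apply]
        field_simp
        ring
      apply Subset.antisymm
      · rintro _ ⟨l, rfl⟩
        obtain ⟨l', h⟩ := key γ g l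
        exact ⟨l', h.symm⟩
      · rintro _ ⟨l, rfl⟩
        obtain ⟨l', h⟩ := key γ⁻¹ (SAff.intCast γ * g) l
        rw [← mul_assoc, ← map_mul, inv_mul_cancel, map_one, one_mul] at h
        exact ⟨l', h.symm⟩)

/-- The `M`-relative Siegel–Veech transform of `f`. -/
def SVrel (M : ℕ+) (f : (Fin 2 → ℝ) → ℂ) (x : H00) : ℂ := ∑' w : config M x, f w

/-- Smooth compactly supported functions `f : ℝ² → ℂ` with mean zero. -/
def IsTestFunction (f : (Fin 2 → ℝ) → ℂ) : Prop :=
  ContDiff ℝ ∞ f ∧ HasCompactSupport f ∧ ∫ w, f w = 0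

/-- The closed span in `L²(H(0,0))` of the `M`-relative Siegel–Veech transforms of smooth
compactly supported mean-zero functions. -/
def SVspan (M : ℕ+) : Submodule ℂ L2H00 :=
  (Submodule.span ℂ {F : L2H00 | ∃ f, IsTestFunction f ∧ F =ᵐ[muMV] SVrel M f}).topologicalClosure

/-- The closed span of the union over all `M ≥ 1` of the spaces `SVspan M`. -/
def SVspanAll : Submodule ℂ L2H00 :=
  (Submodule.span ℂ (⋃ M : ℕ+, (SVspan M : Set L2H00))).topologicalClosure

end TwoPointTori

end

open TwoPointTori

noncomputable section

open MeasureTheory Set UpperHalfPlane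
open scoped Pointwise MatrixGroups ContDiff ENNReal ComplexConjugate

namespace TwoPointTori

/-! Over a point h of SL₂(ℤ)\SL₂(ℝ) the fibre of H(0,0) is a torus, on which F has Fourier
coefficients `co F ξ h`, ξ ∈ ℤ². The lattice moves frequency and base point together
(`co_smul_smul`), and F is genuine exactly when the coefficient at ξ = 0 vanishes almost everywhere
(`mem_genuinePart_iff`). Every nonzero frequency lies in the orbit of exactly one (d, 0) with d ≥ 1,
whose stabiliser is {Tⁿ}. Parseval on the fibres followed by unfolding therefore turns scalar
products with genuine functions into sums over d of integrals over the strip 0 ≤ Re(h·i) < 1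
(`integral_conj_mul_eq_tsum`). Coordinates on the strip are x = Re(h·i) and the bottom row v ∈ ℂ of
h, in which Haar measure is 2 dx dv.

By Poisson summation the coefficient of `SVrel M f` at (d, 0) is M² f̂(dv) if M ∣ d and 0 otherwise
(`co_SVrel_freq`). It does not depend on x, so a pairing with a genuine F sees only the constant
terms c_d(v) = ∫₀¹ co F (d, 0) dx and equals 2M² Σ_{M∣d} ∫ conj(f̂(dv)) c_d(v) dv. If this vanishes
for all M, a sieve over multiples isolates each d (`eq_zero_of_sums_over_multiples`). Plancherel
then gives c_d = 0, because an L² function on the plane that annihilates all mean-zero test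
functions is constant, hence zero (`ae_eq_zero_of_forall_fourier`). So a genuine F is orthogonal to
all Siegel–Veech transforms if and only if all its c_d vanish.

For the lift of a φ of weight k, c_d at v = e^{iθ}/√y is a nonzero automorphy factor times c^{H0}(φ;
0, d; y) (`ae_constTerm_iff`). Hence cusp forms are orthogonal to the Siegel–Veech transforms. For
the sum to be everything, let F be genuine and orthogonal to both spaces. Its isotypic components
`ktype k F` under rotations are again genuine and orthogonal to the Siegel–Veech transforms, since
both conditions are rotation invariant; being lifts of functions of weight k, they are cuspidal. As
`ktype k` is an orthogonal projection and F is orthogonal to its own components, all of them vanish,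
and F = 0 (`ae_eq_zero_of_ktype`). -/

/-! ### Measurability in `SL₂(ℝ)` and `SAff₂(ℝ)` -/

theorem measurable_entry (i j : Fin 2) : Measurable fun g : SL(2, ℝ) => g i j :=
  (measurable_pi_apply j).comp ((measurable_pi_apply i).comp
    (comap_measurable fun g : SL(2, ℝ) => fun (i j : Fin 2) => g i j))

theorem measurable_SL_of_entries {α : Type*} [MeasurableSpace α] {f : α → SL(2, ℝ)}
    (h : ∀ i j, Measurable fun x => f x i j) : Measurable f := by
  rw [measurable_comap_iff]
  exact measurable_pi_lambda _ fun i => measurable_pi_lambda _ fun j => h i j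

instance : MeasurableMul₂ SL(2, ℝ) where
  measurable_mul := by
    refine measurable_SL_of_entries fun i j => ?_
    have : (fun x : SL(2, ℝ) × SL(2, ℝ) => (x.1 * x.2) i j) =
        fun x => x.1 i 0 * x.2 0 j + x.1 i 1 * x.2 1 j := by
      ext x
      rw [Matrix.SpecialLinearGroup.coe_mul, Matrix.mul_apply, Fin.sum_univ_two]
    change Measurable fun x : SL(2, ℝ) × SL(2, ℝ) => (x.1 * x.2) i j
    rw [this]
    exact (((measurable_entry i 0).comp measurable_fst).mul
      ((measurable_entry 0 j).comp measurable_snd)).add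
      (((measurable_entry i 1).comp measurable_fst).mul
      ((measurable_entry 1 j).comp measurable_snd))

theorem measurable_lin : Measurable (SAff.lin : SAff ℝ → SL(2, ℝ)) :=
  measurable_fst.comp (comap_measurable fun g : SAff ℝ => (g.lin, g.trans))

theorem measurable_trans : Measurable (SAff.trans : SAff ℝ → Fin 2 → ℝ) :=
  measurable_snd.comp (comap_measurable fun g : SAff ℝ => (g.lin, g.trans))

theorem measurable_SAff_of {α : Type*} [MeasurableSpace α] {f : α → SAff ℝ}
    (h1 : Measurable fun x => (f x).lin) (h2 : Measurable fun x => (f x).trans) :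
    Measurable f := by
  rw [measurable_comap_iff]
  exact h1.prodMk h2

theorem measurable_vecMul : Measurable fun x : (Fin 2 → ℝ) × SL(2, ℝ) =>
    Matrix.vecMul x.1 (x.2 : Matrix (Fin 2) (Fin 2) ℝ) := by
  refine measurable_pi_lambda _ fun i => ?_
  have : (fun x : (Fin 2 → ℝ) × SL(2, ℝ) => Matrix.vecMul x.1 (x.2 : Matrix (Fin 2) (Fin 2) ℝ) i) =
      fun x => x.1 0 * x.2 0 i + x.1 1 * x.2 1 i := by
    ext x
    simp [Matrix.vecMul, dotProduct, Fin.sum_univ_two]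
  rw [this]
  exact (((measurable_pi_apply 0).comp measurable_fst).mul
      ((measurable_entry 0 i).comp measurable_snd)).add
      (((measurable_pi_apply 1).comp measurable_fst).mul
      ((measurable_entry 1 i).comp measurable_snd))

instance : MeasurableMul₂ (SAff ℝ) where
  measurable_mul := by
    refine measurable_SAff_of ?_ ?_
    · exact (measurable_lin.comp measurable_fst).mul (measurable_lin.comp measurable_snd)
    · exact (measurable_vecMul.comp ((measurable_trans.comp measurable_fst).prodMk
        (measurable_lin.comp measurable_snd))).add (measurable_trans.comp measurable_snd)

theorem measurable_ofSL : Measurable (SAff.ofSL : SL(2, ℝ) → SAff ℝ) :=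
  measurable_SAff_of measurable_id measurable_const

theorem measurable_ofVec : Measurable (SAff.ofVec : (Fin 2 → ℝ) → SAff ℝ) :=
  measurable_SAff_of measurable_const measurable_id

theorem measurable_rot : Measurable rot := by
  refine measurable_SL_of_entries fun i j => ?_
  fin_cases i <;> fin_cases j <;> simp [rot] <;> fun_prop

theorem measurable_toSL2R : Measurable toSL2R := by
  have hre : Measurable fun t : ℍ => t.re := UpperHalfPlane.continuous_re.measurable
  have him : Measurable fun t : ℍ => t.im := UpperHalfPlane.continuous_im.measurable
  refine measurable_SL_of_entries fun i j => ?_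
  fin_cases i <;> fin_cases j <;> simp [coe_toSL2R] <;> fun_prop

/-! ### The Iwasawa decomposition of `SL₂(ℝ)` -/

/-- The element `n(x) a(√y) k(θ)` of `SL₂(ℝ)`, where `τ = x + iy`. -/
def iwa (τ : ℍ) (θ : ℝ) : SL(2, ℝ) := τ.toSL2R * rot θ

/-- The bottom row of a matrix, as the complex number `d - ic`. -/
def bot (h : SL(2, ℝ)) : ℂ := ⟨h 1 1, -h 1 0⟩

theorem measurable_iwa : Measurable fun t : ℍ × ℝ => iwa t.1 t.2 :=
  (measurable_toSL2R.comp measurable_fst).mul (measurable_rot.comp measurable_snd)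

theorem measurable_bot : Measurable bot := by
  have : bot = fun h => (h 1 1 : ℂ) - (h 1 0 : ℂ) * Complex.I := by
    ext h
    apply Complex.ext <;> simp [bot]
  rw [this]
  exact (Complex.measurable_ofReal.comp (measurable_entry 1 1)).sub
    ((Complex.measurable_ofReal.comp (measurable_entry 1 0)).mul_const _)

theorem rot_add (a b : ℝ) : rot (a + b) = rot a * rot b := by
  ext i j
  rw [Matrix.SpecialLinearGroup.coe_mul, Matrix.mul_apply, Fin.sum_univ_two]
  fin_cases i <;> fin_cases j <;> simp [rot, Real.cos_add, Real.sin_add] <;> ring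

theorem rot_zero : rot 0 = 1 := by
  ext i j
  fin_cases i <;> fin_cases j <;> simp [rot]

theorem rot_periodic : Function.Periodic rot (2 * Real.pi) := by
  intro θ
  ext i j
  fin_cases i <;> fin_cases j <;> simp [rot]

theorem iwa_mul_rot (τ : ℍ) (a b : ℝ) : iwa τ a * rot b = iwa τ (a + b) := by
  rw [iwa, iwa, rot_add, mul_assoc]

theorem iwa_periodic (τ : ℍ) : Function.Periodic (iwa τ) (2 * Real.pi) := fun θ => by
  rw [iwa, iwa, rot_periodic]

/-- The sign in `bot` is chosen so that a rotation on the right becomes multiplication by a unit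
complex number; the angle of the Iwasawa decomposition is then the argument of `bot`. -/
theorem bot_mul_rot (h : SL(2, ℝ)) (θ : ℝ) :
    bot (h * rot θ) = bot h * Complex.exp (θ * Complex.I) := by
  have h1 : ∀ j, (h * rot θ) 1 j = h 1 0 * rot θ 0 j + h 1 1 * rot θ 1 j := fun j => by
    rw [Matrix.SpecialLinearGroup.coe_mul, Matrix.mul_apply, Fin.sum_univ_two]
  rw [Complex.exp_mul_I, ← Complex.ofReal_cos, ← Complex.ofReal_sin]
  simp only [bot, h1]
  apply Complex.ext <;> simp [rot, -Complex.ofReal_cos, -Complex.ofReal_sin] <;> ring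

theorem denom_I (h : SL(2, ℝ)) : denom h I = conj (bot h) := by
  apply Complex.ext <;> simp [denom, bot]

theorem rot_smul_I (θ : ℝ) : rot θ • I = I := by
  ext
  have h0 := denom_ne_zero (rot θ : GL (Fin 2) ℝ) I
  rw [coe_specialLinearGroup_apply]
  simp only [denom] at h0
  rw [div_eq_iff (by simpa using h0)]
  apply Complex.ext <;> simp [rot]

theorem iwa_smul_I (τ : ℍ) (θ : ℝ) : iwa τ θ • I = τ := by
  rw [iwa, mul_smul, rot_smul_I, toSL2R_smul_I]

theorem bot_iwa (τ : ℍ) (θ : ℝ) :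
    bot (iwa τ θ) = ((√τ.im)⁻¹ : ℝ) * Complex.exp (θ * Complex.I) := by
  rw [iwa, bot_mul_rot]
  congr 1
  apply Complex.ext <;> simp [bot]

theorem bot_ne_zero (h : SL(2, ℝ)) : bot h ≠ 0 := by
  have := denom_ne_zero (h : GL (Fin 2) ℝ) I
  rw [denom_I] at this
  simpa using this

theorem norm_bot_sq (h : SL(2, ℝ)) : ‖bot h‖ ^ 2 = (h • I).im⁻¹ := by
  have h1 : (h • I).im = I.im / Complex.normSq (denom h I) := by
    have := im_smul_eq_div_normSq (h : GL (Fin 2) ℝ) I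
    simpa using! this
  rw [h1, denom_I, Complex.normSq_conj, Complex.normSq_eq_norm_sq]
  simp

/-- The bottom row is the denominator of h·i, so multiplying h·i by it recovers the numerator, which
is the top row. -/
theorem SL_ext_of_smul_I_of_bot {g h : SL(2, ℝ)} (h1 : g • I = h • I) (h2 : bot g = bot h) :
    g = h := by
  have e1 := congrArg Complex.re h2
  have e2 := congrArg Complex.im h2
  simp only [bot] at e1 e2
  have key : ∀ k : SL(2, ℝ), (k 0 0 : ℂ) * Complex.I + k 0 1 =
      ((k • I : ℍ) : ℂ) * (k 1 0 * Complex.I + k 1 1) := by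
    intro k
    have h0 := denom_ne_zero (k : GL (Fin 2) ℝ) I
    simp only [denom] at h0
    rw [coe_specialLinearGroup_apply]
    exact (div_mul_cancel₀ _ h0).symm
  have k1 := key g
  rw [h1, e1, neg_inj.mp e2, ← key h] at k1
  have r := congrArg Complex.re k1
  have i := congrArg Complex.im k1
  simp at r i
  ext a b
  fin_cases a <;> fin_cases b
  · exact i
  · exact r
  · exact neg_inj.mp e2
  · exact e1

theorem eq_iwa (h : SL(2, ℝ)) : h = iwa (h • I) (Complex.arg (bot h)) := by
  refine SL_ext_of_smul_I_of_bot (iwa_smul_I _ _).symm ?_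
  rw [bot_iwa]
  conv_lhs => rw [← Complex.norm_mul_exp_arg_mul_I (bot h)]
  congr 2
  rw [← Real.sqrt_inv, ← norm_bot_sq, Real.sqrt_sq (norm_nonneg _)]

/-- Left translation acts on the base point and shifts the angle by an amount independent of θ.
Invariance of `muSL` thus reduces to invariance of dx dy / y² and of dθ on the circle. -/
theorem mul_iwa (g : SL(2, ℝ)) (τ : ℍ) :
    ∃ α, ∀ θ, g * iwa τ θ = iwa (g • τ) (α + θ) := by
  refine ⟨Complex.arg (bot (g * iwa τ 0)), fun θ => ?_⟩
  have h1 := eq_iwa (g * iwa τ 0)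
  rw [mul_smul, iwa_smul_I] at h1
  rw [← iwa_mul_rot, ← h1, mul_assoc, iwa_mul_rot, zero_add]

/-! ### The invariant measure on `SL₂(ℝ)` -/

/-- Haar measure `dx dy dθ / y²` on `SL₂(ℝ)`. -/
def muSL : Measure SL(2, ℝ) :=
  Measure.map (fun t : ℍ × ℝ => iwa t.1 t.2)
    (volume.prod (volume.restrict (Ioc (-Real.pi) Real.pi)))

instance : SFinite muSL := by unfold muSL; infer_instance

theorem lintegral_muSL {f : SL(2, ℝ) → ℝ≥0∞} (hf : Measurable f) :
    ∫⁻ h, f h ∂muSL = ∫⁻ τ : ℍ, ∫⁻ θ in Ioc (-Real.pi) Real.pi, f (iwa τ θ) := by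
  rw [muSL, lintegral_map hf measurable_iwa, lintegral_prod]
  exact (hf.comp measurable_iwa).aemeasurable

theorem lintegral_periodic_shift {u : ℝ → ℝ≥0∞} (hu : Function.Periodic u (2 * Real.pi)) (α : ℝ) :
    ∫⁻ θ in Ioc (-Real.pi) Real.pi, u (α + θ) = ∫⁻ θ in Ioc (-Real.pi) Real.pi, u θ := by
  have hp : (0 : ℝ) < 2 * Real.pi := by positivity
  have h1 := (isAddFundamentalDomain_Ioc hp (α - Real.pi)).setLIntegral_eq
    (isAddFundamentalDomain_Ioc hp (-Real.pi)) u (by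
      rintro ⟨_, n, rfl⟩ x
      simpa [add_comm, AddSubgroup.vadd_def] using hu.zsmul n x)
  have e1 : α - Real.pi + 2 * Real.pi = α + Real.pi := by ring
  have e2 : -Real.pi + 2 * Real.pi = Real.pi := by ring
  rw [e1, e2] at h1
  rw [← h1]
  have h2 := (measurePreserving_add_left volume α).setLIntegral_comp_emb
    (measurableEmbedding_addLeft α) u (Ioc (-Real.pi) Real.pi)
  rw [h2]
  congr 2
  simp [sub_eq_add_neg, add_comm]

theorem measurePreserving_SL_smul (g : SL(2, ℝ)) :
    MeasurePreserving (fun τ : ℍ => g • τ) volume volume :=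
  measurePreserving_smul (g : GL (Fin 2) ℝ) (volume : Measure ℍ)

theorem measurePreserving_of_lintegral {α : Type*} [MeasurableSpace α] {μ : Measure α}
    {T : α → α} (hT : Measurable T)
    (h : ∀ f : α → ℝ≥0∞, Measurable f → ∫⁻ x, f (T x) ∂μ = ∫⁻ x, f x ∂μ) :
    MeasurePreserving T μ μ := by
  refine ⟨hT, Measure.ext_of_lintegral _ fun f hf => ?_⟩
  rw [lintegral_map hf hT, h f hf]

theorem measurePreserving_muSL_mul_left (g : SL(2, ℝ)) :
    MeasurePreserving (fun h => g * h) muSL muSL := by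
  refine measurePreserving_of_lintegral (measurable_const_mul g) fun f hf => ?_
  rw [lintegral_muSL (f := fun h => f (g * h)) (hf.comp (measurable_const_mul g)),
    lintegral_muSL hf,
    ← (measurePreserving_SL_smul g).lintegral_comp (f := fun τ : ℍ =>
      ∫⁻ θ in Ioc (-Real.pi) Real.pi, f (iwa τ θ))
      (Measurable.lintegral_prod_right (hf.comp measurable_iwa))]
  refine lintegral_congr fun τ => ?_
  obtain ⟨α, hα⟩ := mul_iwa g τ
  simp_rw [hα]
  exact lintegral_periodic_shift (u := fun θ => f (iwa (g • τ) θ))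
    (fun θ => congrArg f (iwa_periodic _ θ)) α

theorem measurePreserving_muSL_mul_rot (α : ℝ) :
    MeasurePreserving (fun h => h * rot α) muSL muSL := by
  refine measurePreserving_of_lintegral (measurable_mul_const _) fun f hf => ?_
  rw [lintegral_muSL (f := fun h => f (h * rot α)) (hf.comp (measurable_mul_const _)),
    lintegral_muSL hf]
  refine lintegral_congr fun τ => ?_
  simp_rw [iwa_mul_rot, add_comm _ α]
  exact lintegral_periodic_shift (u := fun θ => f (iwa τ θ))
    (fun θ => congrArg f (iwa_periodic _ θ)) α

/-! ### The action of the modular group on `SL₂(ℝ)` and its fundamental domain -/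

/-- The inclusion `SL₂(ℤ) → SL₂(ℝ)`. -/
abbrev castSL : SL(2, ℤ) →* SL(2, ℝ) := Matrix.SpecialLinearGroup.map (Int.castRingHom ℝ)

instance : MulAction SL(2, ℤ) SL(2, ℝ) := MulAction.compHom _ castSL

theorem modular_smul_def (γ : SL(2, ℤ)) (h : SL(2, ℝ)) : γ • h = castSL γ * h := rfl

instance : Countable SL(2, ℤ) := by
  have : Countable (Matrix (Fin 2) (Fin 2) ℤ) :=
    inferInstanceAs (Countable (Fin 2 → Fin 2 → ℤ))
  exact Subtype.countable

instance : MeasurableConstSMul SL(2, ℤ) SL(2, ℝ) where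
  measurable_const_smul γ := measurable_const_mul (castSL γ)

instance : SMulInvariantMeasure SL(2, ℤ) SL(2, ℝ) muSL where
  measure_preimage_smul γ _ hs :=
    (measurePreserving_muSL_mul_left (castSL γ)).measure_preimage hs.nullMeasurableSet

theorem castSL_smul (γ : SL(2, ℤ)) (τ : ℍ) : castSL γ • τ = γ • τ := by
  ext
  rw [coe_specialLinearGroup_apply, coe_specialLinearGroup_apply]
  simp

theorem modular_smul_smul_I (γ : SL(2, ℤ)) (h : SL(2, ℝ)) : (γ • h) • I = γ • (h • I) := by
  rw [modular_smul_def, mul_smul, castSL_smul]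

theorem measurable_smul_I : Measurable fun h : SL(2, ℝ) => h • I := by
  rw [measurable_comap_iff]
  have : (fun h : SL(2, ℝ) => ((h • I : ℍ) : ℂ)) = fun h =>
      ((h 0 0 : ℂ) * Complex.I + h 0 1) / ((h 1 0 : ℂ) * Complex.I + h 1 1) := by
    ext1 h
    rw [coe_specialLinearGroup_apply]
    rfl
  have hm : ∀ i j, Measurable fun h : SL(2, ℝ) => (h i j : ℂ) := fun i j =>
    Complex.measurable_ofReal.comp (measurable_entry i j)
  change Measurable fun h : SL(2, ℝ) => ((h • I : ℍ) : ℂ)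
  rw [this]
  exact (((hm 0 0).mul_const _).add (hm 0 1)).div (((hm 1 0).mul_const _).add (hm 1 1))

/-- The fundamental domain of `SL₂(ℤ)` in `SL₂(ℝ)` corresponding to `𝒟 × [0, π)` in Iwasawa
coordinates. -/
def domSL : Set SL(2, ℝ) :=
  {h | h • I ∈ ModularGroup.fd ∧ (h 1 0 < 0 ∨ (h 1 0 = 0 ∧ 0 < h 1 1))}

theorem measurableSet_domSL : MeasurableSet domSL := by
  have h1 : MeasurableSet ((fun h : SL(2, ℝ) => h • I) ⁻¹' ModularGroup.fd) :=
    measurable_smul_I ModularGroup.isClosed_fd.measurableSet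
  have h2 : MeasurableSet {h : SL(2, ℝ) | h 1 0 < 0} :=
    measurableSet_lt (measurable_entry 1 0) measurable_const
  have h3 : MeasurableSet {h : SL(2, ℝ) | h 1 0 = 0} :=
    measurableSet_eq_fun (measurable_entry 1 0) measurable_const
  have h4 : MeasurableSet {h : SL(2, ℝ) | 0 < h 1 1} :=
    measurableSet_lt measurable_const (measurable_entry 1 1)
  exact h1.inter (h2.union (h3.inter h4))

theorem volume_fd_diff_fdo : volume (ModularGroup.fd \ ModularGroup.fdo) = 0 := by
  rw [volume_eq_lintegral]
  refine setLIntegral_measure_zero _ _ (measure_mono_null (t := Metric.sphere (0 : ℂ) 1 ∪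
    ((fun z : ℂ => z.re) ⁻¹' {1 / 2} ∪ (fun z : ℂ => z.re) ⁻¹' {-1 / 2})) ?_ ?_)
  · rintro _ ⟨τ, ⟨⟨h1, h2⟩, h3⟩, rfl⟩
    by_contra hc
    simp only [mem_union, mem_sphere_iff_norm, sub_zero, mem_preimage, mem_singleton_iff,
      not_or] at hc
    obtain ⟨hc1, hc2, hc3⟩ := hc
    refine h3 ⟨lt_of_le_of_ne h1 fun h => hc1 ?_, lt_of_le_of_ne h2 fun h => ?_⟩
    · rw [Complex.normSq_eq_norm_sq] at h
      nlinarith [norm_nonneg (τ : ℂ)]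
    · rcases abs_eq (by norm_num : (0 : ℝ) ≤ 1 / 2) |>.mp h with h | h
      · exact hc2 h
      · exact hc3 (by rw [coe_re, h]; norm_num)
  · have : ∀ c : ℝ, volume ((fun z : ℂ => z.re) ⁻¹' {c}) = 0 := by
      intro c
      have h := Complex.volume_preserving_equiv_real_prod.measure_preimage
        (s := {c} ×ˢ univ) ((measurableSet_singleton c).prod MeasurableSet.univ).nullMeasurableSet
      rw [Measure.volume_eq_prod, Measure.prod_prod] at h
      simp only [Real.volume_singleton, zero_mul] at h
      convert h using 2
      ext z; simp
    rw [measure_union_null_iff, measure_union_null_iff]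
    exact ⟨Measure.addHaar_sphere _ _ _, this _, this _⟩

theorem muSL_preimage_smul_I_null {N : Set ℍ} (hN : MeasurableSet N) (h0 : volume N = 0) :
    muSL ((fun h : SL(2, ℝ) => h • I) ⁻¹' N) = 0 := by
  have hm := measurable_smul_I hN
  rw [← lintegral_indicator_one hm, lintegral_muSL (measurable_one.indicator hm)]
  have : ∀ τ : ℍ, ∀ θ, ((fun h : SL(2, ℝ) => h • I) ⁻¹' N).indicator (1 : SL(2, ℝ) → ℝ≥0∞)
      (iwa τ θ) = N.indicator 1 τ := by
    intro τ θ
    have : iwa τ θ ∈ (fun h : SL(2, ℝ) => h • I) ⁻¹' N ↔ τ ∈ N := by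
      rw [mem_preimage, iwa_smul_I]
    by_cases h : τ ∈ N
    · rw [indicator_of_mem h, indicator_of_mem (this.mpr h), Pi.one_apply, Pi.one_apply]
    · rw [indicator_of_notMem h, indicator_of_notMem fun hh => h (this.mp hh)]
  simp_rw [this]
  simp only [lintegral_const]
  rw [lintegral_mul_const _ (measurable_one.indicator hN), lintegral_indicator_one hN, h0, zero_mul]

/-- γ and -γ move the base point in the same way; the sign condition on the bottom row selects one
of the two. -/
theorem exists_smul_mem_domSL (h : SL(2, ℝ)) : ∃ γ : SL(2, ℤ), γ • h ∈ domSL := by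
  obtain ⟨γ, hγ⟩ := ModularGroup.exists_smul_mem_fd (h • I)
  rw [← modular_smul_smul_I] at hγ
  by_cases hh : (γ • h) 1 0 < 0 ∨ ((γ • h) 1 0 = 0 ∧ 0 < (γ • h) 1 1)
  · exact ⟨γ, hγ, hh⟩
  · have hneg : (-γ) • h = -(γ • h) := by
      rw [modular_smul_def, modular_smul_def]
      ext i j
      simp
    refine ⟨-γ, ?_, ?_⟩
    · rw [modular_smul_smul_I] at hγ ⊢
      rwa [ModularGroup.SL_neg_smul]
    · rw [hneg]
      have hb := bot_ne_zero (γ • h)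
      simp only [Matrix.SpecialLinearGroup.coe_neg, Matrix.neg_apply]
      by_contra hc
      push Not at hh hc
      apply hb
      have h0 : (γ • h) 1 0 = 0 := by linarith [hh.1, hc.1]
      have := hh.2 h0
      have := hc.2 (by rw [h0, neg_zero])
      have h1 : (γ • h) 1 1 = 0 := by linarith
      apply Complex.ext
      · exact h1
      · simp [bot, h0]

/-- Overlaps of translates lie over the null boundary of the modular domain: over the interior only
±1 can return to it, and -1 reverses the sign of the bottom row. -/
theorem isFundamentalDomain_domSL : IsFundamentalDomain SL(2, ℤ) domSL muSL := by
  refine IsFundamentalDomain.mk'' measurableSet_domSL.nullMeasurableSet ?_ ?_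
    fun γ => (measurePreserving_muSL_mul_left (castSL γ)).quasiMeasurePreserving
  · exact Filter.Eventually.of_forall exists_smul_mem_domSL
  · intro γ hγ
    refine measure_mono_null ?_ (muSL_preimage_smul_I_null
      (ModularGroup.isClosed_fd.measurableSet.diff ModularGroup.isOpen_fdo.measurableSet)
      volume_fd_diff_fdo)
    rintro _ ⟨⟨h, hh, rfl⟩, hh'⟩
    refine ⟨hh'.1, fun ho => ?_⟩
    have h1 : γ⁻¹ • ((γ • h) • I) = h • I := by
      rw [modular_smul_smul_I, inv_smul_smul]
    rcases ModularGroup.eq_one_or_neg_one_of_mem_fdo_mem_fd ho (h1 ▸ hh.1) with h2 | h2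
    · exact hγ (inv_eq_one.mp h2)
    · have h3 : γ = -1 := by rw [← inv_inv γ, h2]; simp
      subst h3
      have hneg : ((-1 : SL(2, ℤ)) • h) = -h := by
        rw [modular_smul_def]
        ext i j
        simp
      have e := hh'.2
      simp only [hneg, Matrix.SpecialLinearGroup.coe_neg, Matrix.neg_apply] at e
      rcases hh.2 with h4 | ⟨h4, h5⟩ <;> rcases e with h6 | ⟨h6, h7⟩ <;> linarith

/-! ### Unfolding -/

instance : SMulInvariantMeasure SL(2, ℤ) (Fin 2 → ℤ) Measure.count where
  measure_preimage_smul γ s _ := by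
    have : (fun x : Fin 2 → ℤ => γ • x) ⁻¹' s = (MulAction.toPerm γ).symm '' s :=
      ((MulAction.toPerm γ).image_symm_eq_preimage s).symm
    rw [this, Measure.count_injective_image (MulAction.toPerm γ).symm.injective]

instance : MeasurableConstSMul SL(2, ℤ) (Fin 2 → ℤ) where
  measurable_const_smul _ := measurable_of_countable _

/-- The product of the Haar measure on `SL₂(ℝ)` with counting measure on `ℤ²`. -/
abbrev muFreq : Measure (SL(2, ℝ) × (Fin 2 → ℤ)) := muSL.prod Measure.count

instance : SMulInvariantMeasure SL(2, ℤ) (SL(2, ℝ) × (Fin 2 → ℤ)) muFreq where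
  measure_preimage_smul γ _ hs :=
    ((measurePreserving_smul γ muSL).prod
      (measurePreserving_smul γ (Measure.count : Measure (Fin 2 → ℤ)))).measure_preimage
        hs.nullMeasurableSet

instance : MeasurableConstSMul SL(2, ℤ) (SL(2, ℝ) × (Fin 2 → ℤ)) where
  measurable_const_smul γ := (measurable_const_smul γ).prodMap (measurable_const_smul γ)

theorem muFreq_domSL_inter {γ : SL(2, ℤ)} (hγ : γ ≠ 1) :
    muFreq (((γ • domSL) ∩ domSL) ×ˢ (univ : Set (Fin 2 → ℤ))) = 0 := by
  have h := isFundamentalDomain_domSL.aedisjoint hγ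
  simp only [Function.onFun, one_smul] at h
  rw [Measure.prod_prod, h, zero_mul]

theorem isFundamentalDomain_domSL_prod :
    IsFundamentalDomain SL(2, ℤ) (domSL ×ˢ (univ : Set (Fin 2 → ℤ))) muFreq := by
  refine IsFundamentalDomain.mk'' (measurableSet_domSL.prod MeasurableSet.univ).nullMeasurableSet
    (Filter.Eventually.of_forall fun x => ?_) ?_
    fun γ => (measurePreserving_smul γ muFreq).quasiMeasurePreserving
  · obtain ⟨γ, hγ⟩ := exists_smul_mem_domSL x.1
    exact ⟨γ, hγ, mem_univ _⟩
  · intro γ hγ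
    refine measure_mono_null (t := ((γ • domSL) ∩ domSL) ×ˢ univ) ?_ ?_
    · rintro _ ⟨⟨x, hx, rfl⟩, hx'⟩
      exact ⟨⟨⟨x.1, hx.1, rfl⟩, hx'.1⟩, mem_univ _⟩
    · exact muFreq_domSL_inter hγ

/-- The fundamental domain `0 ≤ Re τ < 1` for the group of integral upper unipotent matrices. -/
def stripSL : Set SL(2, ℝ) := {h | (h • I).re ∈ Ico 0 1}

theorem measurableSet_stripSL : MeasurableSet stripSL :=
  (UpperHalfPlane.continuous_re.measurable.comp measurable_smul_I) measurableSet_Ico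

/-- The vector `(d, 0)`. -/
def freq (d : ℕ+) : Fin 2 → ℤ := ![d, 0]

theorem freq_injective : Function.Injective freq := fun a b h => by
  have := congrFun h 0
  simpa [freq] using this

theorem freq_ne_zero (d : ℕ+) : freq d ≠ 0 := fun h => by
  have := congrFun h 0
  simp [freq] at this

theorem T_zpow_smul_freq (n : ℤ) (d : ℕ+) : (ModularGroup.T ^ n) • freq d = freq d := by
  change Matrix.mulVec ((ModularGroup.T ^ n : SL(2, ℤ)) : Matrix (Fin 2) (Fin 2) ℤ) (freq d) = _
  rw [ModularGroup.coe_T_zpow]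
  ext i
  fin_cases i <;> simp [freq]

theorem exists_smul_eq_freq {ξ : Fin 2 → ℤ} (hξ : ξ ≠ 0) :
    ∃ (γ : SL(2, ℤ)) (d : ℕ+), γ • ξ = freq d := by
  have hg : 0 < Int.gcd (ξ 0) (ξ 1) := by
    rw [Int.gcd_pos_iff]
    by_contra hc
    push Not at hc
    exact hξ (by ext i; fin_cases i; exacts [hc.1, hc.2])
  obtain ⟨m, hm⟩ := Int.gcd_dvd_left (ξ 0) (ξ 1)
  obtain ⟨n, hn⟩ := Int.gcd_dvd_right (ξ 0) (ξ 1)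
  have hb := Int.gcd_eq_gcd_ab (ξ 0) (ξ 1)
  set d := Int.gcd (ξ 0) (ξ 1)
  set u := Int.gcdA (ξ 0) (ξ 1)
  set v := Int.gcdB (ξ 0) (ξ 1)
  have hd : (d : ℤ) ≠ 0 := by exact_mod_cast hg.ne'
  have huv : u * m + v * n = 1 := by
    apply mul_left_cancel₀ hd
    calc (d : ℤ) * (u * m + v * n) = (d * m) * u + (d * n) * v := by ring
      _ = d * 1 := by rw [← hm, ← hn, ← hb, mul_one]
  -- The Bézout relation u ξ₀ + v ξ₁ = d is the top row; the bottom row annihilates ξ = d (m, n).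
  refine ⟨⟨!![u, v; -n, m], by rw [Matrix.det_fin_two_of]; linarith⟩, ⟨d, hg⟩, ?_⟩
  change Matrix.mulVec !![u, v; -n, m] ξ = _
  ext i
  fin_cases i
  · simp [freq, Matrix.mulVec, dotProduct, Fin.sum_univ_two]
    rw [hb]; ring
  · simp [freq, Matrix.mulVec, dotProduct, Fin.sum_univ_two]
    rw [hm, hn]; ring

/-- The lower left entry must vanish, so the diagonal is ±(1, 1), and positivity of d and d'
excludes the minus sign. -/
theorem eq_T_zpow_of_smul_freq {γ : SL(2, ℤ)} {d d' : ℕ+} (h : γ • freq d = freq d') :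
    ∃ n : ℤ, γ = ModularGroup.T ^ n := by
  have h0 := congrFun h 0
  have h1 := congrFun h 1
  change Matrix.mulVec (γ : Matrix (Fin 2) (Fin 2) ℤ) (freq d) _ = _ at h0 h1
  simp [freq, Matrix.mulVec, dotProduct, Fin.sum_univ_two] at h0 h1
  have hdet := γ.det_coe
  rw [Matrix.det_fin_two, h1, mul_zero, sub_zero] at hdet
  have ha : 0 < γ 0 0 := by
    have h2 : (0 : ℤ) < d := by exact_mod_cast d.pos
    have h3 : (0 : ℤ) < d' := by exact_mod_cast d'.pos
    rw [← h0] at h3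
    exact pos_of_mul_pos_left h3 h2.le
  have ha1 : γ 0 0 = 1 := by
    rcases Int.mul_eq_one_iff_eq_one_or_neg_one.mp hdet with h | h
    · exact h.1
    · linarith [h.1]
  rw [ha1, one_mul] at hdet
  refine ⟨γ 0 1, ?_⟩
  ext i j
  rw [ModularGroup.coe_T_zpow]
  fin_cases i <;> fin_cases j <;> simp [*]

/-- A fundamental domain for the diagonal action of `SL₂(ℤ)` on `SL₂(ℝ) × ℤ²`. -/
def freqDom : Set (SL(2, ℝ) × (Fin 2 → ℤ)) :=
  (domSL ×ˢ {0}) ∪ (stripSL ×ˢ range freq)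

theorem measurableSet_freqDom : MeasurableSet freqDom :=
  (measurableSet_domSL.prod (measurableSet_singleton _)).union
    (measurableSet_stripSL.prod (countable_range _).measurableSet)

/-- Each orbit of frequencies contributes a fundamental domain for the stabiliser of its
representative: all of SL₂(ℤ) for 0, the powers of T for (d, 0). -/
theorem isFundamentalDomain_freqDom : IsFundamentalDomain SL(2, ℤ) freqDom muFreq := by
  refine IsFundamentalDomain.mk'' measurableSet_freqDom.nullMeasurableSet
    (Filter.Eventually.of_forall fun x => ?_) ?_
    fun γ => (measurePreserving_smul γ muFreq).quasiMeasurePreserving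
  · rcases eq_or_ne x.2 0 with h0 | h0
    · obtain ⟨γ, hγ⟩ := exists_smul_mem_domSL x.1
      exact ⟨γ, Or.inl ⟨hγ, by simp [h0]⟩⟩
    · obtain ⟨γ, d, hγ⟩ := exists_smul_eq_freq h0
      refine ⟨ModularGroup.T ^ (-⌊((γ • x.1) • I).re⌋) * γ, Or.inr ⟨?_, d, ?_⟩⟩
      · simp only [stripSL, mem_ofPred_eq, Prod.smul_fst, mul_smul]
        rw [modular_smul_smul_I, ModularGroup.re_T_zpow_smul]
        have h1 := Int.floor_le ((γ • x.1) • I).re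
        have h2 := Int.lt_floor_add_one ((γ • x.1) • I).re
        push_cast
        exact ⟨by linarith, by linarith⟩
      · rw [Prod.smul_snd, mul_smul, hγ, T_zpow_smul_freq]
  · intro γ hγ
    refine measure_mono_null (t := ((γ • domSL) ∩ domSL) ×ˢ univ) ?_ ?_
    · rintro _ ⟨⟨x, hx, rfl⟩, hx'⟩
      rcases hx with ⟨hx1, hx2⟩ | ⟨hx1, d, hx2⟩
      · rcases hx' with ⟨hy1, hy2⟩ | ⟨hy1, d, hy2⟩
        · exact ⟨⟨⟨x.1, hx1, rfl⟩, hy1⟩, mem_univ _⟩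
        · simp only [Prod.smul_snd, mem_singleton_iff.mp hx2, smul_zero] at hy2
          exact (freq_ne_zero d hy2).elim
      · rcases hx' with ⟨hy1, hy2⟩ | ⟨hy1, d', hy2⟩
        · have : x.2 = 0 := by
            have := mem_singleton_iff.mp hy2
            exact (smul_eq_zero_iff_eq γ).mp this
          exact (freq_ne_zero d (hx2.trans this)).elim
        · simp only [Prod.smul_snd, ← hx2] at hy2
          obtain ⟨n, rfl⟩ := eq_T_zpow_of_smul_freq hy2.symm
          simp only [Prod.smul_fst, stripSL, mem_ofPred_eq, modular_smul_smul_I,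
            ModularGroup.re_T_zpow_smul] at hx1 hy1
          have h1 : (n : ℝ) < 1 := by linarith [hx1.1, hy1.2]
          have h2 : (-1 : ℝ) < n := by linarith [hx1.2, hy1.1]
          have h3 : n < 1 := by exact_mod_cast h1
          have h4 : -1 < n := by exact_mod_cast h2
          have : n = 0 := by omega
          exact (hγ (by rw [this, zpow_zero])).elim
    · exact muFreq_domSL_inter hγ

/-- An invariant function has the same integral over the two fundamental domains `domSL` × ℤ² and
`freqDom` of the diagonal action; `h0` removes the orbit of the zero frequency. -/
theorem lintegral_unfold {Φ : SL(2, ℝ) × (Fin 2 → ℤ) → ℝ≥0∞} (hm : Measurable Φ)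
    (hinv : ∀ (γ : SL(2, ℤ)) x, Φ (γ • x) = Φ x) (h0 : ∀ h, Φ (h, 0) = 0) :
    ∫⁻ h in domSL, ∑' ξ, Φ (h, ξ) ∂muSL = ∑' d : ℕ+, ∫⁻ h in stripSL, Φ (h, freq d) ∂muSL := by
  have h1 := isFundamentalDomain_domSL_prod.setLIntegral_eq isFundamentalDomain_freqDom Φ hinv
  rw [← Measure.prod_restrict, Measure.restrict_univ, lintegral_prod _ hm.aemeasurable] at h1
  simp_rw [lintegral_count] at h1
  rw [h1, ← lintegral_indicator measurableSet_freqDom, lintegral_prod_symm _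
    (hm.indicator measurableSet_freqDom).aemeasurable, lintegral_count]
  have hs : ∀ ξ, ξ ∉ range freq → ∀ h, freqDom.indicator Φ (h, ξ) = 0 := by
    intro ξ hξ h
    rw [indicator_apply_eq_zero]
    rintro (⟨_, h2⟩ | ⟨_, h2⟩)
    · have h3 : ξ = 0 := h2
      rw [h3, h0]
    · exact (hξ h2).elim
  rw [← freq_injective.tsum_eq]
  · refine tsum_congr fun d => ?_
    rw [← lintegral_indicator measurableSet_stripSL]
    refine lintegral_congr fun h => ?_
    have : (h, freq d) ∈ freqDom ↔ h ∈ stripSL := by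
      simp [freqDom, freq_ne_zero]
    by_cases hh : h ∈ stripSL
    · rw [indicator_of_mem hh, indicator_of_mem (this.mpr hh)]
    · rw [indicator_of_notMem hh, indicator_of_notMem fun h2 => hh (this.mp h2)]
  · intro ξ hξ
    by_contra hc
    exact hξ (by simp [hs ξ hc])

theorem integral_unfold {Φ : SL(2, ℝ) × (Fin 2 → ℤ) → ℂ}
    (hinv : ∀ (γ : SL(2, ℤ)) x, Φ (γ • x) = Φ x) (h0 : ∀ h, Φ (h, 0) = 0)
    (hi : Integrable Φ ((muSL.restrict domSL).prod Measure.count)) :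
    (Summable fun d : ℕ+ => ∫ h in stripSL, Φ (h, freq d) ∂muSL) ∧
    ∫ h in domSL, ∑' ξ, Φ (h, ξ) ∂muSL = ∑' d : ℕ+, ∫ h in stripSL, Φ (h, freq d) ∂muSL := by
  have hr : (muSL.restrict domSL).prod Measure.count = muFreq.restrict (domSL ×ˢ univ) := by
    rw [← Measure.prod_restrict, Measure.restrict_univ]
  have h1 := isFundamentalDomain_domSL_prod.setIntegral_eq isFundamentalDomain_freqDom hinv
  have hi2 : IntegrableOn Φ freqDom muFreq := by
    rw [← isFundamentalDomain_domSL_prod.integrableOn_iff isFundamentalDomain_freqDom hinv]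
    rwa [IntegrableOn, ← hr]
  have hi3 := hi2.integrable_indicator measurableSet_freqDom
  have hs : ∀ ξ, ξ ∉ range freq → ∀ h, freqDom.indicator Φ (h, ξ) = 0 := by
    intro ξ hξ h
    rw [indicator_apply_eq_zero]
    rintro (⟨_, h2⟩ | ⟨_, h2⟩)
    · have h3 : ξ = 0 := h2
      rw [h3, h0]
    · exact (hξ h2).elim
  have hd : ∀ d, ∫ h, freqDom.indicator Φ (h, freq d) ∂muSL =
      ∫ h in stripSL, Φ (h, freq d) ∂muSL := by
    intro d
    rw [← integral_indicator measurableSet_stripSL]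
    congr 1 with h
    have : (h, freq d) ∈ freqDom ↔ h ∈ stripSL := by
      simp [freqDom, freq_ne_zero]
    by_cases hh : h ∈ stripSL
    · rw [indicator_of_mem hh, indicator_of_mem (this.mpr hh)]
    · rw [indicator_of_notMem hh, indicator_of_notMem fun h2 => hh (this.mp h2)]
  have hsum := integrable_count_iff.mp hi3.integral_prod_right
  refine ⟨?_, ?_⟩
  · have := hsum.of_norm.comp_injective freq_injective
    simpa only [Function.comp_def, hd] using this
  · rw [← hr, integral_prod _ hi, ← integral_indicator measurableSet_freqDom,
      integral_prod_symm _ hi3, integral_countable hi3.integral_prod_right] at h1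
    simp only [measureReal_def, Measure.count_singleton, ENNReal.toReal_one, one_smul] at h1
    rw [← freq_injective.tsum_eq] at h1
    · simp_rw [hd] at h1
      rw [← h1]
      have := hi.prod_right_ae
      refine integral_congr_ae ?_
      filter_upwards [this] with h hh
      rw [integral_countable hh]
      simp [measureReal_def]
    · intro ξ hξ
      by_contra hc
      exact hξ (by simp [hs ξ hc])

/-! ### Fourier analysis of `ℤ²`-periodic functions -/

/-- The half-open unit square. -/
def box : Set (Fin 2 → ℝ) := univ.pi fun _ => Ico 0 1

theorem measurableSet_box : MeasurableSet box := MeasurableSet.univ_pi fun _ => measurableSet_Ico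

/-- Lebesgue measure on the unit square. -/
abbrev volBox : Measure (Fin 2 → ℝ) := volume.restrict box

theorem volume_box : volume box = 1 := by
  rw [box, volume_pi_pi]
  simp

instance : IsProbabilityMeasure volBox := ⟨by rw [Measure.restrict_apply_univ, volume_box]⟩

/-- Periodicity under `ℤ²`. -/
def IsPer {α : Type*} (g : (Fin 2 → ℝ) → α) : Prop :=
  ∀ (l : Fin 2 → ℤ) (w : Fin 2 → ℝ), g (w + fun i => (l i : ℝ)) = g w

local instance : MeasureSpace UnitAddCircle := ⟨AddCircle.haarAddCircle⟩

local instance : Measure.IsAddHaarMeasure (volume : Measure UnitAddCircle) :=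
  inferInstanceAs (Measure.IsAddHaarMeasure AddCircle.haarAddCircle)

/-- The projection `ℝ² → (ℝ/ℤ)²`. -/
def toTorus (w : Fin 2 → ℝ) : UnitAddTorus (Fin 2) := fun i => (w i : UnitAddCircle)

theorem measurable_toTorus : Measurable toTorus :=
  measurable_pi_lambda _ fun i => AddCircle.measurable_mk'.comp (measurable_pi_apply i)

theorem measurePreserving_toTorus : MeasurePreserving toTorus volBox volume := by
  refine ⟨measurable_toTorus, Measure.ext_of_lintegral _ fun f hf => ?_⟩
  rw [lintegral_map hf measurable_toTorus, UnitAddTorus.lintegral_preimage f 0]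
  refine setLIntegral_congr ?_
  -- The square is half open on the right here and on the left in the formula for the torus; both
  -- agree with the closed square up to a null set.
  have h1 := Measure.univ_pi_Ico_ae_eq_Icc (μ := fun _ : Fin 2 => (volume : Measure ℝ))
    (f := fun _ => 0) (g := fun _ => 1)
  have h2 := Measure.univ_pi_Ioc_ae_eq_Icc (μ := fun _ : Fin 2 => (volume : Measure ℝ))
    (f := fun _ => 0) (g := fun _ => 1)
  refine (h1.trans h2.symm).trans (Filter.EventuallyEq.of_eq ?_)
  ext x
  change x ∈ univ.pi (fun _ => Ioc (0 : ℝ) 1) ↔ ∀ i, x i ∈ Ioc ((0 : Fin 2 → ℝ) i) (_ + 1)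
  simp

/-- A measurable section of `toTorus`. -/
def ofTorus (t : UnitAddTorus (Fin 2)) : Fin 2 → ℝ := fun i => (AddCircle.equivIco 1 0 (t i)).1

theorem measurable_ofTorus : Measurable ofTorus :=
  measurable_pi_lambda _ fun i => measurable_subtype_coe.comp
    ((AddCircle.measurableEquivIco 1 0).measurable.comp (measurable_pi_apply i))

theorem toTorus_ofTorus (t : UnitAddTorus (Fin 2)) : toTorus (ofTorus t) = t := by
  ext i
  exact AddCircle.coe_equivIco

theorem IsPer.eq_of_toTorus_eq {α : Type*} {g : (Fin 2 → ℝ) → α} (hg : IsPer g)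
    {v w : Fin 2 → ℝ} (h : toTorus v = toTorus w) : g v = g w := by
  have h1 : ∀ i, ∃ n : ℤ, v i = w i + n := by
    intro i
    have := congrFun h i
    have h2 : ((v i - w i : ℝ) : UnitAddCircle) = 0 := by
      rw [AddCircle.coe_sub, sub_eq_zero]
      exact this
    obtain ⟨n, hn⟩ := AddCircle.coe_eq_zero_iff 1 |>.mp h2
    exact ⟨n, by rw [zsmul_eq_mul, mul_one] at hn; linarith⟩
  choose l hl using h1
  rw [← hg l w]
  congr 1
  ext i
  exact hl i

theorem IsPer.ofTorus_toTorus {α : Type*} {g : (Fin 2 → ℝ) → α} (hg : IsPer g)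
    (w : Fin 2 → ℝ) : g (ofTorus (toTorus w)) = g w :=
  hg.eq_of_toTorus_eq (toTorus_ofTorus _)

section Substitution

variable {T : UnitAddTorus (Fin 2) → UnitAddTorus (Fin 2)} {S : (Fin 2 → ℝ) → Fin 2 → ℝ}

theorem lintegral_box_eq_torus {g : (Fin 2 → ℝ) → ℝ≥0∞} (hg : IsPer g) (hm : Measurable g) :
    ∫⁻ w, g w ∂volBox = ∫⁻ t, g (ofTorus t) := by
  rw [← measurePreserving_toTorus.lintegral_comp (f := fun t => g (ofTorus t))
    (hm.comp measurable_ofTorus)]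
  simp only [hg.ofTorus_toTorus]

theorem integral_box_eq_torus {g : (Fin 2 → ℝ) → ℂ} (hg : IsPer g) (hm : Measurable g) :
    ∫ w, g w ∂volBox = ∫ t, g (ofTorus t) := by
  rw [← measurePreserving_toTorus.map_eq, integral_map (f := fun t => g (ofTorus t))
    measurable_toTorus.aemeasurable
    (hm.comp measurable_ofTorus).aestronglyMeasurable]
  simp only [hg.ofTorus_toTorus]

/-- If S covers a measure-preserving map of the torus, substituting it into a periodic function does
not change the integral over the unit square, although S need not preserve the square. -/
theorem lintegral_box_subst (hT : MeasurePreserving T volume volume)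
    (hST : ∀ w, toTorus (S w) = T (toTorus w))
    {g : (Fin 2 → ℝ) → ℝ≥0∞} (hg : IsPer g) (hm : Measurable g) :
    ∫⁻ w, g (S w) ∂volBox = ∫⁻ w, g w ∂volBox := by
  have h1 : ∀ w, g (S w) = g (ofTorus (T (toTorus w))) := fun w => by
    rw [← hST, hg.ofTorus_toTorus]
  simp_rw [h1]
  rw [measurePreserving_toTorus.lintegral_comp (f := fun t => g (ofTorus (T t)))
    (hm.comp (measurable_ofTorus.comp hT.measurable)),
    hT.lintegral_comp (f := fun t => g (ofTorus t)) (hm.comp measurable_ofTorus),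
    lintegral_box_eq_torus hg hm]

theorem integral_box_subst (hT : MeasurePreserving T volume volume)
    (hST : ∀ w, toTorus (S w) = T (toTorus w))
    {g : (Fin 2 → ℝ) → ℂ} (hg : IsPer g) (hm : Measurable g) :
    ∫ w, g (S w) ∂volBox = ∫ w, g w ∂volBox := by
  have h1 : ∀ w, g (S w) = g (ofTorus (T (toTorus w))) := fun w => by
    rw [← hST, hg.ofTorus_toTorus]
  simp_rw [h1]
  rw [integral_box_eq_torus hg hm,
    ← integral_map (f := fun t => g (ofTorus (T t))) measurable_toTorus.aemeasurable
      (hm.comp (measurable_ofTorus.comp hT.measurable)).aestronglyMeasurable,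
    measurePreserving_toTorus.map_eq]
  conv_rhs => rw [← hT.map_eq]
  rw [integral_map (f := fun t => g (ofTorus t)) hT.measurable.aemeasurable
    (hm.comp measurable_ofTorus).aestronglyMeasurable]

end Substitution

/-- The endomorphism of the torus given by right multiplication with an integral matrix. -/
def torusMul (A : Matrix (Fin 2) (Fin 2) ℤ) : UnitAddTorus (Fin 2) →+ UnitAddTorus (Fin 2) where
  toFun t := fun i => ∑ j, A j i • t j
  map_zero' := by ext; simp
  map_add' s t := by ext i; simp [Finset.sum_add_distrib, smul_add]

theorem torusMul_mul (A B : Matrix (Fin 2) (Fin 2) ℤ) (t : UnitAddTorus (Fin 2)) :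
    torusMul (A * B) t = torusMul B (torusMul A t) := by
  ext i
  simp [torusMul, Matrix.mul_apply, Fin.sum_univ_two, add_smul, mul_smul, smul_add,
    smul_comm (A _ _)]
  abel

theorem torusMul_surjective {A : Matrix (Fin 2) (Fin 2) ℤ} (hA : A.det ≠ 0) :
    Function.Surjective (torusMul A) := by
  intro t
  -- Cramer's rule on a divisible group: divide by the determinant, then apply the adjugate.
  refine ⟨torusMul A.adjugate fun i => DivisibleBy.div (t i) A.det, ?_⟩
  rw [← torusMul_mul, Matrix.adjugate_mul]
  ext i
  simp only [torusMul, AddMonoidHom.coe_mk, ZeroHom.coe_mk, Matrix.smul_apply, Matrix.one_apply,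
    Fin.sum_univ_two]
  fin_cases i <;> simp <;> exact DivisibleBy.div_cancel _ hA

/-- A continuous surjective endomorphism of a compact group preserves normalised Haar measure.
Allowing any nonzero determinant covers both SL₂(ℤ) and multiplication by M. -/
theorem measurePreserving_torusMul {A : Matrix (Fin 2) (Fin 2) ℤ} (hA : A.det ≠ 0) :
    MeasurePreserving (torusMul A) volume volume := by
  refine AddMonoidHom.measurePreserving ?_ (torusMul_surjective hA) rfl
  exact continuous_pi fun i => continuous_finsetSum Finset.univ fun j _ =>
    (continuous_apply j).zsmul (A j i)

theorem toTorus_vecMul (A : Matrix (Fin 2) (Fin 2) ℤ) (w : Fin 2 → ℝ) :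
    toTorus (Matrix.vecMul w (A.map (Int.cast : ℤ → ℝ))) = torusMul A (toTorus w) := by
  ext i
  simp [toTorus, torusMul, Matrix.vecMul, dotProduct, Fin.sum_univ_two, mul_comm (w _),
    ← zsmul_eq_mul]

theorem lintegral_box_vecMul {A : Matrix (Fin 2) (Fin 2) ℤ} (hA : A.det ≠ 0)
    {g : (Fin 2 → ℝ) → ℝ≥0∞} (hg : IsPer g) (hm : Measurable g) :
    ∫⁻ w, g (Matrix.vecMul w (A.map (Int.cast : ℤ → ℝ))) ∂volBox = ∫⁻ w, g w ∂volBox :=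
  lintegral_box_subst (measurePreserving_torusMul hA) (toTorus_vecMul A) hg hm

theorem integral_box_vecMul {A : Matrix (Fin 2) (Fin 2) ℤ} (hA : A.det ≠ 0)
    {g : (Fin 2 → ℝ) → ℂ} (hg : IsPer g) (hm : Measurable g) :
    ∫ w, g (Matrix.vecMul w (A.map (Int.cast : ℤ → ℝ))) ∂volBox = ∫ w, g w ∂volBox :=
  integral_box_subst (measurePreserving_torusMul hA) (toTorus_vecMul A) hg hm

theorem integral_box_add (v : Fin 2 → ℝ) {g : (Fin 2 → ℝ) → ℂ} (hg : IsPer g)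
    (hm : Measurable g) : ∫ w, g (w + v) ∂volBox = ∫ w, g w ∂volBox :=
  integral_box_subst (measurePreserving_add_right volume (toTorus v)) (fun w => by
    ext i; simp [toTorus]) hg hm

/-- The character `w ↦ e(-ξ·w)` of `ℝ²`. -/
def chr (ξ : Fin 2 → ℤ) (w : Fin 2 → ℝ) : ℂ := e (-(ξ 0 * w 0 + ξ 1 * w 1))

theorem e_add (s t : ℝ) : e (s + t) = e s * e t := by
  simp [e, mul_add, Complex.exp_add]

theorem e_int (n : ℤ) : e n = 1 := by
  have := Complex.exp_int_mul_two_pi_mul_I n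
  rw [← this, e]
  congr 1
  push_cast
  ring

theorem norm_e (t : ℝ) : ‖e t‖ = 1 := by
  have : 2 * Real.pi * Complex.I * t = ((2 * Real.pi * t : ℝ) : ℂ) * Complex.I := by
    push_cast; ring
  rw [e, this, Complex.norm_exp_ofReal_mul_I]

theorem continuous_e : Continuous e := by
  unfold e
  fun_prop

theorem continuous_chr (ξ : Fin 2 → ℤ) : Continuous (chr ξ) := by
  unfold chr
  exact continuous_e.comp (by fun_prop)

theorem chr_add (ξ : Fin 2 → ℤ) (v w : Fin 2 → ℝ) : chr ξ (v + w) = chr ξ v * chr ξ w := by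
  rw [chr, chr, chr, ← e_add]
  congr 1
  simp
  ring

theorem isPer_chr (ξ : Fin 2 → ℤ) : IsPer (chr ξ) := by
  intro l w
  rw [chr_add]
  have : chr ξ (fun i => (l i : ℝ)) = 1 := by
    rw [chr, ← e_int (-(ξ 0 * l 0 + ξ 1 * l 1))]
    push_cast
    rfl
  rw [this, mul_one]

theorem chr_eq_mFourier (ξ : Fin 2 → ℤ) (w : Fin 2 → ℝ) :
    chr ξ w = UnitAddTorus.mFourier (-ξ) (toTorus w) := by
  simp only [UnitAddTorus.mFourier, ContinuousMap.coe_mk, Fin.prod_univ_two, toTorus,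
    fourier_coe_apply, chr, e, ← Complex.exp_add]
  congr 1
  push_cast
  simp
  ring

/-- The Fourier coefficients of a periodic function. -/
def fc (g : (Fin 2 → ℝ) → ℂ) (ξ : Fin 2 → ℤ) : ℂ := ∫ w, g w * chr ξ w ∂volBox

theorem IsPer.mul {g₁ g₂ : (Fin 2 → ℝ) → ℂ} (h₁ : IsPer g₁) (h₂ : IsPer g₂) :
    IsPer fun w => g₁ w * g₂ w := fun l w => by
  simp only [h₁ l w, h₂ l w]

theorem mFourierCoeff_ofTorus {g : (Fin 2 → ℝ) → ℂ} (hg : IsPer g) (hm : Measurable g)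
    (ξ : Fin 2 → ℤ) :
    UnitAddTorus.mFourierCoeff (fun t => g (ofTorus t)) ξ = fc g ξ := by
  rw [fc, integral_box_eq_torus (hg.mul (isPer_chr ξ)) (hm.mul (continuous_chr ξ).measurable)]
  simp only [UnitAddTorus.mFourierCoeff, chr_eq_mFourier, toTorus_ofTorus, smul_eq_mul, mul_comm]

theorem memLp_ofTorus {g : (Fin 2 → ℝ) → ℂ} (hg : IsPer g) (hm : Measurable g)
    (h2 : MemLp g 2 volBox) : MemLp (fun t => g (ofTorus t)) 2 volume := by
  rw [← measurePreserving_toTorus.map_eq, memLp_map_measure_iff (g := fun t => g (ofTorus t))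
    (hm.comp measurable_ofTorus).aestronglyMeasurable measurable_toTorus.aemeasurable]
  simpa only [Function.comp_def, hg.ofTorus_toTorus] using h2

theorem hasSum_fc {g₁ g₂ : (Fin 2 → ℝ) → ℂ} (hg₁ : IsPer g₁) (hm₁ : Measurable g₁)
    (h₁ : MemLp g₁ 2 volBox) (hg₂ : IsPer g₂) (hm₂ : Measurable g₂) (h₂ : MemLp g₂ 2 volBox) :
    HasSum (fun ξ => conj (fc g₁ ξ) * fc g₂ ξ) (∫ w, conj (g₁ w) * g₂ w ∂volBox) := by
  have h := UnitAddTorus.hasSum_prod_mFourierCoeff (memLp_ofTorus hg₁ hm₁ h₁).toLp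
    (memLp_ofTorus hg₂ hm₂ h₂).toLp
  have e₁ := (memLp_ofTorus hg₁ hm₁ h₁).coeFn_toLp
  have e₂ := (memLp_ofTorus hg₂ hm₂ h₂).coeFn_toLp
  have c : ∀ {f₁ f₂ : UnitAddTorus (Fin 2) → ℂ}, f₁ =ᵐ[volume] f₂ → ∀ ξ,
      UnitAddTorus.mFourierCoeff f₁ ξ = UnitAddTorus.mFourierCoeff f₂ ξ := by
    intro f₁ f₂ h ξ
    refine integral_congr_ae ?_
    filter_upwards [h] with t ht
    rw [ht]
  simp_rw [c e₁, c e₂, mFourierCoeff_ofTorus hg₁ hm₁, mFourierCoeff_ofTorus hg₂ hm₂] at h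
  convert h using 1
  rw [integral_box_eq_torus]
  · refine integral_congr_ae ?_
    filter_upwards [e₁, e₂] with t h1 h2
    rw [h1, h2]
  · intro l w
    simp only [hg₁ l w, hg₂ l w]
  · exact (Complex.continuous_conj.measurable.comp hm₁).mul hm₂

theorem tsum_enorm_fc_sq {g : (Fin 2 → ℝ) → ℂ} (hg : IsPer g) (hm : Measurable g)
    (h : MemLp g 2 volBox) : ∑' ξ, ‖fc g ξ‖ₑ ^ 2 = ∫⁻ w, ‖g w‖ₑ ^ 2 ∂volBox := by
  have h1 := hasSum_fc hg hm h hg hm h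
  have e1 : ∀ z : ℂ, conj z * z = ((‖z‖ ^ 2 : ℝ) : ℂ) := fun z => by
    rw [mul_comm, Complex.mul_conj, Complex.normSq_eq_norm_sq]
  have e2 : ∀ z : ℂ, ‖z‖ₑ ^ 2 = ENNReal.ofReal (‖z‖ ^ 2) := fun z => by
    rw [ENNReal.ofReal_pow (norm_nonneg _), ofReal_norm]
  simp_rw [e1] at h1
  rw [integral_complex_ofReal, Complex.hasSum_ofReal] at h1
  simp_rw [e2]
  rw [← ofReal_integral_eq_lintegral_ofReal, ← h1.tsum_eq, ENNReal.ofReal_tsum_of_nonneg]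
  · intro; positivity
  · exact h1.summable
  · exact h.integrable_norm_pow (by norm_num)
  · exact Filter.Eventually.of_forall fun w => by positivity

/-- The action of `SL₂(ℤ)` on periodic functions and on Fourier coefficients. -/
theorem fc_comp_vecMul {g : (Fin 2 → ℝ) → ℂ} (hg : IsPer g) (hm : Measurable g) (γ : SL(2, ℤ))
    (ξ : Fin 2 → ℤ) :
    fc (fun w => g (Matrix.vecMul w (castSL γ : Matrix (Fin 2) (Fin 2) ℝ))) (γ • ξ) = fc g ξ := by
  have h := integral_box_vecMul (A := (γ : Matrix (Fin 2) (Fin 2) ℤ)) (by simp)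
    (hg.mul (isPer_chr ξ)) (hm.mul (continuous_chr ξ).measurable)
  rw [fc, fc, ← h]
  congr 1 with w
  congr 1
  change e (-(((Matrix.mulVec (γ : Matrix (Fin 2) (Fin 2) ℤ) ξ) 0 : ℤ) * w 0 +
    ((Matrix.mulVec (γ : Matrix (Fin 2) (Fin 2) ℤ) ξ) 1 : ℤ) * w 1)) = _
  rw [chr]
  congr 1
  simp [Matrix.mulVec, Matrix.vecMul, dotProduct, Fin.sum_univ_two]
  ring

theorem fc_comp_smul {g : (Fin 2 → ℝ) → ℂ} (hg : IsPer g) (hm : Measurable g) (M : ℕ+)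
    (ξ : Fin 2 → ℤ) :
    fc (fun w => g ((M : ℝ) • w)) (fun i => M * ξ i) = fc g ξ := by
  have hv : ∀ w : Fin 2 → ℝ, Matrix.vecMul w ((Matrix.diagonal fun _ => (M : ℤ)).map
      (Int.cast : ℤ → ℝ)) = (M : ℝ) • w := by
    intro w
    ext i
    fin_cases i <;> simp [Matrix.vecMul, dotProduct, Fin.sum_univ_two, mul_comm]
  have h := integral_box_vecMul (A := Matrix.diagonal fun _ => (M : ℤ))
    (by simp) (hg.mul (isPer_chr ξ)) (hm.mul (continuous_chr ξ).measurable)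
  simp_rw [hv] at h
  rw [fc, fc, ← h]
  congr 1 with w
  congr 1
  rw [chr, chr]
  congr 1
  simp
  ring

/-- The function w ↦ g(Mw) is invariant under translation by eᵢ/M, which multiplies its coefficient
at ξ by e(-ξᵢ/M) ≠ 1. -/
theorem fc_comp_smul_of_not_dvd {g : (Fin 2 → ℝ) → ℂ} (hg : IsPer g) (hm : Measurable g) (M : ℕ+)
    {ξ : Fin 2 → ℤ} {i : Fin 2} (hξ : ¬ (M : ℤ) ∣ ξ i) :
    fc (fun w => g ((M : ℝ) • w)) ξ = 0 := by
  have hM : (M : ℝ) ≠ 0 := by positivity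
  have hper : IsPer fun w => g ((M : ℝ) • w) := by
    intro l w
    have := hg (fun i => M * l i) ((M : ℝ) • w)
    change g ((M : ℝ) • (w + fun i => (l i : ℝ))) = g ((M : ℝ) • w)
    rw [← this]
    congr 1
    ext i
    simp
    ring
  have hmM : Measurable fun w : Fin 2 → ℝ => g ((M : ℝ) • w) := hm.comp (measurable_const_smul _)
  set v : Fin 2 → ℝ := Pi.single i (M : ℝ)⁻¹
  have h := integral_box_add v (hper.mul (isPer_chr ξ)) (hmM.mul (continuous_chr ξ).measurable)
  have h1 : ∀ w, g ((M : ℝ) • (w + v)) = g ((M : ℝ) • w) := by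
    intro w
    have := hg (Pi.single i 1) ((M : ℝ) • w)
    rw [← this]
    congr 1
    ext j
    by_cases hj : j = i
    · subst hj; simp [v, mul_add, hM]
    · simp [v, hj]
  simp_rw [h1, chr_add, ← mul_assoc] at h
  rw [integral_mul_const] at h
  have h2 : chr ξ v ≠ 1 := by
    intro h3
    apply hξ
    have hv : chr ξ v = e (-(ξ i / M)) := by
      rw [chr]
      congr 1
      fin_cases i <;> simp [v] <;> ring
    rw [hv, e, Complex.exp_eq_one_iff] at h3
    obtain ⟨n, hn⟩ := h3
    refine ⟨-n, ?_⟩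
    have hpi : (2 * Real.pi * Complex.I : ℂ) ≠ 0 := Complex.two_pi_I_ne_zero
    rw [mul_comm (n : ℂ)] at hn
    have hn := mul_left_cancel₀ hpi hn
    have hn2 : -(ξ i / M : ℝ) = n := by exact_mod_cast hn
    have hn3 : (ξ i : ℝ) = M * (-n : ℤ) := by
      push_cast
      rw [← hn2]
      field_simp
    exact_mod_cast hn3
  change fc (fun w => g ((M : ℝ) • w)) ξ * chr ξ v = fc (fun w => g ((M : ℝ) • w)) ξ at h
  by_contra hc
  exact h2 (mul_left_cancel₀ hc (h.trans (mul_one _).symm))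

/-! ### Functions on `H(0,0)` as functions on `SL₂(ℝ) × ℝ²` -/

/-- The point of `SAff₂(ℝ)` with linear part `h` and translation part `w h`. -/
def pt (h : SL(2, ℝ)) (w : Fin 2 → ℝ) : SAff ℝ := SAff.ofVec w * SAff.ofSL h

theorem measurable_pt : Measurable fun p : SL(2, ℝ) × (Fin 2 → ℝ) => pt p.1 p.2 :=
  (measurable_ofVec.comp measurable_snd).mul (measurable_ofSL.comp measurable_fst)

/-- The restriction of a function on `H(0,0)` to the fibre over `h`. -/
def fib {α : Type} (F : H00 → α) (h : SL(2, ℝ)) (w : Fin 2 → ℝ) : α := F (H00.mk (pt h w))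

theorem H00.mk_intCast_mul (γ : SAff ℤ) (g : SAff ℝ) : H00.mk (SAff.intCast γ * g) = H00.mk g :=
  Quotient.sound ⟨⟨_, γ, rfl⟩, rfl⟩

theorem isPer_fib {α : Type} (F : H00 → α) (h : SL(2, ℝ)) : IsPer (fib F h) := by
  intro l w
  rw [fib, fib, ← H00.mk_intCast_mul (SAff.ofVec l) (pt h w)]
  congr 2
  simp only [pt]
  ext1
  · simp [SAff.ofVec, SAff.ofSL, SAff.intCast]
  · simp [SAff.ofVec, SAff.ofSL, SAff.intCast, Matrix.add_vecMul, add_comm]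

theorem fib_smul {α : Type} (F : H00 → α) (γ : SL(2, ℤ)) (h : SL(2, ℝ)) (w : Fin 2 → ℝ) :
    fib F (γ • h) w = fib F h (Matrix.vecMul w (castSL γ : Matrix (Fin 2) (Fin 2) ℝ)) := by
  rw [fib, fib, ← H00.mk_intCast_mul (SAff.ofSL γ) (pt h _)]
  congr 2
  simp only [pt]
  ext1
  · simp [SAff.ofVec, SAff.ofSL, SAff.intCast, modular_smul_def]
  · have : (fun _ : Fin 2 => (0 : ℝ)) = 0 := rfl
    simp [SAff.ofVec, SAff.ofSL, SAff.intCast, modular_smul_def, Matrix.vecMul_vecMul, this]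

theorem measurable_fib {α : Type} [MeasurableSpace α] {F : H00 → α} (hF : Measurable F) :
    Measurable fun p : SL(2, ℝ) × (Fin 2 → ℝ) => fib F p.1 p.2 :=
  hF.comp (measurable_H00_mk.comp measurable_pt)

theorem measurable_fib_right {α : Type} [MeasurableSpace α] {F : H00 → α} (hF : Measurable F)
    (h : SL(2, ℝ)) : Measurable (fib F h) :=
  (measurable_fib hF).comp measurable_prodMk_left

/-- The projection `SL₂(ℝ) × ℝ² → H(0,0)`. -/
def proj (p : SL(2, ℝ) × (Fin 2 → ℝ)) : H00 := H00.mk (pt p.1 p.2)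

theorem measurable_proj : Measurable proj := measurable_H00_mk.comp measurable_pt

/-- The invariant measure on a fundamental domain in `SL₂(ℝ) × ℝ²`. -/
abbrev muDom : Measure (SL(2, ℝ) × (Fin 2 → ℝ)) := (muSL.restrict domSL).prod volBox

/-- The bottom row is (-sin θ, cos θ)/√y, so the sign condition in `domSL` cuts the full circle down
to the half circle [0, π) used to define `muMV`. -/
theorem iwa_mem_domSL_iff {τ : ℍ} {θ : ℝ} (hθ : θ ∈ Ioc (-Real.pi) Real.pi) :
    iwa τ θ ∈ domSL ↔ τ ∈ ModularGroup.fd ∧ θ ∈ Ico 0 Real.pi := by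
  have hr : 0 < (√τ.im)⁻¹ := inv_pos.mpr (Real.sqrt_pos.mpr τ.im_pos)
  have hb := bot_iwa τ θ
  rw [Complex.exp_mul_I, ← Complex.ofReal_cos, ← Complex.ofReal_sin] at hb
  have h1 : iwa τ θ 1 1 = (√τ.im)⁻¹ * Real.cos θ := by
    have := congrArg Complex.re hb
    simpa [bot, -Complex.ofReal_cos, -Complex.ofReal_sin] using this
  have h0 : iwa τ θ 1 0 = -((√τ.im)⁻¹ * Real.sin θ) := by
    have := congrArg Complex.im hb
    simp [bot, -Complex.ofReal_cos, -Complex.ofReal_sin] at this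
    rw [← this, neg_neg]
  change (iwa τ θ • I ∈ ModularGroup.fd ∧ _) ↔ _
  rw [iwa_smul_I, h0, h1]
  refine and_congr_right fun _ => ?_
  simp only [neg_lt_zero, neg_eq_zero, mul_pos_iff_of_pos_left hr, mul_eq_zero, hr.ne', false_or]
  constructor
  · rintro (h | ⟨h, h'⟩)
    · refine ⟨?_, lt_of_le_of_ne hθ.2 fun h2 => ?_⟩
      · by_contra hc
        push Not at hc
        exact absurd h (not_lt.mpr (Real.sin_neg_of_neg_of_neg_pi_lt hc hθ.1).le)
      · rw [h2, Real.sin_pi] at h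
        exact lt_irrefl _ h
    · rcases lt_trichotomy θ 0 with h2 | h2 | h2
      · exact absurd h (Real.sin_neg_of_neg_of_neg_pi_lt h2 hθ.1).ne
      · rw [h2]; exact ⟨le_rfl, Real.pi_pos⟩
      · rcases lt_or_eq_of_le hθ.2 with h3 | h3
        · exact ⟨h2.le, h3⟩
        · rw [h3, Real.cos_pi] at h'; linarith
  · rintro ⟨h, h'⟩
    rcases eq_or_lt_of_le h with h2 | h2
    · right; rw [← h2]; simp
    · left; exact Real.sin_pos_of_pos_of_lt_pi h2 h'

theorem setLIntegral_domSL {G : SL(2, ℝ) → ℝ≥0∞} (hG : Measurable G) :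
    ∫⁻ h in domSL, G h ∂muSL =
      ∫⁻ τ in ModularGroup.fd, ∫⁻ θ in Ico 0 Real.pi, G (iwa τ θ) := by
  rw [← lintegral_indicator measurableSet_domSL,
    lintegral_muSL (hG.indicator measurableSet_domSL),
    ← lintegral_indicator ModularGroup.isClosed_fd.measurableSet]
  refine lintegral_congr fun τ => ?_
  have key : ∀ θ ∈ Ioc (-Real.pi) Real.pi, domSL.indicator G (iwa τ θ) =
      ModularGroup.fd.indicator (fun τ => (Ico 0 Real.pi).indicator (fun θ => G (iwa τ θ)) θ) τ := by
    intro θ hθ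
    have := iwa_mem_domSL_iff (τ := τ) hθ
    by_cases h1 : τ ∈ ModularGroup.fd
    · by_cases h2 : θ ∈ Ico 0 Real.pi
      · rw [indicator_of_mem h1, indicator_of_mem h2, indicator_of_mem (this.mpr ⟨h1, h2⟩)]
      · rw [indicator_of_mem h1, indicator_of_notMem h2,
          indicator_of_notMem fun h => h2 (this.mp h).2]
    · rw [indicator_of_notMem h1, indicator_of_notMem fun h => h1 (this.mp h).1]
  rw [setLIntegral_congr_fun measurableSet_Ioc key]
  by_cases h1 : τ ∈ ModularGroup.fd
  · simp only [indicator_of_mem h1]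
    rw [lintegral_indicator measurableSet_Ico, Measure.restrict_restrict measurableSet_Ico]
    congr 2
    ext θ
    simp only [mem_inter_iff, mem_Ico, mem_Ioc]
    constructor
    · exact fun h => h.1
    · exact fun h => ⟨h, by linarith [h.1, Real.pi_pos], h.2.le⟩
  · simp only [indicator_of_notMem h1, lintegral_zero]

/-- This replaces Iwasawa coordinates by SL₂(ℝ) × ℝ², where the lattice action is explicit and
fundamental domains can be exchanged. -/
theorem muMV_eq_map_proj : muMV = Measure.map proj muDom := by
  refine Measure.ext_of_lintegral _ fun f hf => ?_
  rw [lintegral_map hf measurable_proj, muMV,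
    lintegral_map (g := fun t => H00.mk (iwasawa t)) hf
      (measurable_H00_mk.comp measurable_iwasawa)]
  have hm1 : Measurable fun t : ℍ × (Fin 2 → ℝ) × ℝ => f (H00.mk (iwasawa t)) :=
    hf.comp (measurable_H00_mk.comp measurable_iwasawa)
  have hm2 : Measurable fun p => f (proj p) := hf.comp measurable_proj
  have hiw : ∀ t : ℍ × (Fin 2 → ℝ) × ℝ, H00.mk (iwasawa t) = proj (iwa t.1 t.2.2, t.2.1) := by
    intro t
    rw [proj, pt, iwasawa, mul_assoc]
    congr 2
    ext1
    · simp [SAff.ofSL, iwa]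
    · simp [SAff.ofSL]
  rw [lintegral_prod _ hm2.aemeasurable, setLIntegral_domSL
    (hm2.lintegral_prod_right)]
  have : (volume : Measure (ℍ × (Fin 2 → ℝ) × ℝ)).restrict fundDomain =
      (volume.restrict ModularGroup.fd).prod
        (volBox.prod (volume.restrict (Ico 0 Real.pi))) := by
    rw [fundDomain, Measure.prod_restrict, Measure.prod_restrict]
    rfl
  rw [this, lintegral_prod _ hm1.aemeasurable]
  refine lintegral_congr fun τ => ?_
  rw [lintegral_prod_symm (fun y => f (H00.mk (iwasawa (τ, y))))
    (hm1.comp measurable_prodMk_left).aemeasurable]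
  simp only [hiw]

theorem measurePreserving_proj : MeasurePreserving proj muDom muMV :=
  ⟨measurable_proj, muMV_eq_map_proj.symm⟩

theorem lintegral_muMV {F : H00 → ℝ≥0∞} (hF : Measurable F) :
    ∫⁻ x, F x ∂muMV = ∫⁻ h in domSL, ∫⁻ w, fib F h w ∂volBox ∂muSL := by
  rw [← measurePreserving_proj.lintegral_comp hF,
    lintegral_prod (fun p => F (proj p)) (hF.comp measurable_proj).aemeasurable]
  rfl

theorem integral_muMV {F : H00 → ℂ} (hF : Measurable F) (hi : Integrable F muMV) :
    ∫ x, F x ∂muMV = ∫ h in domSL, ∫ w, fib F h w ∂volBox ∂muSL := by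
  have hi2 := (measurePreserving_proj.integrable_comp hF.aestronglyMeasurable).mpr hi
  rw [← measurePreserving_proj.map_eq, integral_map measurable_proj.aemeasurable
    hF.aestronglyMeasurable, integral_prod (fun p => F (proj p)) hi2]
  rfl

/-! ### Fourier coefficients along the torus fibres -/

/-- The Fourier coefficient with frequency `ξ` of `F` on the torus fibre over `h`. -/
def co (F : H00 → ℂ) (ξ : Fin 2 → ℤ) (h : SL(2, ℝ)) : ℂ := fc (fib F h) ξ

/-- The lattice acts on the fibres by integral changes of coordinates, hence on frequencies by the
dual action. This is the invariance that permits unfolding. -/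
theorem co_smul_smul {F : H00 → ℂ} (hF : Measurable F) (γ : SL(2, ℤ)) (ξ : Fin 2 → ℤ)
    (h : SL(2, ℝ)) : co F (γ • ξ) (γ • h) = co F ξ h := by
  rw [co, co, ← fc_comp_vecMul (isPer_fib F h) (measurable_fib_right hF h) γ ξ]
  congr 1
  ext w
  exact fib_smul F γ h w

theorem measurable_co {F : H00 → ℂ} (hF : Measurable F) (ξ : Fin 2 → ℤ) : Measurable (co F ξ) := by
  have : StronglyMeasurable fun p : SL(2, ℝ) × (Fin 2 → ℝ) => fib F p.1 p.2 * chr ξ p.2 :=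
    ((measurable_fib hF).mul ((continuous_chr ξ).measurable.comp measurable_snd)).stronglyMeasurable
  exact this.integral_prod_right.measurable

theorem measurable_co_prod {F : H00 → ℂ} (hF : Measurable F) :
    Measurable fun x : SL(2, ℝ) × (Fin 2 → ℤ) => co F x.2 x.1 :=
  measurable_from_prod_countable_left fun ξ => measurable_co hF ξ

theorem memLp_two_iff {α : Type*} [MeasurableSpace α] {μ : Measure α} {f : α → ℂ}
    (hf : AEStronglyMeasurable f μ) : MemLp f 2 μ ↔ ∫⁻ x, ‖f x‖ₑ ^ 2 ∂μ < ⊤ := by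
  rw [MemLp, and_iff_right hf, eLpNorm_lt_top_iff_lintegral_rpow_enorm_lt_top (by norm_num)
    (by norm_num)]
  simp

theorem ae_memLp_fib {F : H00 → ℂ} (hF : Measurable F) (h2 : MemLp F 2 muMV) :
    ∀ᵐ h ∂muSL.restrict domSL, MemLp (fib F h) 2 volBox := by
  rw [memLp_two_iff hF.aestronglyMeasurable, lintegral_muMV (hF.enorm.pow_const 2)] at h2
  have hm : Measurable fun p : SL(2, ℝ) × (Fin 2 → ℝ) => ‖fib F p.1 p.2‖ₑ ^ 2 :=
    (measurable_fib hF).enorm.pow_const 2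
  filter_upwards [ae_lt_top hm.lintegral_prod_right h2.ne] with h hh
  rw [memLp_two_iff (measurable_fib_right hF h).aestronglyMeasurable]
  exact hh

theorem lintegral_enorm_sq_eq_tsum_co {F : H00 → ℂ} (hF : Measurable F)
    (h2 : ∀ᵐ h ∂muSL.restrict domSL, MemLp (fib F h) 2 volBox) :
    ∫⁻ x, ‖F x‖ₑ ^ 2 ∂muMV = ∫⁻ h in domSL, ∑' ξ, ‖co F ξ h‖ₑ ^ 2 ∂muSL := by
  rw [lintegral_muMV (hF.enorm.pow_const 2)]
  refine lintegral_congr_ae ?_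
  filter_upwards [h2] with h hh
  exact (tsum_enorm_fc_sq (isPer_fib F h) (measurable_fib_right hF h) hh).symm

/-- The function `conj F₁(ξ) F₂(ξ)` of Fourier coefficients away from `ξ = 0`. -/
def coProd (F₁ F₂ : H00 → ℂ) (x : SL(2, ℝ) × (Fin 2 → ℤ)) : ℂ :=
  if x.2 = 0 then 0 else conj (co F₁ x.2 x.1) * co F₂ x.2 x.1

theorem measurable_coProd {F₁ F₂ : H00 → ℂ} (h₁ : Measurable F₁) (h₂ : Measurable F₂) :
    Measurable (coProd F₁ F₂) :=
  Measurable.ite (measurable_snd (measurableSet_singleton 0)) measurable_const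
    ((Complex.continuous_conj.measurable.comp (measurable_co_prod h₁)).mul (measurable_co_prod h₂))

theorem coProd_smul {F₁ F₂ : H00 → ℂ} (h₁ : Measurable F₁) (h₂ : Measurable F₂) (γ : SL(2, ℤ))
    (x : SL(2, ℝ) × (Fin 2 → ℤ)) : coProd F₁ F₂ (γ • x) = coProd F₁ F₂ x := by
  simp only [coProd, Prod.smul_snd, Prod.smul_fst, smul_eq_zero_iff_eq, co_smul_smul h₁,
    co_smul_smul h₂]

/-- Square integrability is required on the fibres only, so the identity can serve to prove that F
lies in L². -/
theorem enorm_sq_eq_tsum_strip {F : H00 → ℂ} (hF : Measurable F)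
    (h2 : ∀ᵐ h ∂muSL.restrict domSL, MemLp (fib F h) 2 volBox)
    (h0 : ∀ᵐ h ∂muSL.restrict domSL, co F 0 h = 0) :
    ∫⁻ x, ‖F x‖ₑ ^ 2 ∂muMV = ∑' d : ℕ+, ∫⁻ h in stripSL, ‖co F (freq d) h‖ₑ ^ 2 ∂muSL := by
  have h := lintegral_unfold (Φ := fun x => if x.2 = 0 then 0 else ‖co F x.2 x.1‖ₑ ^ 2)
    (Measurable.ite (measurable_snd (measurableSet_singleton 0)) measurable_const
      ((measurable_co_prod hF).enorm.pow_const 2))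
    (fun γ x => by simp only [Prod.smul_snd, Prod.smul_fst, smul_eq_zero_iff_eq, co_smul_smul hF])
    (fun h => by simp)
  simp only [freq_ne_zero, if_false] at h
  rw [lintegral_enorm_sq_eq_tsum_co hF h2, ← h]
  refine lintegral_congr_ae ?_
  filter_upwards [h0] with h hh
  refine tsum_congr fun ξ => ?_
  split_ifs with hξ
  · subst hξ; simp [hh]
  · rfl

theorem enorm_mul_le (a b : ℂ) : ‖conj a * b‖ₑ ≤ ‖a‖ₑ ^ 2 + ‖b‖ₑ ^ 2 := by
  have h1 : ∀ z : ℂ, ‖z‖ₑ ^ 2 = ENNReal.ofReal (‖z‖ ^ 2) := fun z => by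
    rw [ENNReal.ofReal_pow (norm_nonneg _), ofReal_norm]
  rw [h1, h1, ← ENNReal.ofReal_add (by positivity) (by positivity), ← ofReal_norm]
  refine ENNReal.ofReal_le_ofReal ?_
  rw [norm_mul, RCLike.norm_conj]
  nlinarith [sq_nonneg (‖a‖ - ‖b‖), norm_nonneg a, norm_nonneg b]

theorem integrable_coProd {F₁ F₂ : H00 → ℂ} (h₁ : Measurable F₁) (h₂ : Measurable F₂)
    (m₁ : MemLp F₁ 2 muMV) (m₂ : MemLp F₂ 2 muMV) :
    Integrable (coProd F₁ F₂) ((muSL.restrict domSL).prod Measure.count) := by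
  refine ⟨(measurable_coProd h₁ h₂).aestronglyMeasurable, ?_⟩
  rw [HasFiniteIntegral, lintegral_prod _ (measurable_coProd h₁ h₂).enorm.aemeasurable]
  simp_rw [lintegral_count]
  have b : ∀ {F : H00 → ℂ}, Measurable F → MemLp F 2 muMV →
      ∫⁻ h in domSL, ∑' ξ, ‖co F ξ h‖ₑ ^ 2 ∂muSL < ⊤ := by
    intro F hF mF
    rw [← lintegral_enorm_sq_eq_tsum_co hF (ae_memLp_fib hF mF)]
    exact (memLp_two_iff hF.aestronglyMeasurable).mp mF
  refine lt_of_le_of_lt (lintegral_mono fun h => ENNReal.tsum_le_tsum fun ξ =>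
    (?_ : _ ≤ ‖co F₁ ξ h‖ₑ ^ 2 + ‖co F₂ ξ h‖ₑ ^ 2)) ?_
  · simp only [coProd]
    split_ifs
    · simp
    · exact enorm_mul_le _ _
  · simp_rw [ENNReal.tsum_add]
    rw [lintegral_add_left (Measurable.tsum fun ξ =>
      (measurable_co h₁ ξ).enorm.pow_const 2)]
    exact ENNReal.add_lt_top.mpr ⟨b h₁ m₁, b h₂ m₂⟩

/-- The polarised identity: one of the two functions having no zero frequency suffices. Summability
is recorded because the sieve over multiples uses it. -/
theorem integral_conj_mul_eq_tsum {F₁ F₂ : H00 → ℂ} (h₁ : Measurable F₁) (h₂ : Measurable F₂)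
    (m₁ : MemLp F₁ 2 muMV) (m₂ : MemLp F₂ 2 muMV)
    (h0 : ∀ᵐ h ∂muSL.restrict domSL, co F₁ 0 h = 0) :
    (Summable fun d : ℕ+ => ∫ h in stripSL, conj (co F₁ (freq d) h) * co F₂ (freq d) h ∂muSL) ∧
    ∫ x, conj (F₁ x) * F₂ x ∂muMV =
      ∑' d : ℕ+, ∫ h in stripSL, conj (co F₁ (freq d) h) * co F₂ (freq d) h ∂muSL := by
  have h := integral_unfold (Φ := coProd F₁ F₂) (coProd_smul h₁ h₂) (fun h => by simp [coProd])
    (integrable_coProd h₁ h₂ m₁ m₂)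
  simp only [coProd, freq_ne_zero, if_false] at h
  refine ⟨h.1, ?_⟩
  rw [← h.2, integral_muMV (F := fun x => conj (F₁ x) * F₂ x)
    ((Complex.continuous_conj.measurable.comp h₁).mul h₂)]
  · refine integral_congr_ae ?_
    filter_upwards [h0, ae_memLp_fib h₁ m₁, ae_memLp_fib h₂ m₂] with h hh hh₁ hh₂
    have := hasSum_fc (isPer_fib F₁ h) (measurable_fib_right h₁ h) hh₁
      (isPer_fib F₂ h) (measurable_fib_right h₂ h) hh₂
    change ∫ w, conj (fib F₁ h w) * fib F₂ h w ∂volBox = _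
    rw [← this.tsum_eq]
    refine tsum_congr fun ξ => ?_
    split_ifs with hξ
    · subst hξ
      have hh' : fc (fib F₁ h) 0 = 0 := hh
      rw [hh', map_zero, zero_mul]
    · rfl
  · have := MemLp.integrable_mul (p := 2) (q := 2) m₁.star m₂
    exact this

/-! ### The genuine part in terms of Fourier coefficients -/

theorem inner_L2_eq {α : Type*} [MeasurableSpace α] {μ : Measure α} (F G : Lp ℂ 2 μ) :
    inner ℂ F G = ∫ x, conj (F x) * G x ∂μ := by
  rw [L2.inner_def]
  refine integral_congr_ae (Filter.Eventually.of_forall fun x => ?_)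
  simp only [RCLike.inner_apply]
  rw [mul_comm]

theorem integrable_conj_mul {α : Type*} [MeasurableSpace α] {μ : Measure α} {F G : α → ℂ}
    (hF : MemLp F 2 μ) (hG : MemLp G 2 μ) : Integrable (fun x => conj (F x) * G x) μ :=
  MemLp.integrable_mul (p := 2) (q := 2) hF.star hG

theorem measurable_coeFn_Lp {α : Type*} [MeasurableSpace α] {μ : Measure α} (F : Lp ℂ 2 μ) :
    Measurable F := (Lp.stronglyMeasurable F).measurable

theorem co_zero (F : H00 → ℂ) (h : SL(2, ℝ)) : co F 0 h = ∫ w, fib F h w ∂volBox := by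
  simp [co, fc, chr, e]

theorem fib_comp_forget {α : Type} (ψ : H0 → α) (h : SL(2, ℝ)) (w : Fin 2 → ℝ) :
    fib (fun x => ψ (forget x)) h w = ψ (H0.mk h) := by
  change ψ (H0.mk (1 * h)) = _
  rw [one_mul]

/-- The fibre average of a function on `H(0,0)`. -/
def average (F : H00 → ℂ) (hF : Measurable F) : H0 → ℂ :=
  Quotient.lift (co F 0) (by
    rintro a b ⟨⟨_, γ, rfl⟩, rfl⟩
    have := co_smul_smul hF γ 0 b
    rwa [smul_zero] at this)

theorem measurable_average {F : H00 → ℂ} (hF : Measurable F) : Measurable (average F hF) :=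
  fun _ hs => measurable_co hF 0 hs

theorem integral_conj_comp_forget_mul {ψ : H0 → ℂ} (hψ : Measurable ψ)
    (hψ2 : MemLp (fun x => ψ (forget x)) 2 muMV) {F : H00 → ℂ} (hF : Measurable F)
    (hF2 : MemLp F 2 muMV) :
    ∫ x, conj (ψ (forget x)) * F x ∂muMV =
      ∫ h in domSL, conj (ψ (H0.mk h)) * co F 0 h ∂muSL := by
  rw [integral_muMV (F := fun x => conj (ψ (forget x)) * F x)
    ((Complex.continuous_conj.measurable.comp (hψ.comp measurable_forget)).mul hF)
    (integrable_conj_mul hψ2 hF2)]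
  congr 1 with h
  rw [co_zero, ← integral_const_mul]
  congr 1 with w
  change conj (fib (fun x => ψ (forget x)) h w) * fib F h w = _
  rw [fib_comp_forget]

theorem inner_pullback (ψ : Lp ℂ 2 muMV0) (F : L2H00) :
    inner ℂ (pullback ψ) F = ∫ h in domSL, conj (ψ (H0.mk h)) * co F 0 h ∂muSL := by
  have hp : pullback ψ =ᵐ[muMV] fun x => ψ (forget x) :=
    Lp.coeFn_compMeasurePreserving ψ ⟨measurable_forget, rfl⟩
  rw [inner_L2_eq, ← integral_conj_comp_forget_mul (measurable_coeFn_Lp ψ)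
    ((memLp_congr_ae hp).mp (Lp.memLp _)) (measurable_coeFn_Lp F) (Lp.memLp F)]
  refine integral_congr_ae ?_
  filter_upwards [hp] with x hx
  rw [hx]

theorem memLp_average {F : H00 → ℂ} (hF : Measurable F) (h2 : MemLp F 2 muMV) :
    MemLp (average F hF) 2 muMV0 := by
  rw [muMV0, memLp_map_measure_iff (measurable_average hF).aestronglyMeasurable
    measurable_forget.aemeasurable,
    memLp_two_iff ((measurable_average hF).comp measurable_forget).aestronglyMeasurable,
    lintegral_muMV (((measurable_average hF).comp measurable_forget).enorm.pow_const 2)]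
  refine lt_of_le_of_lt ?_ ((memLp_two_iff hF.aestronglyMeasurable).mp h2)
  rw [lintegral_enorm_sq_eq_tsum_co hF (ae_memLp_fib hF h2)]
  refine lintegral_mono fun h => ?_
  have : ∀ w, fib (fun x => ‖(average F hF ∘ forget) x‖ₑ ^ 2) h w = ‖co F 0 h‖ₑ ^ 2 := by
    intro w
    exact fib_comp_forget (fun y => ‖average F hF y‖ₑ ^ 2) h w
  simp only [this, lintegral_const, measure_univ, mul_one]
  exact ENNReal.le_tsum (f := fun ξ => ‖co F ξ h‖ₑ ^ 2) 0

/-- A pullback is constant on fibres, so pairing with it only involves the fibre average.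
Conversely, the average is square integrable, being one term of Parseval, and pairing F with the
pullback of its own average gives the squared norm of the average. -/
theorem mem_genuinePart_iff (F : L2H00) :
    F ∈ genuinePart ↔ ∀ᵐ h ∂muSL.restrict domSL, co F 0 h = 0 := by
  have hF := measurable_coeFn_Lp F
  rw [genuinePart, Submodule.mem_orthogonal]
  constructor
  · intro h
    have hψ := memLp_average hF (Lp.memLp F)
    let Ψ : Lp ℂ 2 muMV0 := hψ.toLp
    have h1 := h (pullback Ψ) ⟨Ψ, rfl⟩
    have hp : pullback Ψ =ᵐ[muMV] fun x => average F hF (forget x) := by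
      have h2 : pullback Ψ =ᵐ[muMV] fun x => Ψ (forget x) :=
        Lp.coeFn_compMeasurePreserving Ψ ⟨measurable_forget, rfl⟩
      have h3 : (fun x => Ψ (forget x)) =ᵐ[muMV] fun x => average F hF (forget x) :=
        ae_of_ae_map measurable_forget.aemeasurable hψ.coeFn_toLp
      exact h2.trans h3
    have hm : MemLp (fun x => average F hF (forget x)) 2 muMV :=
      (memLp_congr_ae hp).mp (Lp.memLp _)
    have h4 : inner ℂ (pullback Ψ) F =
        ∫ h in domSL, conj (co F 0 h) * co F 0 h ∂muSL := by
      rw [inner_L2_eq]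
      refine Eq.trans (integral_congr_ae ?_)
        (integral_conj_comp_forget_mul (measurable_average hF) hm hF (Lp.memLp F))
      filter_upwards [hp] with x hx
      rw [hx]
    rw [h1] at h4
    have e1 : ∀ z : ℂ, conj z * z = ((‖z‖ ^ 2 : ℝ) : ℂ) := fun z => by
      rw [mul_comm, Complex.mul_conj, Complex.normSq_eq_norm_sq]
    simp_rw [e1] at h4
    rw [integral_complex_ofReal, eq_comm, Complex.ofReal_eq_zero] at h4
    have hi : Integrable (fun h => ‖co F 0 h‖ ^ 2) (muSL.restrict domSL) := by
      have : MemLp (co F 0) 2 (muSL.restrict domSL) := by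
        rw [memLp_two_iff (measurable_co hF 0).aestronglyMeasurable]
        refine lt_of_le_of_lt ?_ ((memLp_two_iff hF.aestronglyMeasurable).mp (Lp.memLp F))
        rw [lintegral_enorm_sq_eq_tsum_co hF (ae_memLp_fib hF (Lp.memLp F))]
        exact lintegral_mono fun h => ENNReal.le_tsum (f := fun ξ => ‖co F ξ h‖ₑ ^ 2) 0
      exact this.integrable_norm_pow (by norm_num)
    rw [integral_eq_zero_iff_of_nonneg (fun h => by positivity) hi] at h4
    filter_upwards [h4] with h hh
    simpa using hh
  · rintro h _ ⟨ψ, rfl⟩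
    change inner ℂ (pullback ψ) F = 0
    rw [inner_pullback]
    refine integral_eq_zero_of_ae ?_
    filter_upwards [h] with h hh
    simp [hh]

theorem co_congr_ae {F G : H00 → ℂ} (h : F =ᵐ[muMV] G) :
    ∀ᵐ h ∂muSL.restrict domSL, ∀ ξ, co F ξ h = co G ξ h := by
  have h1 := measurePreserving_proj.quasiMeasurePreserving.ae_eq_comp h
  have h2 := Measure.ae_ae_of_ae_prod h1
  filter_upwards [h2] with h hh ξ
  refine integral_congr_ae ?_
  filter_upwards [hh] with w hw
  change F (proj (h, w)) * _ = G (proj (h, w)) * _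
  rw [show F (proj (h, w)) = G (proj (h, w)) from hw]

/-! ### Horocyclic coordinates on `SL₂(ℝ)` -/

theorem measurable_ofComplex : Measurable (ofComplex : ℂ → ℍ) := by
  classical
  rw [measurable_comap_iff]
  have : (UpperHalfPlane.coe ∘ (ofComplex : ℂ → ℍ)) =
      fun z => if 0 < z.im then z else ((ofComplex 0 : ℍ) : ℂ) := by
    ext1 z
    split_ifs with h
    · rw [Function.comp_apply, ofComplex_apply_of_im_pos h]
    · rw [Function.comp_apply, ofComplex_apply_eq_of_im_nonpos (not_lt.mp h) (w' := 0) (by simp)]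
  rw [this]
  exact Measurable.ite (measurableSet_lt measurable_const Complex.measurable_im) measurable_id
    measurable_const

/-- The point `x + iy` of the upper half plane. -/
def uhp (x y : ℝ) : ℍ := ofComplex (x + y * Complex.I)

theorem measurable_uhp : Measurable fun p : ℝ × ℝ => uhp p.1 p.2 :=
  measurable_ofComplex.comp ((Complex.measurable_ofReal.comp measurable_fst).add
    ((Complex.measurable_ofReal.comp measurable_snd).mul_const _))

theorem coe_uhp (x : ℝ) {y : ℝ} (hy : 0 < y) : (uhp x y : ℂ) = x + y * Complex.I := by
  rw [uhp, ofComplex_apply_of_im_pos (by simpa using hy)]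

theorem uhp_im (x : ℝ) {y : ℝ} (hy : 0 < y) : (uhp x y).im = y := by
  rw [← coe_im, coe_uhp x hy]; simp

theorem uhp_re (x : ℝ) {y : ℝ} (hy : 0 < y) : (uhp x y).re = x := by
  rw [← coe_re, coe_uhp x hy]; simp

theorem lintegral_upperHalfPlane {g : ℍ → ℝ≥0∞} (hg : Measurable g) :
    ∫⁻ τ, g τ = ∫⁻ x : ℝ, ∫⁻ y in Ioi (0 : ℝ), ENNReal.ofReal ((y ^ 2)⁻¹) * g (uhp x y) := by
  have hrange : range UpperHalfPlane.coe = {z : ℂ | 0 < z.im} := by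
    ext z
    exact ⟨by rintro ⟨τ, rfl⟩; exact τ.im_pos, fun h => ⟨⟨z, h⟩, rfl⟩⟩
  have hU : MeasurableSet {z : ℂ | 0 < z.im} :=
    measurableSet_lt measurable_const Complex.measurable_im
  have hd : Measurable fun z : ℂ => ENNReal.ofReal ((z.im ^ 2)⁻¹) * g (ofComplex z) :=
    (Complex.measurable_im.pow_const 2).inv.ennreal_ofReal.mul (hg.comp measurable_ofComplex)
  have h1 : ∫⁻ τ, g τ = ∫⁻ z in {z : ℂ | 0 < z.im},
      ENNReal.ofReal ((z.im ^ 2)⁻¹) * g (ofComplex z) := by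
    rw [← hrange, ← measurableEmbedding_coe.map_comap, lintegral_map hd measurable_coe,
      volume_def, lintegral_withDensity_eq_lintegral_mul _ ?_ hg]
    · refine lintegral_congr fun τ => ?_
      rw [Pi.mul_apply, ofComplex_apply, coe_im]
      congr 1
      rw [← ENNReal.ofReal_coe_nnreal]
      congr 1
      simp
    · refine Measurable.coe_nnreal_ennreal ?_
      refine Continuous.measurable (.pow (.div₀ continuous_const ?_ ?_) _)
      · exact continuous_im.subtype_mk _
      · exact fun x ↦ NNReal.ne_iff.mp x.im_ne_zero
  have h2 := Complex.volume_preserving_equiv_real_prod.symm.setLIntegral_comp_preimage hU hd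
  rw [h1, ← h2]
  have h3 : (Complex.measurableEquivRealProd.symm ⁻¹' {z : ℂ | 0 < z.im}) =
      (univ : Set ℝ) ×ˢ Ioi (0 : ℝ) := by
    ext p; simp
  rw [h3, Measure.volume_eq_prod, ← Measure.prod_restrict, Measure.restrict_univ, lintegral_prod]
  · refine lintegral_congr fun x => lintegral_congr fun y => ?_
    simp only [Complex.measurableEquivRealProd_symm_apply, uhp]
    congr 3
    rw [Complex.mk_eq_add_mul_I]
  · exact (hd.comp Complex.measurableEquivRealProd.symm.measurable).aemeasurable

/-- With r = 1/√y one has dy/y² = 2 r dr up to orientation, which is twice the radial part of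
Lebesgue measure on the plane. -/
theorem lintegral_polar {u : ℂ → ℝ≥0∞} (hu : Measurable u) :
    ∫⁻ y in Ioi (0 : ℝ), ENNReal.ofReal ((y ^ 2)⁻¹) *
      ∫⁻ θ in Ioc (-Real.pi) Real.pi, u (((√y)⁻¹ : ℝ) * Complex.exp (θ * Complex.I)) =
    2 * ∫⁻ v, u v := by
  set U : ℝ → ℝ≥0∞ := fun r => ∫⁻ θ in Ioc (-Real.pi) Real.pi, u (r * Complex.exp (θ * Complex.I))
  have hmu : Measurable fun p : ℝ × ℝ => u (p.1 * Complex.exp (p.2 * Complex.I)) :=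
    hu.comp (by fun_prop)
  have hmU : Measurable U := hmu.lintegral_prod_right'
  have h1 : ∫⁻ v, u v = ∫⁻ r in Ioi (0 : ℝ), ENNReal.ofReal r * U r := by
    rw [← Complex.lintegral_comp_polarCoord_symm, polarCoord_target, Measure.volume_eq_prod,
      ← Measure.prod_restrict, lintegral_prod]
    · refine lintegral_congr fun r => ?_
      rw [restrict_Ioo_eq_restrict_Ioc, ← lintegral_const_mul
        (f := fun θ : ℝ => u (r * Complex.exp (θ * Complex.I))) _
        (hmu.comp measurable_prodMk_left)]
      refine lintegral_congr fun θ => ?_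
      simp [Complex.exp_mul_I, Complex.polarCoord_symm_apply]
    · refine Measurable.aemeasurable ?_
      refine Measurable.mul (by fun_prop) ?_
      have : (fun p : ℝ × ℝ => u (Complex.polarCoord.symm p)) =
          fun p : ℝ × ℝ => u (p.1 * Complex.exp (p.2 * Complex.I)) := by
        ext p
        simp [Complex.exp_mul_I, Complex.polarCoord_symm_apply]
      rw [this]
      exact hmu
  have himg : (fun r : ℝ => (r ^ 2)⁻¹) '' Ioi 0 = Ioi 0 := by
    ext y
    constructor
    · rintro ⟨r, hr, rfl⟩
      have : 0 < r := hr
      change 0 < (r ^ 2)⁻¹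
      positivity
    · intro hy
      have hy' : 0 < y := hy
      refine ⟨(√y)⁻¹, show 0 < (√y)⁻¹ from inv_pos.mpr (Real.sqrt_pos.mpr hy'), ?_⟩
      simp only [inv_pow, Real.sq_sqrt hy'.le, inv_inv]
  have hinj : InjOn (fun r : ℝ => (r ^ 2)⁻¹) (Ioi 0) := by
    intro a ha b hb hab
    have := inv_injective hab
    exact (pow_left_inj₀ (le_of_lt ha) (le_of_lt hb) two_ne_zero).mp this
  have hder : ∀ r ∈ Ioi (0 : ℝ), HasDerivWithinAt (fun r : ℝ => (r ^ 2)⁻¹)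
      (-(2 * r) / (r ^ 2) ^ 2) (Ioi 0) r := by
    intro r hr
    have h0 : (0 : ℝ) < r := hr
    have := ((hasDerivAt_pow 2 r).inv (by positivity)).hasDerivWithinAt (s := Ioi 0)
    norm_num at this
    exact this
  conv_lhs => rw [← himg]
  rw [lintegral_image_eq_lintegral_abs_deriv_mul measurableSet_Ioi hder hinj, h1,
    ← lintegral_const_mul (f := fun r => ENNReal.ofReal r * U r) _
      (measurable_id.ennreal_ofReal.mul hmU)]
  refine setLIntegral_congr_fun measurableSet_Ioi fun r hr => ?_
  have h0 : (0 : ℝ) < r := hr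
  have e1 : (√((r ^ 2)⁻¹))⁻¹ = r := by
    rw [Real.sqrt_inv, Real.sqrt_sq h0.le, inv_inv]
  simp only [e1]
  rw [← mul_assoc, ← mul_assoc, ← ENNReal.ofReal_mul (abs_nonneg _)]
  have : (2 : ℝ≥0∞) = ENNReal.ofReal 2 := by simp
  rw [this, ← ENNReal.ofReal_mul (by norm_num)]
  congr 2
  rw [abs_div, abs_neg, abs_of_pos (by positivity : 0 < 2 * r), abs_of_pos (by positivity)]
  field_simp

/-- The element of `SL₂(ℝ)` with bottom row `v` whose image in `ℍ` has real part `x`. -/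
def horo (p : ℝ × ℂ) : SL(2, ℝ) := iwa (uhp p.1 ((‖p.2‖ ^ 2)⁻¹)) (Complex.arg p.2)

theorem measurable_horo_coord :
    Measurable fun p : ℝ × ℂ => (uhp p.1 ((‖p.2‖ ^ 2)⁻¹), Complex.arg p.2) := by
  have h0 : Measurable fun p : ℝ × ℂ => (‖p.2‖ ^ 2)⁻¹ :=
    (measurable_snd.norm.pow_const 2).inv
  have h1 : Measurable fun p : ℝ × ℂ => (p.1, (‖p.2‖ ^ 2)⁻¹) := measurable_fst.prodMk h0
  have h2 : Measurable fun p : ℝ × ℂ => Complex.arg p.2 :=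
    Complex.measurable_arg.comp measurable_snd
  exact (measurable_uhp.comp h1).prodMk h2

theorem measurable_horo : Measurable horo := by
  have := Measurable.comp (g := fun t : ℍ × ℝ => iwa t.1 t.2) measurable_iwa measurable_horo_coord
  exact this

theorem horo_polar (x : ℝ) {y θ : ℝ} (hy : 0 < y) (hθ : θ ∈ Ioc (-Real.pi) Real.pi) :
    horo (x, ((√y)⁻¹ : ℝ) * Complex.exp (θ * Complex.I)) = iwa (uhp x y) θ := by
  have hs : 0 < (√y)⁻¹ := inv_pos.mpr (Real.sqrt_pos.mpr hy)
  rw [horo]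
  simp only [Complex.arg_real_mul _ hs, norm_mul, Complex.norm_exp_ofReal_mul_I, mul_one, Complex.norm_real,
    Real.norm_of_nonneg hs.le, inv_pow, Real.sq_sqrt hy.le, inv_inv]
  congr 1
  rw [Complex.exp_mul_I, Complex.arg_cos_add_sin_mul_I hθ]

theorem horo_smul_I (p : ℝ × ℂ) : horo p • I = uhp p.1 ((‖p.2‖ ^ 2)⁻¹) := iwa_smul_I _ _

theorem bot_horo (x : ℝ) {v : ℂ} (hv : v ≠ 0) : bot (horo (x, v)) = v := by
  have h0 : 0 < ‖v‖ := norm_pos_iff.mpr hv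
  rw [horo, bot_iwa, uhp_im _ (by positivity), Real.sqrt_inv, inv_inv, Real.sqrt_sq h0.le]
  exact Complex.norm_mul_exp_arg_mul_I v

/-- In the coordinates given by Re(h·i) and the bottom row, Haar measure is a multiple of Lebesgue
measure, so Euclidean Fourier analysis applies in the bottom row. -/
theorem muSL_eq_map_horo : muSL = (2 : ℝ≥0∞) • Measure.map horo (volume.prod volume) := by
  refine Measure.ext_of_lintegral _ fun f hf => ?_
  rw [lintegral_smul_measure, lintegral_map hf measurable_horo,
    lintegral_prod (fun p => f (horo p)) (hf.comp measurable_horo).aemeasurable, smul_eq_mul,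
    ← lintegral_const_mul _ (Measurable.lintegral_prod_right'
      (f := fun p : ℝ × ℂ => f (horo p)) (hf.comp measurable_horo)), lintegral_muSL hf,
    lintegral_upperHalfPlane (Measurable.lintegral_prod_right'
      (f := fun p : ℍ × ℝ => f (iwa p.1 p.2)) (hf.comp measurable_iwa))]
  refine lintegral_congr fun x => ?_
  rw [← lintegral_polar (u := fun v => f (horo (x, v)))
    ((hf.comp measurable_horo).comp measurable_prodMk_left)]
  refine setLIntegral_congr_fun measurableSet_Ioi fun y hy => ?_
  congr 1
  refine setLIntegral_congr_fun measurableSet_Ioc fun θ hθ => ?_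
  simp only [horo_polar x hy hθ]

theorem muSL_restrict_strip : muSL.restrict stripSL =
    (2 : ℝ≥0∞) • Measure.map horo ((volume.restrict (Ico 0 1)).prod volume) := by
  rw [muSL_eq_map_horo, Measure.restrict_smul, Measure.restrict_map measurable_horo
    measurableSet_stripSL]
  congr 2
  have : (volume.restrict (Ico (0 : ℝ) 1)).prod (volume : Measure ℂ) =
      (volume.prod volume).restrict (Ico (0 : ℝ) 1 ×ˢ univ) := by
    rw [← Measure.prod_restrict, Measure.restrict_univ]
  rw [this]
  refine Measure.restrict_congr_set ?_
  -- At v = 0 the prescribed height is 0, outside the half plane, and `uhp` takes a default value;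
  -- this null set is discarded.
  have h0 : ∀ᵐ p : ℝ × ℂ ∂volume.prod volume, p.2 ≠ 0 :=
    Measure.quasiMeasurePreserving_snd.ae (Measure.ae_ne volume 0)
  filter_upwards [h0] with p hp
  have h1 : 0 < ‖p.2‖ := norm_pos_iff.mpr hp
  refine propext ?_
  change horo p ∈ stripSL ↔ p ∈ Ico (0 : ℝ) 1 ×ˢ univ
  change (horo p • I).re ∈ Ico (0 : ℝ) 1 ↔ _
  rw [horo_smul_I, uhp_re _ (by positivity)]
  simp

theorem lintegral_strip_bot {u : ℂ → ℝ≥0∞} (hu : Measurable u) :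
    ∫⁻ h in stripSL, u (bot h) ∂muSL = 2 * ∫⁻ v, u v := by
  rw [muSL_restrict_strip, lintegral_smul_measure, lintegral_map (f := fun h => u (bot h))
    (hu.comp measurable_bot) measurable_horo, lintegral_prod (fun p => u (bot (horo p)))
    ((hu.comp measurable_bot).comp measurable_horo).aemeasurable]
  have : ∀ x : ℝ, ∫⁻ v, u (bot (horo (x, v))) = ∫⁻ v, u v := by
    intro x
    refine lintegral_congr_ae ?_
    filter_upwards [Measure.ae_ne volume (0 : ℂ)] with v hv
    rw [bot_horo x hv]
  simp_rw [this]
  simp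

/-! ### Periodization -/

/-- The `ℤ²`-periodization of a function on the plane. -/
def per (u : (Fin 2 → ℝ) → ℂ) (w : Fin 2 → ℝ) : ℂ := ∑' l : Fin 2 → ℤ, u (w + fun i => (l i : ℝ))

theorem isPer_per (u : (Fin 2 → ℝ) → ℂ) : IsPer (per u) := fun l w => by
  unfold per
  rw [← (Equiv.addLeft l).tsum_eq (fun l' : Fin 2 → ℤ => u (w + fun i => (l' i : ℝ)))]
  refine tsum_congr fun l' => ?_
  congr 1
  ext i
  simp [add_assoc]

theorem measurable_per {u : (Fin 2 → ℝ) → ℂ} (hu : Measurable u) : Measurable (per u) :=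
  Measurable.tsum fun _ => hu.comp (measurable_id.add_const _)

theorem exists_finset_of_hasCompactSupport {u : (Fin 2 → ℝ) → ℂ} (hc : HasCompactSupport u) :
    ∃ S : Finset (Fin 2 → ℤ), ∀ w ∈ box, ∀ l ∉ S, u (w + fun i => (l i : ℝ)) = 0 := by
  obtain ⟨R, hR⟩ := hc.isBounded.exists_norm_le
  obtain ⟨N, hN⟩ := exists_nat_gt (R + 1)
  refine ⟨Fintype.piFinset fun _ => Finset.Icc (-N : ℤ) N, fun w hw l hl => ?_⟩
  by_contra h
  refine hl (Fintype.mem_piFinset.2 fun i => ?_)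
  have h1 := hR _ (subset_tsupport _ h)
  have h2 := (norm_le_pi_norm _ i).trans h1
  have h3 := hw i (mem_univ i)
  rw [Pi.add_apply, Real.norm_eq_abs, abs_le] at h2
  rw [Finset.mem_Icc]
  have h4 := h3.1
  have h5 := h3.2
  constructor
  · have : ((-N : ℤ) : ℝ) < l i := by push_cast; linarith
    exact_mod_cast this.le
  · have : (l i : ℝ) < (N : ℤ) := by push_cast; linarith
    exact_mod_cast this.le

theorem memLp_per {u : (Fin 2 → ℝ) → ℂ} (hu : Continuous u) (hc : HasCompactSupport u) :
    MemLp (per u) 2 volBox := by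
  obtain ⟨S, hS⟩ := exists_finset_of_hasCompactSupport hc
  obtain ⟨C, hC⟩ := hc.exists_bound_of_continuous hu
  refine MemLp.of_bound (measurable_per hu.measurable).aestronglyMeasurable (∑ _l ∈ S, C) ?_
  filter_upwards [ae_restrict_mem measurableSet_box] with w hw
  rw [per, tsum_eq_sum (s := S) fun l hl => hS w hw l hl]
  exact norm_sum_le_of_le _ fun l _ => hC _

/-- The integer translate of the unit square. -/
def cell (l : Fin 2 → ℤ) : Set (Fin 2 → ℝ) := {w | (fun i => ⌊w i⌋) = l}

theorem measurableSet_cell (l : Fin 2 → ℤ) : MeasurableSet (cell l) :=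
  (measurable_pi_lambda _ fun i => Int.measurable_floor.comp (measurable_pi_apply i))
    (measurableSet_singleton l)

theorem preimage_cell (l : Fin 2 → ℤ) :
    (fun w : Fin 2 → ℝ => w + fun i => (l i : ℝ)) ⁻¹' cell l = box := by
  ext w
  simp only [cell, box, mem_preimage, mem_ofPred_eq, mem_pi, mem_univ, forall_true_left, funext_iff,
    Pi.add_apply, Int.floor_add_intCast, add_eq_right, Int.floor_eq_zero_iff]

theorem integral_eq_tsum_cell {g : (Fin 2 → ℝ) → ℂ} (hg : Integrable g) :
    ∫ w, g w = ∑' l : Fin 2 → ℤ, ∫ w, g (w + fun i => (l i : ℝ)) ∂volBox := by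
  have hU : (⋃ l, cell l) = univ := by
    ext w; simp [cell]
  rw [← setIntegral_univ, ← hU, integral_iUnion measurableSet_cell ?_ hg.integrableOn]
  · refine tsum_congr fun l => ?_
    rw [volBox, ← preimage_cell l]
    exact ((measurePreserving_add_right volume _).setIntegral_preimage_emb
      (MeasurableEquiv.addRight _).measurableEmbedding g _).symm
  · intro l l' hll
    refine Set.disjoint_left.2 fun w hw hw' => hll ?_
    exact Eq.trans (Eq.symm hw) hw'

/-- The unfolding behind Poisson summation: the integer translates of the unit square tile the plane
and the character is periodic. Compact support makes all the sums finite. -/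
theorem fc_per {u : (Fin 2 → ℝ) → ℂ} (hu : Continuous u) (hc : HasCompactSupport u)
    (ξ : Fin 2 → ℤ) : fc (per u) ξ = ∫ w, u w * chr ξ w := by
  obtain ⟨S, hS⟩ := exists_finset_of_hasCompactSupport hc
  have hi : Integrable fun w => u w * chr ξ w :=
    (hu.mul (continuous_chr ξ)).integrable_of_hasCompactSupport hc.mul_right
  have hz : ∀ l ∉ S, ∫ w, (fun w => u w * chr ξ w) (w + fun i => (l i : ℝ)) ∂volBox = 0 := by
    intro l hl
    refine integral_eq_zero_of_ae ?_
    filter_upwards [ae_restrict_mem measurableSet_box] with w hw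
    simp [hS w hw l hl]
  rw [integral_eq_tsum_cell hi, tsum_eq_sum hz, ← integral_finsetSum]
  · refine integral_congr_ae ?_
    filter_upwards [ae_restrict_mem measurableSet_box] with w hw
    rw [per, tsum_eq_sum (s := S) fun l hl => hS w hw l hl, Finset.sum_mul]
    refine Finset.sum_congr rfl fun l _ => ?_
    rw [isPer_chr ξ l w]
  · intro l _
    exact (hi.comp_add_right _).restrict

/-! ### Siegel–Veech transforms and their Fourier coefficients -/

theorem SVrel_mk (M : ℕ+) (f : (Fin 2 → ℝ) → ℂ) (g : SAff ℝ) :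
    SVrel M f (H00.mk g) = ∑' l : Fin 2 → ℤ, f (g.trans +
      (M : ℝ)⁻¹ • Matrix.vecMul (fun i => (l i : ℝ)) (g.lin : Matrix (Fin 2) (Fin 2) ℝ)) := by
  have hM : ((M : ℕ) : ℝ)⁻¹ ≠ 0 := by positivity
  have hinj : Function.Injective fun l : Fin 2 → ℤ => g.trans +
      (M : ℝ)⁻¹ • Matrix.vecMul (fun i => (l i : ℝ)) (g.lin : Matrix (Fin 2) (Fin 2) ℝ) := by
    intro l l' h
    have h1 := smul_right_injective _ hM (add_left_cancel h)
    have h2 : (fun i => (l i : ℝ)) = fun i => (l' i : ℝ) := by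
      have := congrArg (fun v => Matrix.vecMul v ((g.lin⁻¹ : SL(2, ℝ)) : Matrix (Fin 2) (Fin 2) ℝ)) h1
      simp only [Matrix.vecMul_vecMul, ← Matrix.SpecialLinearGroup.coe_mul, mul_inv_cancel,
        Matrix.SpecialLinearGroup.coe_one, Matrix.vecMul_one] at this
      exact this
    ext i
    exact_mod_cast congrFun h2 i
  exact tsum_range f hinj

theorem measurable_SVrel (M : ℕ+) {f : (Fin 2 → ℝ) → ℂ} (hf : Measurable f) :
    Measurable (SVrel M f) := by
  have h : Measurable fun g : SAff ℝ => SVrel M f (H00.mk g) := by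
    simp_rw [SVrel_mk]
    refine Measurable.tsum fun l => hf.comp (measurable_trans.add ?_)
    exact (measurable_vecMul.comp (measurable_const.prodMk measurable_lin)).const_smul ((M : ℝ)⁻¹)
  exact fun s hs => h hs

/-- The function on the plane whose periodization is a fibre of the Siegel–Veech transform. -/
def fibFun (M : ℕ+) (f : (Fin 2 → ℝ) → ℂ) (h : SL(2, ℝ)) (v : Fin 2 → ℝ) : ℂ :=
  f ((M : ℝ)⁻¹ • Matrix.vecMul v (h : Matrix (Fin 2) (Fin 2) ℝ))

/-- The identity wh + M⁻¹lh = M⁻¹(Mw + l)h exhibits the fibre as a periodization dilated by M, whose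
frequencies are therefore multiples of M. -/
theorem fib_SVrel (M : ℕ+) (f : (Fin 2 → ℝ) → ℂ) (h : SL(2, ℝ)) :
    fib (SVrel M f) h = fun w => per (fibFun M f h) ((M : ℝ) • w) := by
  have hM : ((M : ℕ) : ℝ) ≠ 0 := by positivity
  ext w
  rw [fib, SVrel_mk, per]
  refine tsum_congr fun l => ?_
  unfold fibFun
  congr 1
  simp [pt, SAff.ofVec, SAff.ofSL, Matrix.add_vecMul, Matrix.smul_vecMul, smul_smul, hM]

theorem continuous_vecMul_SL (h : SL(2, ℝ)) :
    Continuous fun v : Fin 2 → ℝ => Matrix.vecMul v (h : Matrix (Fin 2) (Fin 2) ℝ) :=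
  continuous_id.matrix_vecMul continuous_const

theorem continuous_fibFun (M : ℕ+) {f : (Fin 2 → ℝ) → ℂ} (hf : Continuous f) (h : SL(2, ℝ)) :
    Continuous (fibFun M f h) := by
  have h1 := continuous_vecMul_SL h
  unfold fibFun
  fun_prop

/-- The action of `SL₂(ℝ)` on row vectors. -/
def vecMulHomeo (h : SL(2, ℝ)) : (Fin 2 → ℝ) ≃ₜ (Fin 2 → ℝ) where
  toFun v := Matrix.vecMul v (h : Matrix (Fin 2) (Fin 2) ℝ)
  invFun v := Matrix.vecMul v ((h⁻¹ : SL(2, ℝ)) : Matrix (Fin 2) (Fin 2) ℝ)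
  left_inv v := by
    simp only [Matrix.vecMul_vecMul, ← Matrix.SpecialLinearGroup.coe_mul, mul_inv_cancel,
      Matrix.SpecialLinearGroup.coe_one, Matrix.vecMul_one]
  right_inv v := by
    simp only [Matrix.vecMul_vecMul, ← Matrix.SpecialLinearGroup.coe_mul, inv_mul_cancel,
      Matrix.SpecialLinearGroup.coe_one, Matrix.vecMul_one]
  continuous_toFun := continuous_vecMul_SL h
  continuous_invFun := continuous_vecMul_SL h⁻¹

theorem measurePreserving_vecMul (h : SL(2, ℝ)) :
    MeasurePreserving (vecMulHomeo h) volume volume := by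
  refine ⟨(vecMulHomeo h).continuous.measurable, ?_⟩
  have hd : (Matrix.transpose (h : Matrix (Fin 2) (Fin 2) ℝ)).det = 1 := by
    rw [Matrix.det_transpose]; exact h.2
  have := Real.map_matrix_volume_pi_eq_smul_volume_pi (M := Matrix.transpose (h : Matrix (Fin 2) (Fin 2) ℝ))
    (by rw [hd]; exact one_ne_zero)
  rw [hd] at this
  simp only [inv_one, abs_one, ENNReal.ofReal_one, one_smul] at this
  refine Eq.trans ?_ this
  congr 1
  ext v
  simp [vecMulHomeo, Matrix.toLin'_apply, Matrix.mulVec_transpose]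

theorem hasCompactSupport_fibFun (M : ℕ+) {f : (Fin 2 → ℝ) → ℂ} (hf : HasCompactSupport f)
    (h : SL(2, ℝ)) : HasCompactSupport (fibFun M f h) := by
  have hM : ((M : ℕ) : ℝ)⁻¹ ≠ 0 := by positivity
  exact hf.comp_homeomorph ((vecMulHomeo h).trans (Homeomorph.smulOfNeZero _ hM))

/-- The function on `ℂ` attached to a function on the plane. -/
def toC (f : (Fin 2 → ℝ) → ℂ) (z : ℂ) : ℂ := f ![z.re, z.im]

theorem e_eq (t : ℝ) : e (-t) = Complex.exp (((-2 * Real.pi * t : ℝ) : ℂ) * Complex.I) := by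
  unfold e; congr 1; push_cast; ring

/-- After the substitution v ↦ v h⁻¹ the character only involves the first coordinate of v h⁻¹,
which is the inner product of v with `bot h`; the top row drops out. Rescaling by M produces M². -/
theorem integral_fibFun_mul_chr (M : ℕ+) (f : (Fin 2 → ℝ) → ℂ) (h : SL(2, ℝ)) (ξ : Fin 2 → ℤ)
    (k : ℤ) (hξ : ξ = ![k, 0]) :
    ∫ v, fibFun M f h v * chr ξ v =
      (M : ℂ) ^ 2 * FourierTransform.fourier (toC f) ((M * k : ℝ) * bot h) := by
  have hM : ((M : ℕ) : ℝ) ≠ 0 := by positivity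
  subst hξ
  have e1 : ∫ v, fibFun M f h v * chr ![k, 0] v = ∫ v, f ((M : ℝ)⁻¹ • v) *
      e (-(k * (v 0 * h 1 1 - v 1 * h 1 0))) := by
    rw [← (measurePreserving_vecMul h).integral_comp' (f := (vecMulHomeo h).toMeasurableEquiv)
      (g := fun v : Fin 2 → ℝ => f ((M : ℝ)⁻¹ • v) * e (-(k * (v 0 * h 1 1 - v 1 * h 1 0))))]
    refine integral_congr_ae (ae_of_all _ fun v => ?_)
    have hd : h 0 0 * h 1 1 - h 0 1 * h 1 0 = 1 := by
      have := h.2; rwa [Matrix.det_fin_two] at this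
    simp only [fibFun, chr, Homeomorph.toMeasurableEquiv_coe, vecMulHomeo, Homeomorph.homeomorph_mk_coe,
      Equiv.coe_fn_mk]
    congr 2
    simp only [Matrix.cons_val_zero, Matrix.cons_val_one, Int.cast_zero, zero_mul, add_zero,
      Matrix.vecMul, dotProduct, Fin.sum_univ_two]
    linear_combination (k * v 0 : ℝ) * hd
  have e2 : ∫ v, f ((M : ℝ)⁻¹ • v) * e (-(k * (v 0 * h 1 1 - v 1 * h 1 0))) =
      (M : ℂ) ^ 2 * ∫ v, f v * e (-(M * k * (v 0 * h 1 1 - v 1 * h 1 0))) := by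
    have := Measure.integral_comp_smul (volume : Measure (Fin 2 → ℝ))
      (fun v => f v * e (-(M * k * (v 0 * h 1 1 - v 1 * h 1 0)))) (M : ℝ)⁻¹
    rw [Module.finrank_fin_fun, inv_pow, inv_inv, abs_of_nonneg (by positivity)] at this
    rw [Complex.real_smul] at this
    push_cast at this
    rw [← this]
    refine integral_congr_ae (ae_of_all _ fun v => ?_)
    simp only [Pi.smul_apply, smul_eq_mul]
    congr 3
    field_simp
  rw [e1, e2]
  congr 1
  rw [Real.fourier_eq', ← Complex.volume_preserving_equiv_pi.integral_comp'
    (f := Complex.measurableEquivPi)]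
  refine integral_congr_ae (ae_of_all _ fun z => ?_)
  simp only [toC, smul_eq_mul]
  rw [mul_comm, e_eq]
  congr 1
  · congr 4
    simp [Complex.inner, bot, Complex.measurableEquivPi_apply]
    ring
  
theorem co_SVrel_freq (M : ℕ+) {f : (Fin 2 → ℝ) → ℂ} (hf : Continuous f)
    (hc : HasCompactSupport f) (h : SL(2, ℝ)) (d : ℕ+) :
    co (SVrel M f) (freq d) h = if (M : ℕ) ∣ d then
      (M : ℂ) ^ 2 * FourierTransform.fourier (toC f) ((d : ℝ) * bot h) else 0 := by
  have hm := measurable_per (continuous_fibFun M hf h).measurable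
  rw [co, fib_SVrel]
  split_ifs with hd
  · obtain ⟨k, rfl⟩ := PNat.dvd_iff.2 hd
    have : freq (M * k) = fun i => (M : ℤ) * (![(k : ℤ), 0] : Fin 2 → ℤ) i := by
      ext i; fin_cases i <;> simp [freq]
    rw [this, fc_comp_smul (isPer_per _) hm, fc_per (continuous_fibFun M hf h)
      (hasCompactSupport_fibFun M hc h), integral_fibFun_mul_chr M f h _ k rfl]
    push_cast
    rfl
  · refine fc_comp_smul_of_not_dvd (isPer_per _) hm M (i := 0) fun h' => hd ?_
    simp only [freq, Matrix.cons_val_zero] at h'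
    exact_mod_cast h'

theorem co_SVrel_zero (M : ℕ+) {f : (Fin 2 → ℝ) → ℂ} (hf : Continuous f)
    (hc : HasCompactSupport f) (h0 : ∫ w, f w = 0) (h : SL(2, ℝ)) : co (SVrel M f) 0 h = 0 := by
  have hm := measurable_per (continuous_fibFun M hf h).measurable
  have : (0 : Fin 2 → ℤ) = fun i => (M : ℤ) * (![((0 : ℤ) : ℤ), 0] : Fin 2 → ℤ) i := by
    ext i; fin_cases i <;> simp
  rw [co, fib_SVrel, this, fc_comp_smul (isPer_per _) hm, fc_per (continuous_fibFun M hf h)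
      (hasCompactSupport_fibFun M hc h), integral_fibFun_mul_chr M f h _ 0 rfl]
  rw [Real.fourier_eq']
  simp only [Int.cast_zero, mul_zero, Complex.ofReal_zero, zero_mul, inner_zero_right,
    Complex.exp_zero, one_smul]
  have e : ∫ z, toC f z = ∫ w, f w :=
    Complex.volume_preserving_equiv_pi.integral_comp' (f := Complex.measurableEquivPi) f
  rw [e, h0, mul_zero]

theorem ae_memLp_fib_SVrel (M : ℕ+) {f : (Fin 2 → ℝ) → ℂ} (hf : Continuous f)
    (hc : HasCompactSupport f) (h : SL(2, ℝ)) : MemLp (fib (SVrel M f) h) 2 volBox := by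
  have hm := measurable_per (continuous_fibFun M hf h).measurable
  have h2 := memLp_per (continuous_fibFun M hf h) (hasCompactSupport_fibFun M hc h)
  have hm' : Measurable fun w => per (fibFun M f h) ((M : ℝ) • w) :=
    hm.comp (measurable_const_smul _)
  rw [fib_SVrel, memLp_two_iff hm'.aestronglyMeasurable]
  rw [memLp_two_iff hm.aestronglyMeasurable] at h2
  refine lt_of_le_of_lt (le_of_eq ?_) h2
  have hd : (Matrix.diagonal fun _ : Fin 2 => (M : ℤ)).det ≠ 0 := by
    simp
  rw [← lintegral_box_vecMul hd (g := fun w => ‖per (fibFun M f h) w‖ₑ ^ 2)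
    (fun l w => by simp only [isPer_per _ l w]) (hm.enorm.pow_const 2)]
  refine lintegral_congr fun w => ?_
  congr 3
  ext i
  simp [Matrix.diagonal_map, Matrix.vecMul_diagonal, mul_comm]

/-! ### Square integrability of Siegel–Veech transforms -/

theorem toC_eq (f : (Fin 2 → ℝ) → ℂ) : toC f = f ∘ Complex.basisOneI.equivFunL := by
  ext z
  have : Complex.basisOneI.equivFunL z = ![z.re, z.im] := by
    change Complex.basisOneI.equivFun z = _
    rw [Module.Basis.equivFun_apply, Complex.coe_basisOneI_repr]
  simp [toC, this]

theorem IsTestFunction.continuous {f : (Fin 2 → ℝ) → ℂ} (hf : IsTestFunction f) : Continuous f :=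
  hf.1.continuous

theorem IsTestFunction.hasCompactSupport_toC {f : (Fin 2 → ℝ) → ℂ} (hf : IsTestFunction f) :
    HasCompactSupport (toC f) := by
  rw [toC_eq]
  exact hf.2.1.comp_homeomorph Complex.basisOneI.equivFunL.toHomeomorph

theorem IsTestFunction.contDiff_toC {f : (Fin 2 → ℝ) → ℂ} (hf : IsTestFunction f) :
    ContDiff ℝ ∞ (toC f) := by
  rw [toC_eq]
  exact hf.1.comp Complex.basisOneI.equivFunL.contDiff

/-- The Schwartz function on `ℂ` attached to a test function on the plane. -/
def IsTestFunction.schwartz {f : (Fin 2 → ℝ) → ℂ} (hf : IsTestFunction f) : SchwartzMap ℂ ℂ :=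
  hf.hasCompactSupport_toC.toSchwartzMap hf.contDiff_toC

theorem IsTestFunction.fourier_toC {f : (Fin 2 → ℝ) → ℂ} (hf : IsTestFunction f) :
    FourierTransform.fourier (toC f) = FourierTransform.fourier hf.schwartz := by
  rw [SchwartzMap.fourier_coe]
  rfl

theorem IsTestFunction.continuous_fourier {f : (Fin 2 → ℝ) → ℂ} (hf : IsTestFunction f) :
    Continuous (FourierTransform.fourier (toC f)) := by
  rw [hf.fourier_toC]
  exact SchwartzMap.continuous _

theorem IsTestFunction.memLp_fourier {f : (Fin 2 → ℝ) → ℂ} (hf : IsTestFunction f) :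
    MemLp (FourierTransform.fourier (toC f)) 2 volume := by
  rw [hf.fourier_toC]
  exact SchwartzMap.memLp _ 2 _

theorem lintegral_comp_smul {u : ℂ → ℝ≥0∞} (hu : Measurable u) (d : ℕ+) :
    ∫⁻ v, u ((d : ℝ) • v) = ENNReal.ofReal (((d : ℝ) ^ 2)⁻¹) * ∫⁻ v, u v := by
  have hd : ((d : ℕ) : ℝ) ≠ 0 := by positivity
  have := Measure.map_addHaar_smul (volume : Measure ℂ) hd
  rw [Complex.finrank_real_complex, abs_of_nonneg (by positivity)] at this
  rw [← lintegral_map hu (measurable_const_smul _), this, lintegral_smul_measure, smul_eq_mul]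

/-- The frequency (d, 0) contributes at most a constant times ∫ |f̂(dv)|² dv, which is d⁻² ∫ |f̂|²
because v ranges over a plane; the sum over d converges. -/
theorem memLp_SVrel (M : ℕ+) {f : (Fin 2 → ℝ) → ℂ} (hf : IsTestFunction f) :
    MemLp (SVrel M f) 2 muMV := by
  have hm := measurable_SVrel M hf.continuous.measurable
  rw [memLp_two_iff hm.aestronglyMeasurable, enorm_sq_eq_tsum_strip hm
    (ae_of_all _ (ae_memLp_fib_SVrel M hf.continuous hf.2.1))
    (ae_of_all _ (co_SVrel_zero M hf.continuous hf.2.1 hf.2.2))]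
  set Φ := FourierTransform.fourier (toC f) with hΦ
  have hΦm : Measurable fun v => ‖Φ v‖ₑ ^ 2 := hf.continuous_fourier.measurable.enorm.pow_const 2
  have hC : ∫⁻ v, ‖Φ v‖ₑ ^ 2 < ⊤ :=
    (memLp_two_iff hf.continuous_fourier.aestronglyMeasurable).1 hf.memLp_fourier
  have key : ∀ d : ℕ+, ∫⁻ h in stripSL, ‖co (SVrel M f) (freq d) h‖ₑ ^ 2 ∂muSL ≤
      ENNReal.ofReal (((d : ℝ) ^ 2)⁻¹) * (‖(M : ℂ) ^ 2‖ₑ ^ 2 * (2 * ∫⁻ v, ‖Φ v‖ₑ ^ 2)) := by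
    intro d
    have hle : ∀ h, ‖co (SVrel M f) (freq d) h‖ₑ ^ 2 ≤
        ‖(M : ℂ) ^ 2‖ₑ ^ 2 * ‖Φ ((d : ℝ) • bot h)‖ₑ ^ 2 := by
      intro h
      rw [co_SVrel_freq M hf.continuous hf.2.1]
      split_ifs
      · rw [enorm_mul, mul_pow, hΦ, Complex.real_smul]
      · simp
    refine (lintegral_mono hle).trans (le_of_eq ?_)
    have hm2 : Measurable fun v : ℂ => ‖Φ ((d : ℝ) • v)‖ₑ ^ 2 :=
      hΦm.comp (measurable_const_smul (d : ℝ))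
    have hm3 : Measurable fun h => ‖Φ ((d : ℝ) • bot h)‖ₑ ^ 2 := hm2.comp measurable_bot
    rw [lintegral_const_mul _ hm3,
      lintegral_strip_bot (u := fun v => ‖Φ ((d : ℝ) • v)‖ₑ ^ 2) hm2,
      lintegral_comp_smul (u := fun v => ‖Φ v‖ₑ ^ 2) hΦm]
    ring
  refine (ENNReal.tsum_le_tsum key).trans_lt ?_
  rw [ENNReal.tsum_mul_right]
  refine ENNReal.mul_lt_top ?_ (ENNReal.mul_lt_top (by simp [enorm_lt_top])
    (ENNReal.mul_lt_top (by simp) hC))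
  have hs : Summable fun d : ℕ+ => ((d : ℝ) ^ 2)⁻¹ :=
    (Real.summable_nat_pow_inv.2 one_lt_two).comp_injective PNat.coe_injective
  exact hs.tsum_ofReal_lt_top

theorem mem_genuinePart_of_ae_eq_SVrel {M : ℕ+} {f : (Fin 2 → ℝ) → ℂ} (hf : IsTestFunction f)
    {F : L2H00} (hF : F =ᵐ[muMV] SVrel M f) : F ∈ genuinePart := by
  rw [mem_genuinePart_iff]
  filter_upwards [co_congr_ae hF] with h hh
  rw [hh, co_SVrel_zero M hf.continuous hf.2.1 hf.2.2]

/-! ### Pairing with Siegel–Veech transforms -/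

/-- The constant term, along the horocycle with frame coordinate `v`, of a Fourier coefficient. -/
def constTerm (F : H00 → ℂ) (ξ : Fin 2 → ℤ) (v : ℂ) : ℂ := ∫ x in Ico (0 : ℝ) 1, co F ξ (horo (x, v))

theorem measurable_constTerm {F : H00 → ℂ} (hF : Measurable F) (ξ : Fin 2 → ℤ) :
    Measurable (constTerm F ξ) := by
  have h : Measurable fun p : ℂ × ℝ => co F ξ (horo (p.2, p.1)) :=
    (measurable_co hF ξ).comp (measurable_horo.comp (measurable_snd.prodMk measurable_fst))
  exact (StronglyMeasurable.integral_prod_right h.stronglyMeasurable).measurable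

theorem lintegral_strip {u : SL(2, ℝ) → ℝ≥0∞} (hu : Measurable u) :
    ∫⁻ h in stripSL, u h ∂muSL = 2 * ∫⁻ v, ∫⁻ x in Ico (0 : ℝ) 1, u (horo (x, v)) := by
  rw [muSL_restrict_strip, lintegral_smul_measure, lintegral_map hu measurable_horo,
    lintegral_prod_symm (f := fun p => u (horo p)) (hu.comp measurable_horo).aemeasurable]
  rfl

theorem integral_strip {u : SL(2, ℝ) → ℂ} (hu : Measurable u)
    (hi : IntegrableOn u stripSL muSL) :
    ∫ h in stripSL, u h ∂muSL = 2 * ∫ v, ∫ x in Ico (0 : ℝ) 1, u (horo (x, v)) := by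
  have hi' : Integrable (fun p => u (horo p)) ((volume.restrict (Ico (0 : ℝ) 1)).prod volume) := by
    rw [IntegrableOn, muSL_restrict_strip, integrable_smul_measure (by simp) (by simp)] at hi
    exact hi.comp_measurable measurable_horo
  rw [muSL_restrict_strip, integral_smul_measure,
    integral_map measurable_horo.aemeasurable hu.aestronglyMeasurable, integral_prod_symm _ hi']
  simp [Complex.real_smul]

theorem lintegral_enorm_sq_co_lt_top {F : H00 → ℂ} (hF : Measurable F) (h2 : MemLp F 2 muMV)
    (h0 : ∀ᵐ h ∂muSL.restrict domSL, co F 0 h = 0) (d : ℕ+) :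
    ∫⁻ h in stripSL, ‖co F (freq d) h‖ₑ ^ 2 ∂muSL < ⊤ := by
  have h := (memLp_two_iff hF.aestronglyMeasurable).1 h2
  rw [enorm_sq_eq_tsum_strip hF (ae_memLp_fib hF h2) h0] at h
  exact (ENNReal.le_tsum d).trans_lt h

/-- Cauchy–Schwarz on an interval of length one bounds the square of the constant term by the mean
square in x. -/
theorem memLp_constTerm {F : H00 → ℂ} (hF : Measurable F) (h2 : MemLp F 2 muMV)
    (h0 : ∀ᵐ h ∂muSL.restrict domSL, co F 0 h = 0) (d : ℕ+) :
    MemLp (constTerm F (freq d)) 2 volume := by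
  rw [memLp_two_iff (measurable_constTerm hF _).aestronglyMeasurable]
  have h := lintegral_enorm_sq_co_lt_top hF h2 h0 d
  rw [lintegral_strip ((measurable_co hF _).enorm.pow_const 2)] at h
  have h' : ∫⁻ v, ∫⁻ x in Ico (0 : ℝ) 1, ‖co F (freq d) (horo (x, v))‖ₑ ^ 2 < ⊤ := by
    refine lt_of_le_of_lt ?_ h
    exact le_mul_of_one_le_left zero_le one_le_two
  refine lt_of_le_of_lt (lintegral_mono fun v => ?_) h'
  have hm : Measurable fun x : ℝ => co F (freq d) (horo (x, v)) :=
    (measurable_co hF _).comp (measurable_horo.comp (measurable_id.prodMk measurable_const))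
  have hJ := ENNReal.lintegral_mul_le_Lp_mul_Lq (volume.restrict (Ico (0 : ℝ) 1))
    Real.HolderConjugate.two_two hm.enorm.aemeasurable
    (measurable_const (a := (1 : ℝ≥0∞))).aemeasurable
  simp only [Pi.mul_apply, mul_one, ENNReal.one_rpow, lintegral_const, Measure.restrict_apply,
    MeasurableSet.univ, univ_inter, Real.volume_Ico, sub_zero, ENNReal.ofReal_one] at hJ
  calc ‖constTerm F (freq d) v‖ₑ ^ 2
      ≤ (∫⁻ x in Ico (0 : ℝ) 1, ‖co F (freq d) (horo (x, v))‖ₑ) ^ 2 := by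
        gcongr; exact enorm_integral_le_lintegral_enorm _
    _ ≤ ((∫⁻ x in Ico (0 : ℝ) 1, ‖co F (freq d) (horo (x, v))‖ₑ ^ (2 : ℝ)) ^ (1 / 2 : ℝ)) ^ 2 := by
        gcongr
    _ = ∫⁻ x in Ico (0 : ℝ) 1, ‖co F (freq d) (horo (x, v))‖ₑ ^ 2 := by
        rw [← ENNReal.rpow_natCast, ← ENNReal.rpow_mul]
        norm_num

/-- The contribution of one frequency to the pairing with a Siegel–Veech transform. -/
def freqPairing (F : H00 → ℂ) (f : (Fin 2 → ℝ) → ℂ) (d : ℕ+) : ℂ :=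
  ∫ v, conj (FourierTransform.fourier (toC f) ((d : ℝ) • v)) * constTerm F (freq d) v

/-- The coefficient of the Siegel–Veech transform depends on the bottom row alone, so the integral
over x falls entirely on F. -/
theorem strip_pairing {F : H00 → ℂ} (hF : Measurable F) (h2 : MemLp F 2 muMV)
    (h0 : ∀ᵐ h ∂muSL.restrict domSL, co F 0 h = 0) {f : (Fin 2 → ℝ) → ℂ} (hf : IsTestFunction f)
    (M d : ℕ+) :
    ∫ h in stripSL, conj (co (SVrel M f) (freq d) h) * co F (freq d) h ∂muSL =
      if (M : ℕ) ∣ d then (2 * (M : ℂ) ^ 2) * freqPairing F f d else 0 := by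
  have hm := measurable_SVrel M hf.continuous.measurable
  have hint : IntegrableOn (fun h => conj (co (SVrel M f) (freq d) h) * co F (freq d) h)
      stripSL muSL := by
    refine MemLp.integrable_mul (p := 2) (q := 2)
      (f := fun h => conj (co (SVrel M f) (freq d) h)) ?_ ?_
    · refine MemLp.star ?_
      exact (memLp_two_iff (measurable_co hm _).aestronglyMeasurable).2
        (lintegral_enorm_sq_co_lt_top hm (memLp_SVrel M hf)
          (ae_of_all _ (co_SVrel_zero M hf.continuous hf.2.1 hf.2.2)) d)
    · exact (memLp_two_iff (measurable_co hF _).aestronglyMeasurable).2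
        (lintegral_enorm_sq_co_lt_top hF h2 h0 d)
  have hmeas : Measurable fun h => conj (co (SVrel M f) (freq d) h) * co F (freq d) h :=
    (Complex.continuous_conj.measurable.comp (measurable_co hm _)).mul (measurable_co hF _)
  rw [integral_strip hmeas hint]
  split_ifs with hd
  · rw [mul_assoc, freqPairing, ← integral_const_mul ((M : ℂ) ^ 2)]
    congr 1
    refine integral_congr_ae ?_
    have hv : ∀ᵐ v : ℂ, v ≠ 0 := by
      simp [ae_iff, measure_singleton]
    filter_upwards [hv] with v hv
    rw [constTerm, ← integral_const_mul, ← integral_const_mul]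
    refine integral_congr_ae (ae_of_all _ fun x => ?_)
    simp only [co_SVrel_freq M hf.continuous hf.2.1, hd, if_true, bot_horo x hv, map_mul, map_pow,
      Complex.real_smul, Complex.conj_natCast]
    ring
  · simp [co_SVrel_freq M hf.continuous hf.2.1, hd]

theorem integral_conj_SVrel_mul {F : H00 → ℂ} (hF : Measurable F) (h2 : MemLp F 2 muMV)
    (h0 : ∀ᵐ h ∂muSL.restrict domSL, co F 0 h = 0) {f : (Fin 2 → ℝ) → ℂ} (hf : IsTestFunction f)
    (M : ℕ+) :
    (Summable fun d : ℕ+ => if (M : ℕ) ∣ d then (2 * (M : ℂ) ^ 2) * freqPairing F f d else 0) ∧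
    ∫ x, conj (SVrel M f x) * F x ∂muMV =
      ∑' d : ℕ+, if (M : ℕ) ∣ d then (2 * (M : ℂ) ^ 2) * freqPairing F f d else 0 := by
  have := integral_conj_mul_eq_tsum (measurable_SVrel M hf.continuous.measurable) hF
    (memLp_SVrel M hf) h2 (ae_of_all _ (co_SVrel_zero M hf.continuous hf.2.1 hf.2.2))
  simp only [strip_pairing hF h2 h0 hf] at this
  exact this

/-! ### Recovering a summable sequence from its sums over multiples -/

/-- The sums of `a` over the multiples in `S` of every positive integer vanish. -/
def SumsOverMultiplesVanish (a : ℕ+ → ℂ) (S : Set ℕ+) : Prop :=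
  ∀ M : ℕ+, ∑' d, (S ∩ {d | (M : ℕ) ∣ d}).indicator a d = 0

/-- Being a multiple of both q and M is being a multiple of their least common multiple. Demanding
vanishing for every M at once is what lets the sieve be iterated. -/
theorem SumsOverMultiplesVanish.inter {a : ℕ+ → ℂ} {S : Set ℕ+}
    (h : SumsOverMultiplesVanish a S) (q : ℕ+) :
    SumsOverMultiplesVanish a (S ∩ {d | (q : ℕ) ∣ d}) := fun M => by
  have : S ∩ {d | (q : ℕ) ∣ d} ∩ {d | (M : ℕ) ∣ d} = S ∩ {d | (PNat.lcm q M : ℕ) ∣ d} := by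
    ext d
    simp only [mem_inter_iff, mem_ofPred_eq, PNat.lcm_coe, Nat.lcm_dvd_iff, and_assoc]
  rw [this, h]

theorem SumsOverMultiplesVanish.diff {a : ℕ+ → ℂ} (ha : Summable a) {S : Set ℕ+}
    (h : SumsOverMultiplesVanish a S) (q : ℕ+) :
    SumsOverMultiplesVanish a (S \ {d | (q : ℕ) ∣ d}) := fun M => by
  have h1 : (S \ {d | (q : ℕ) ∣ d} ∩ {d | (M : ℕ) ∣ d}).indicator a =
      (S ∩ {d | (M : ℕ) ∣ d}).indicator a -
        ((S ∩ {d | (q : ℕ) ∣ d}) ∩ {d | (M : ℕ) ∣ d}).indicator a := by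
    ext d
    by_cases hS : d ∈ S <;> by_cases hq : (q : ℕ) ∣ d <;> by_cases hM : (M : ℕ) ∣ d <;>
      simp [indicator, hS, hq, hM]
  rw [h1]
  simp only [Pi.sub_apply]
  rw [Summable.tsum_sub (ha.indicator _) (ha.indicator _), h M, h.inter q M, sub_zero]

/-- A sieve: among the multiples of n, remove in turn those of 2n, 3n, and so on. All sums stay
zero, the remaining set shrinks to {n}, and dominated convergence by the summable norms leaves a n =
0. -/
theorem eq_zero_of_sums_over_multiples {a : ℕ+ → ℂ} (ha : Summable a)
    (h : ∀ M : ℕ+, ∑' d : ℕ+, (if (M : ℕ) ∣ d then a d else 0) = 0) (n : ℕ+) : a n = 0 := by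
  classical
  have h0 : SumsOverMultiplesVanish a univ := fun M => by
    rw [← h M]
    refine tsum_congr fun d => ?_
    simp [indicator]
  have hN : ∀ N : ℕ, SumsOverMultiplesVanish a
      {d | (n : ℕ) ∣ d ∧ ∀ j : ℕ, j < N → ¬ ((n * (j + 2) : ℕ) ∣ d)} := by
    intro N
    induction N with
    | zero => simpa using h0.inter n
    | succ N ih =>
      convert ih.diff ha (n * ⟨N + 2, by omega⟩) using 1
      ext d
      simp only [mem_ofPred_eq, mem_sdiff, and_assoc]
      refine and_congr_right fun _ => ?_
      constructor
      · exact fun H => ⟨fun j hj => H j (by omega), H N (by omega)⟩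
      · rintro ⟨H1, H2⟩ j hj
        rcases Nat.lt_succ_iff_lt_or_eq.1 hj with hj | rfl
        · exact H1 j hj
        · exact H2
  -- Taking M = 1 in `hN` makes the divisibility condition empty, so this is the sum over the whole
  -- sieved set.
  have hlim := tendsto_tsum_of_dominated_convergence (𝓕 := Filter.atTop) (bound := fun d => ‖a d‖)
    (f := fun (N : ℕ) d => ({d : ℕ+ | (n : ℕ) ∣ d ∧ ∀ j : ℕ, j < N → ¬ ((n * (j + 2) : ℕ) ∣ d)}
      ∩ {d | ((1 : ℕ+) : ℕ) ∣ d}).indicator a d)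
    (g := fun d => if d = n then a n else 0) ha.norm ?_ ?_
  · simp only [fun N => hN N 1, tsum_ite_eq] at hlim
    exact (tendsto_nhds_unique hlim tendsto_const_nhds)
  · intro d
    refine tendsto_const_nhds.congr' ?_
    filter_upwards [Filter.eventually_ge_atTop ((d : ℕ) + 1)] with N hN
    by_cases hd : d = n
    · subst hd
      rw [if_pos rfl, indicator_of_mem]
      refine ⟨⟨dvd_rfl, fun j _ hj => ?_⟩, by simp⟩
      have := Nat.le_of_dvd d.pos hj
      have := d.pos
      nlinarith
    · rw [if_neg hd, indicator_of_notMem]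
      rintro ⟨⟨⟨k, hk⟩, h2⟩, -⟩
      have hk0 : k ≠ 0 := by
        rintro rfl
        simp at hk
      have hk1 : k ≠ 1 := by
        rintro rfl
        exact hd (PNat.eq (by simpa using hk))
      have hle : k ≤ d := Nat.le_of_dvd d.pos ⟨n, by rw [hk, mul_comm]⟩
      refine h2 (k - 2) (by omega) ?_
      rw [hk, Nat.sub_add_cancel (by omega)]
  · exact Filter.Eventually.of_forall fun N d => norm_indicator_le_norm_self a d

/-! ### Functions orthogonal to all Fourier transforms of mean-zero test functions -/

theorem ae_eq_zero_of_memLp_of_ae_const {G : ℂ → ℂ} (h2 : MemLp G 2 volume) {K : ℂ}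
    (hK : ∀ᵐ z, G z = K) : K = 0 := by
  have h := (memLp_congr_ae (show G =ᵐ[volume] fun _ => K from hK)).1 h2
  rcases (memLp_const_iff (by norm_num) (by norm_num)).1 h with h | h
  · exact h
  · simp at h

/-- Subtracting a multiple of a bump of integral one turns any test function into one of mean zero.
Hence G annihilates all test functions up to a constant K, so G = K almost everywhere, and a
constant in L² of the plane is zero. -/
theorem ae_eq_zero_of_forall_integral_mul {G : ℂ → ℂ} (h2 : MemLp G 2 volume)
    (h : ∀ g : ℂ → ℝ, ContDiff ℝ ∞ g → HasCompactSupport g → ∫ z, g z = 0 →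
      ∫ z, (g z : ℂ) * G z = 0) : ∀ᵐ z, G z = 0 := by
  have hloc : LocallyIntegrable G := h2.locallyIntegrable (by norm_num)
  let ψ₀ : ContDiffBump (0 : ℂ) := ⟨1, 2, one_pos, one_lt_two⟩
  set ψ : ℂ → ℝ := ψ₀.normed volume with hψ
  have hψs : ContDiff ℝ ∞ ψ := ψ₀.contDiff_normed
  have hψc : HasCompactSupport ψ := ψ₀.hasCompactSupport_normed
  have hψ1 : ∫ z, ψ z = 1 := ψ₀.integral_normed
  set K : ℂ := ∫ z, (ψ z : ℂ) * G z
  have hint : ∀ {g : ℂ → ℝ}, Continuous g → HasCompactSupport g →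
      Integrable fun z => (g z : ℂ) * G z := by
    intro g hg hc
    have := hloc.integrable_smul_left_of_hasCompactSupport hg hc
    simpa [Complex.real_smul] using this
  have key : ∀ g : ℂ → ℝ, ContDiff ℝ ∞ g → HasCompactSupport g →
      ∫ z, g z • (G z - K) = 0 := by
    intro g hg hc
    have hgi : Integrable g := hg.continuous.integrable_of_hasCompactSupport hc
    have hψi : Integrable ψ := hψs.continuous.integrable_of_hasCompactSupport hψc
    set t : ℝ := ∫ z, g z
    have h1 := h (fun z => g z - t * ψ z) (hg.sub (contDiff_const.mul hψs))
      (hc.sub (hψc.mul_left (f := fun _ => t))) (by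
        rw [integral_sub hgi (hψi.const_mul t), integral_const_mul, hψ1, mul_one, sub_self])
    have h3 : ∫ z, ((g z - t * ψ z : ℝ) : ℂ) * G z = (∫ z, (g z : ℂ) * G z) - t * K := by
      rw [← integral_const_mul, ← integral_sub (hint hg.continuous hc)
        ((hint hψs.continuous hψc).const_mul _)]
      refine integral_congr_ae (ae_of_all _ fun z => ?_)
      push_cast
      ring
    rw [h3] at h1
    have h4 : ∫ z, (g z : ℂ) * K = t * K := by
      rw [integral_mul_const, integral_complex_ofReal]
    have hgi' : Integrable fun z => (g z : ℂ) := hgi.ofReal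
    rw [← h1, ← h4, ← integral_sub (hint hg.continuous hc) (hgi'.mul_const K)]
    refine integral_congr_ae (ae_of_all _ fun z => ?_)
    simp only [Complex.real_smul]
    ring
  have h0 := ae_eq_zero_of_integral_contDiff_smul_eq_zero
    (hloc.sub (locallyIntegrable_const K)) key
  have hK : ∀ᵐ z, G z = K := by
    filter_upwards [h0] with z hz
    exact sub_eq_zero.1 hz
  have hK0 := ae_eq_zero_of_memLp_of_ae_const h2 hK
  filter_upwards [hK] with z hz
  rw [hz, hK0]

theorem isTestFunction_comp_equivFunL_symm {g : ℂ → ℝ} (hg : ContDiff ℝ ∞ g)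
    (hc : HasCompactSupport g) (h0 : ∫ z, g z = 0) :
    IsTestFunction fun w => (g (Complex.basisOneI.equivFunL.symm w) : ℂ) := by
  refine ⟨?_, ?_, ?_⟩
  · exact Complex.ofRealCLM.contDiff.comp (hg.comp Complex.basisOneI.equivFunL.symm.contDiff)
  · have h1 : HasCompactSupport fun z => (g z : ℂ) := hc.comp_left (g := Complex.ofReal) rfl
    exact h1.comp_homeomorph Complex.basisOneI.equivFunL.symm.toHomeomorph
  · rw [← Complex.volume_preserving_equiv_pi.integral_comp' (f := Complex.measurableEquivPi)]
    have : ∀ z, Complex.basisOneI.equivFunL.symm (Complex.measurableEquivPi z) = z := by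
      intro z
      rw [ContinuousLinearEquiv.symm_apply_eq]
      change _ = Complex.basisOneI.equivFun z
      rw [Module.Basis.equivFun_apply, Complex.coe_basisOneI_repr]
      simp [Complex.measurableEquivPi_apply]
    simp only [this]
    rw [integral_complex_ofReal, h0, Complex.ofReal_zero]

theorem toC_comp_equivFunL_symm (g : ℂ → ℝ) :
    toC (fun w => (g (Complex.basisOneI.equivFunL.symm w) : ℂ)) = fun z => (g z : ℂ) := by
  rw [toC_eq]
  ext z
  simp

/-- By Plancherel the hypothesis says that the inverse Fourier transform of c annihilates mean-zero
test functions. Real test functions suffice, so the conjugation disappears. -/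
theorem ae_eq_zero_of_forall_fourier {c : ℂ → ℂ} (h2 : MemLp c 2 volume)
    (h : ∀ f : (Fin 2 → ℝ) → ℂ, IsTestFunction f →
      ∫ v, conj (FourierTransform.fourier (toC f) v) * c v = 0) : ∀ᵐ v, c v = 0 := by
  let C : Lp ℂ 2 (volume : Measure ℂ) := h2.toLp c
  let G : Lp ℂ 2 (volume : Measure ℂ) := FourierTransformInv.fourierInv C
  have hGC : FourierTransform.fourier G = C := FourierTransform.fourier_fourierInv_eq C
  have hG0 : ∀ᵐ z, G z = 0 := by
    refine ae_eq_zero_of_forall_integral_mul (Lp.memLp G) fun g hg hc h0 => ?_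
    have hf := isTestFunction_comp_equivFunL_symm hg hc h0
    have h3 := h _ hf
    let S : Lp ℂ 2 (volume : Measure ℂ) := hf.schwartz.toLp 2 volume
    have hS : S =ᵐ[volume] fun z => (g z : ℂ) := by
      refine (SchwartzMap.coeFn_toLp hf.schwartz 2 volume).trans ?_
      rw [← toC_comp_equivFunL_symm g]
      rfl
    have h4 : inner ℂ S G = 0 := by
      rw [← Lp.inner_fourier_eq, hGC, SchwartzMap.toLp_fourier_eq, inner_L2_eq, ← h3]
      refine integral_congr_ae ?_
      filter_upwards [h2.coeFn_toLp, SchwartzMap.coeFn_toLp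
        (FourierTransform.fourier hf.schwartz) 2 volume] with v hv hv'
      rw [hv, hv', ← hf.fourier_toC]
    rw [inner_L2_eq] at h4
    rw [← h4]
    refine integral_congr_ae ?_
    filter_upwards [hS] with z hz
    rw [hz, Complex.conj_ofReal]
  have hG : G = 0 := by
    refine Lp.ext ?_
    filter_upwards [hG0, Lp.coeFn_zero ℂ 2 (volume : Measure ℂ)] with z hz hz'
    rw [hz, hz']
    rfl
  have hC : C = 0 := by rw [← hGC, hG, FourierTransform.fourier_zero]
  filter_upwards [h2.coeFn_toLp, Lp.coeFn_zero ℂ 2 (volume : Measure ℂ)] with v hv hv'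
  change C v = c v at hv
  rw [← hv, hC, hv']
  rfl

/-! ### Orthogonality to Siegel–Veech transforms in terms of constant terms -/

/-- For a fixed f the sieve over multiples isolates the contribution of one d; varying f then forces
the constant term itself to vanish. -/
theorem ae_constTerm_eq_zero {F : H00 → ℂ} (hF : Measurable F) (h2 : MemLp F 2 muMV)
    (h0 : ∀ᵐ h ∂muSL.restrict domSL, co F 0 h = 0)
    (hperp : ∀ (M : ℕ+) (f : (Fin 2 → ℝ) → ℂ), IsTestFunction f →
      ∫ x, conj (SVrel M f x) * F x ∂muMV = 0) (d : ℕ+) :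
    ∀ᵐ v, constTerm F (freq d) v = 0 := by
  have hd : ((d : ℕ) : ℝ) ≠ 0 := by positivity
  have hpair : ∀ f, IsTestFunction f → freqPairing F f d = 0 := by
    intro f hf
    have hsum : Summable (freqPairing F f) := by
      have := (integral_conj_SVrel_mul hF h2 h0 hf 1).1
      simp only [PNat.one_coe, one_dvd, if_true] at this
      exact (summable_mul_left_iff (by simp)).1 this
    refine eq_zero_of_sums_over_multiples hsum (fun M => ?_) d
    have h3 := (integral_conj_SVrel_mul hF h2 h0 hf M).2
    rw [hperp M f hf] at h3
    have h4 : ∀ d : ℕ+, (if (M : ℕ) ∣ d then (2 * (M : ℂ) ^ 2) * freqPairing F f d else 0) =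
        (2 * (M : ℂ) ^ 2) * (if (M : ℕ) ∣ d then freqPairing F f d else 0) := by
      intro d; split_ifs <;> simp
    simp only [h4] at h3
    rw [tsum_mul_left] at h3
    exact (mul_eq_zero.1 h3.symm).resolve_left (by simp)
  have hc2 := memLp_constTerm hF h2 h0 d
  have hqmp : Measure.QuasiMeasurePreserving (fun v : ℂ => (d : ℝ)⁻¹ • v) volume volume := by
    refine ⟨measurable_const_smul _, ?_⟩
    rw [Measure.map_addHaar_smul volume (inv_ne_zero hd)]
    exact Measure.smul_absolutelyContinuous
  have hqmp' : Measure.QuasiMeasurePreserving (fun v : ℂ => (d : ℝ) • v) volume volume := by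
    refine ⟨measurable_const_smul _, ?_⟩
    rw [Measure.map_addHaar_smul volume hd]
    exact Measure.smul_absolutelyContinuous
  -- The pairing involves f̂(dv); rescaling v by 1/d brings it to the form required by Plancherel.
  have hc3 : MemLp (fun v => constTerm F (freq d) ((d : ℝ)⁻¹ • v)) 2 volume := by
    refine MemLp.comp_of_map (g := constTerm F (freq d)) (f := fun v => (d : ℝ)⁻¹ • v) ?_
      (measurable_const_smul _).aemeasurable
    rw [Measure.map_addHaar_smul volume (inv_ne_zero hd)]
    exact hc2.smul_measure (by simp)
  have := ae_eq_zero_of_forall_fourier hc3 fun f hf => by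
    have h5 := Measure.integral_comp_smul (volume : Measure ℂ) (fun v =>
      conj (FourierTransform.fourier (toC f) ((d : ℝ) • v)) * constTerm F (freq d) v) ((d : ℝ)⁻¹)
    rw [← freqPairing, hpair f hf, smul_zero] at h5
    simpa only [smul_inv_smul₀ hd] using h5
  filter_upwards [hqmp'.ae this] with v hv
  rwa [inv_smul_smul₀ hd] at hv

theorem integral_conj_SVrel_mul_eq_zero {F : H00 → ℂ} (hF : Measurable F) (h2 : MemLp F 2 muMV)
    (h0 : ∀ᵐ h ∂muSL.restrict domSL, co F 0 h = 0)
    (hc : ∀ d : ℕ+, ∀ᵐ v, constTerm F (freq d) v = 0) {f : (Fin 2 → ℝ) → ℂ}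
    (hf : IsTestFunction f) (M : ℕ+) : ∫ x, conj (SVrel M f x) * F x ∂muMV = 0 := by
  have hp : ∀ d, freqPairing F f d = 0 := by
    intro d
    refine integral_eq_zero_of_ae ?_
    filter_upwards [hc d] with v hv
    simp [hv]
  rw [(integral_conj_SVrel_mul hF h2 h0 hf M).2]
  simp [hp]

/-! ### Integrability along horocycles -/

/-- The part of the strip at heights between `a` and `b`. -/
def stripBox (a b : ℝ) : Set SL(2, ℝ) := {h | (h • I).re ∈ Ico 0 1 ∧ (h • I).im ∈ Icc a b}

theorem measurableSet_stripBox (a b : ℝ) : MeasurableSet (stripBox a b) :=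
  ((UpperHalfPlane.continuous_re.measurable.comp measurable_smul_I) measurableSet_Ico).inter
    ((UpperHalfPlane.continuous_im.measurable.comp measurable_smul_I) measurableSet_Icc)

/-- With x and y confined to bounded intervals and y away from 0, Iwasawa coordinates bound the
matrix entries. This boundedness replaces a compactness argument. -/
theorem abs_entry_le_of_mem_stripBox {a b : ℝ} (ha : 0 < a) {h : SL(2, ℝ)} (hh : h ∈ stripBox a b)
    (i j : Fin 2) : |h i j| ≤ √b + 1 / √a := by
  obtain ⟨⟨hx0, hx1⟩, hy0, hy1⟩ := hh
  set τ := h • I with hτ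
  rw [eq_iwa h, ← hτ]
  set θ := Complex.arg (bot h)
  have hs : 0 < √a := Real.sqrt_pos.2 ha
  have hsy : √a ≤ √τ.im := Real.sqrt_le_sqrt hy0
  have hyb : √τ.im ≤ √b := Real.sqrt_le_sqrt hy1
  have h1 : 1 / √τ.im ≤ 1 / √a := one_div_le_one_div_of_le hs hsy
  have hp : 0 < √τ.im := hs.trans_le hsy
  have h2 : |τ.re / √τ.im| ≤ 1 / √a := by
    rw [abs_div, abs_of_nonneg hx0, abs_of_pos hp]
    exact (div_le_div_of_nonneg_right hx1.le hp.le).trans h1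
  have hc := Real.abs_cos_le_one θ
  have hsn := Real.abs_sin_le_one θ
  have key : ∀ u v : ℝ, |u| ≤ √b → |v| ≤ 1 / √a → ∀ s t : ℝ, |s| ≤ 1 → |t| ≤ 1 →
      |u * s + v * t| ≤ √b + 1 / √a := by
    intro u v hu hv s t hs ht
    refine (abs_add_le _ _).trans ?_
    rw [abs_mul, abs_mul]
    have := mul_le_mul hu hs (abs_nonneg _) (Real.sqrt_nonneg _)
    have := mul_le_mul hv ht (abs_nonneg _) (by positivity)
    linarith
  have hu : |√τ.im| ≤ √b := by rwa [abs_of_pos hp]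
  have hv : |1 / √τ.im| ≤ 1 / √a := by rwa [abs_of_pos (by positivity)]
  rw [iwa, Matrix.SpecialLinearGroup.coe_mul, Matrix.mul_apply, Fin.sum_univ_two, coe_toSL2R]
  have h0b : |(0 : ℝ)| ≤ √b := by simp
  fin_cases i <;> fin_cases j
  · exact key _ _ hu h2 _ _ hc (by simpa [rot] using hsn)
  · exact key _ _ hu h2 _ _ hsn hc
  · exact key _ _ h0b hv _ _ hc (by simpa [rot] using hsn)
  · exact key _ _ h0b hv _ _ hsn hc

theorem finite_setOf_abs_entry_le (R : ℝ) :
    {γ : SL(2, ℤ) | ∀ i j, |(castSL γ) i j| ≤ R}.Finite := by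
  obtain ⟨N, hN⟩ := exists_nat_ge R
  have hfin := Set.finite_Icc (α := Fin 2 → Fin 2 → ℤ) (fun _ _ => -N) (fun _ _ => N)
  refine Set.Finite.of_finite_image (f := fun γ : SL(2, ℤ) => fun i j => γ i j)
    (hfin.subset ?_) ?_
  · rintro _ ⟨γ, hγ, rfl⟩
    have : ∀ i j, |γ i j| ≤ (N : ℤ) := by
      intro i j
      have h1 : |((γ i j : ℤ) : ℝ)| ≤ R := hγ i j
      have h2 : ((|γ i j| : ℤ) : ℝ) ≤ ((N : ℤ) : ℝ) := by
        push_cast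
        exact h1.trans hN
      exact_mod_cast h2
    exact ⟨fun i j => (abs_le.1 (this i j)).1, fun i j => (abs_le.1 (this i j)).2⟩
  · intro γ _ γ' _ h
    ext i j
    exact congrFun (congrFun h i) j

theorem abs_entry_castSL_le {R : ℝ} {γ : SL(2, ℤ)} {h : SL(2, ℝ)} (h1 : ∀ i j, |h i j| ≤ R)
    (h2 : ∀ i j, |(γ • h) i j| ≤ R) (i j : Fin 2) : |(castSL γ) i j| ≤ 2 * (R * R) := by
  have hγ : castSL γ = (γ • h) * h⁻¹ := by rw [modular_smul_def, mul_inv_cancel_right]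
  have hinv : ∀ i j, |(h⁻¹ : SL(2, ℝ)) i j| ≤ R := by
    intro i j
    rw [Matrix.SpecialLinearGroup.SL2_inv_expl]
    fin_cases i <;> fin_cases j <;> simp <;> exact h1 _ _
  have hR : 0 ≤ R := (abs_nonneg _).trans (h1 0 0)
  rw [hγ, Matrix.SpecialLinearGroup.coe_mul, Matrix.mul_apply, Fin.sum_univ_two]
  refine (abs_add_le _ _).trans ?_
  rw [abs_mul, abs_mul]
  have := mul_le_mul (h2 i 0) (hinv 0 j) (abs_nonneg _) hR
  have := mul_le_mul (h2 i 1) (hinv 1 j) (abs_nonneg _) hR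
  linarith

/-- If h and γh both lie in the box, then γ = (γh)h⁻¹ has entries bounded in terms of a and b, which
leaves finitely many γ. So the box meets each orbit in a uniformly bounded number of points. -/
theorem exists_tsum_indicator_stripBox_le {a : ℝ} (ha : 0 < a) (b : ℝ) :
    ∃ N : ℕ, ∀ h : SL(2, ℝ),
      ∑' γ : SL(2, ℤ), (stripBox a b).indicator (fun _ => (1 : ℝ≥0∞)) (γ • h) ≤ N := by
  classical
  set R : ℝ := √b + 1 / √a
  set S := (finite_setOf_abs_entry_le (2 * (R * R))).toFinset
  refine ⟨S.card, fun h => ?_⟩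
  by_cases hex : ∃ γ₀ : SL(2, ℤ), γ₀ • h ∈ stripBox a b
  · obtain ⟨γ₀, hγ₀⟩ := hex
    -- Counting from a point of the orbit that is already in the box makes the bound independent of
    -- h.
    rw [← (Equiv.mulRight γ₀).tsum_eq]
    have hle : ∀ γ : SL(2, ℤ), (stripBox a b).indicator (fun _ => (1 : ℝ≥0∞))
        ((Equiv.mulRight γ₀ γ) • h) ≤ if γ ∈ S then 1 else 0 := by
      intro γ
      rw [Equiv.coe_mulRight, mul_smul]
      by_cases hm : γ • γ₀ • h ∈ stripBox a b
      · rw [indicator_of_mem hm, if_pos]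
        rw [Set.Finite.mem_toFinset]
        exact fun i j => abs_entry_castSL_le (abs_entry_le_of_mem_stripBox ha hγ₀)
          (abs_entry_le_of_mem_stripBox ha hm) i j
      · rw [indicator_of_notMem hm]
        exact zero_le
    refine (ENNReal.tsum_le_tsum hle).trans (le_of_eq ?_)
    rw [tsum_eq_sum (s := S) fun γ hγ => if_neg hγ, Finset.sum_congr rfl fun γ hγ => if_pos hγ]
    simp
  · push Not at hex
    simp [indicator_of_notMem (hex _)]

/-- The integral of a function on `H(0,0)` over a torus fibre. -/
def fibInt (G : H00 → ℝ≥0∞) (h : SL(2, ℝ)) : ℝ≥0∞ := ∫⁻ w, fib G h w ∂volBox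

theorem measurable_fibInt {G : H00 → ℝ≥0∞} (hG : Measurable G) : Measurable (fibInt G) :=
  (measurable_fib hG).lintegral_prod_right'

theorem fibInt_smul {G : H00 → ℝ≥0∞} (hG : Measurable G) (γ : SL(2, ℤ)) (h : SL(2, ℝ)) :
    fibInt G (γ • h) = fibInt G h := by
  simp only [fibInt, fib_smul]
  exact lintegral_box_vecMul (A := (γ : Matrix (Fin 2) (Fin 2) ℤ)) (by rw [γ.2]; exact one_ne_zero)
    (isPer_fib G h) (measurable_fib_right hG h)

theorem fibInt_const_mul {G : H00 → ℝ≥0∞} (hG : Measurable G) (c : ℝ≥0∞) (h : SL(2, ℝ)) :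
    fibInt (fun x => c * G x) h = c * fibInt G h :=
  lintegral_const_mul _ (measurable_fib_right hG h)

/-- The box covers the quotient with multiplicity at most N, so integrability on H(0,0) passes to
parts of the strip of bounded height. -/
theorem exists_setLIntegral_stripBox_le {a : ℝ} (ha : 0 < a) (b : ℝ) :
    ∃ N : ℕ, ∀ G : H00 → ℝ≥0∞, Measurable G →
      ∫⁻ h in stripBox a b, fibInt G h ∂muSL ≤ N * ∫⁻ x, G x ∂muMV := by
  obtain ⟨N, hN⟩ := exists_tsum_indicator_stripBox_le ha b
  refine ⟨N, fun G hG => ?_⟩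
  have hPm := measurable_fibInt hG
  have hPinv := fibInt_smul hG
  have hμ : ∫⁻ x, G x ∂muMV = ∫⁻ h in domSL, fibInt G h ∂muSL := lintegral_muMV hG
  generalize fibInt G = P at *
  rw [hμ, ← lintegral_indicator (measurableSet_stripBox a b),
    isFundamentalDomain_domSL.lintegral_eq_tsum'', ← lintegral_tsum, ← lintegral_const_mul _ hPm]
  · refine lintegral_mono fun h => ?_
    have : ∀ γ : SL(2, ℤ), (stripBox a b).indicator P (γ • h) =
        (stripBox a b).indicator (fun _ => (1 : ℝ≥0∞)) (γ • h) * P h := by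
      intro γ
      by_cases hm : γ • h ∈ stripBox a b
      · rw [indicator_of_mem hm, indicator_of_mem hm, hPinv, one_mul]
      · rw [indicator_of_notMem hm, indicator_of_notMem hm, zero_mul]
    simp only [this]
    rw [ENNReal.tsum_mul_right]
    gcongr
    exact hN h
  · intro γ
    exact ((hPm.indicator (measurableSet_stripBox a b)).comp
      (measurable_const_smul γ)).aemeasurable

theorem iwa_mem_stripBox_iff {a b x y θ : ℝ} (hy : 0 < y) :
    iwa (uhp x y) θ ∈ stripBox a b ↔ x ∈ Ico (0 : ℝ) 1 ∧ y ∈ Icc a b := by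
  simp only [stripBox, mem_ofPred_eq, iwa_smul_I, uhp_re x hy, uhp_im x hy]

theorem setLIntegral_stripBox {a : ℝ} (ha : 0 < a) (b : ℝ) {P : SL(2, ℝ) → ℝ≥0∞}
    (hP : Measurable P) : ∫⁻ h in stripBox a b, P h ∂muSL =
      ∫⁻ x in Ico (0 : ℝ) 1, ∫⁻ y in Icc a b, ENNReal.ofReal ((y ^ 2)⁻¹) *
        ∫⁻ θ in Ioc (-Real.pi) Real.pi, P (iwa (uhp x y) θ) := by
  have hS := measurableSet_stripBox a b
  have hm : Measurable fun p : ℍ × ℝ => (stripBox a b).indicator P (iwa p.1 p.2) :=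
    (hP.indicator hS).comp measurable_iwa
  have hm' : Measurable fun τ => ∫⁻ θ in Ioc (-Real.pi) Real.pi,
      (stripBox a b).indicator P (iwa τ θ) := hm.lintegral_prod_right'
  rw [← lintegral_indicator hS, lintegral_muSL (hP.indicator hS), lintegral_upperHalfPlane hm',
    ← lintegral_indicator measurableSet_Ico]
  refine lintegral_congr fun x => ?_
  have hsub : Icc a b ⊆ Ioi 0 := fun y hy => ha.trans_le hy.1
  by_cases hx : x ∈ Ico (0 : ℝ) 1
  · rw [indicator_of_mem hx, ← lintegral_indicator measurableSet_Ioi,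
      ← lintegral_indicator measurableSet_Icc]
    refine lintegral_congr fun y => ?_
    by_cases hy0 : y ∈ Ioi (0 : ℝ)
    · rw [indicator_of_mem hy0]
      by_cases hy : y ∈ Icc a b
      · rw [indicator_of_mem hy]
        congr 1
        refine lintegral_congr fun θ => ?_
        rw [indicator_of_mem ((iwa_mem_stripBox_iff hy0).2 ⟨hx, hy⟩)]
      · rw [indicator_of_notMem hy]
        have : ∀ θ, (stripBox a b).indicator P (iwa (uhp x y) θ) = 0 := fun θ =>
          indicator_of_notMem (fun h => hy ((iwa_mem_stripBox_iff hy0).1 h).2) _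
        simp [this]
    · rw [indicator_of_notMem hy0, indicator_of_notMem fun h => hy0 (hsub h)]
  · rw [indicator_of_notMem hx]
    refine (setLIntegral_congr_fun measurableSet_Ioi fun y hy => ?_).trans lintegral_zero
    have : ∀ θ, (stripBox a b).indicator P (iwa (uhp x y) θ) = 0 := fun θ =>
      indicator_of_notMem (fun h => hx ((iwa_mem_stripBox_iff hy).1 h).1) _
    simp [this]

/-- The integral of a function on `H(0,0)` over the closed horocycle at height `y` with angle `θ`
and over the torus fibres above it. -/
def horoInt (G : H00 → ℝ≥0∞) (y θ : ℝ) : ℝ≥0∞ :=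
  ∫⁻ x in Ico (0 : ℝ) 1, fibInt G (iwa (uhp x y) θ)

theorem measurable_iwa_uhp :
    Measurable fun q : ℝ × ℝ × ℝ => iwa (uhp q.1 q.2.1) q.2.2 := by
  have h1 : Measurable fun q : ℝ × ℝ × ℝ => uhp q.1 q.2.1 :=
    measurable_uhp.comp (measurable_fst.prodMk (measurable_fst.comp measurable_snd))
  have h2 : Measurable fun q : ℝ × ℝ × ℝ => (uhp q.1 q.2.1, q.2.2) :=
    h1.prodMk (measurable_snd.comp measurable_snd)
  have := measurable_iwa.comp h2
  exact this

theorem measurable_comp_iwa_uhp {P : SL(2, ℝ) → ℝ≥0∞} (hP : Measurable P) {α : Type*}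
    [MeasurableSpace α] {x y θ : α → ℝ} (hx : Measurable x) (hy : Measurable y)
    (hθ : Measurable θ) : Measurable fun q => P (iwa (uhp (x q) (y q)) (θ q)) := by
  have := (hP.comp measurable_iwa_uhp).comp (hx.prodMk (hy.prodMk hθ))
  exact this

theorem measurable_horoInt {G : H00 → ℝ≥0∞} (hG : Measurable G) :
    Measurable fun p : ℝ × ℝ => horoInt G p.1 p.2 :=
  Measurable.lintegral_prod_right' (f := fun q : (ℝ × ℝ) × ℝ => fibInt G (iwa (uhp q.2 q.1.1) q.1.2))
    (measurable_comp_iwa_uhp (measurable_fibInt hG) (by fun_prop) (by fun_prop) (by fun_prop))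

theorem setLIntegral_stripBox_symm {a : ℝ} (ha : 0 < a) (b : ℝ) {P : SL(2, ℝ) → ℝ≥0∞}
    (hP : Measurable P) : ∫⁻ h in stripBox a b, P h ∂muSL =
      ∫⁻ y in Icc a b, ENNReal.ofReal ((y ^ 2)⁻¹) *
        ∫⁻ θ in Ioc (-Real.pi) Real.pi, ∫⁻ x in Ico (0 : ℝ) 1, P (iwa (uhp x y) θ) := by
  rw [setLIntegral_stripBox ha b hP]
  have hJ : Measurable fun q : ℝ × ℝ =>
      ∫⁻ θ in Ioc (-Real.pi) Real.pi, P (iwa (uhp q.1 q.2) θ) :=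
    Measurable.lintegral_prod_right' (f := fun q : (ℝ × ℝ) × ℝ => P (iwa (uhp q.1.1 q.1.2) q.2))
      (measurable_comp_iwa_uhp hP (by fun_prop) (by fun_prop) (by fun_prop))
  have hw : Measurable fun q : ℝ × ℝ => ENNReal.ofReal ((q.2 ^ 2)⁻¹) := by fun_prop
  rw [lintegral_lintegral_swap (hw.mul hJ).aemeasurable]
  refine lintegral_congr fun y => ?_
  have hJ' : Measurable fun x : ℝ => ∫⁻ θ in Ioc (-Real.pi) Real.pi, P (iwa (uhp x y) θ) := by
    have := hJ.comp (measurable_id.prodMk (measurable_const (a := y)))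
    exact this
  rw [lintegral_const_mul _ hJ']
  congr 1
  have hm : Measurable fun q : ℝ × ℝ => P (iwa (uhp q.1 y) q.2) :=
    measurable_comp_iwa_uhp hP (by fun_prop) (by fun_prop) (by fun_prop)
  exact lintegral_lintegral_swap (f := fun x θ => P (iwa (uhp x y) θ)) hm.aemeasurable

theorem setLIntegral_horoInt_lt_top {G : H00 → ℝ≥0∞} (hG : Measurable G)
    (hfin : ∫⁻ x, G x ∂muMV < ⊤) {a b : ℝ} (ha : 0 < a) :
    ∫⁻ y in Icc a b, ENNReal.ofReal ((y ^ 2)⁻¹) *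
      ∫⁻ θ in Ioc (-Real.pi) Real.pi, horoInt G y θ < ⊤ := by
  obtain ⟨N, hN⟩ := exists_setLIntegral_stripBox_le ha b
  refine lt_of_le_of_lt (le_of_eq ?_)
    ((hN G hG).trans_lt (ENNReal.mul_lt_top (ENNReal.natCast_lt_top N) hfin))
  rw [setLIntegral_stripBox_symm ha b (measurable_fibInt hG)]
  rfl

theorem ae_horoInt_lt_top {G : H00 → ℝ≥0∞} (hG : Measurable G)
    (hfin : ∫⁻ x, G x ∂muMV < ⊤) :
    ∀ᵐ y ∂(volume.restrict (Ioi (0 : ℝ))), ∀ᵐ θ ∂(volume.restrict (Ioc (-Real.pi) Real.pi)),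
      horoInt G y θ < ⊤ := by
  have hU : Ioi (0 : ℝ) ⊆ ⋃ n : ℕ, Icc (1 / ((n : ℝ) + 1)) (n + 1) := by
    intro y hy
    obtain ⟨n, hn⟩ := exists_nat_ge (max y y⁻¹)
    have h1 := (le_max_left _ _).trans hn
    have h2 := (le_max_right _ _).trans hn
    have hy : (0 : ℝ) < y := hy
    refine mem_iUnion.2 ⟨n, ?_, by linarith⟩
    rw [one_div]
    exact inv_le_of_inv_le₀ hy (by linarith)
  have hm := measurable_horoInt hG
  have hm1 : Measurable fun y => ∫⁻ θ in Ioc (-Real.pi) Real.pi, horoInt G y θ :=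
    hm.lintegral_prod_right'
  have hw : Measurable fun y : ℝ => ENNReal.ofReal ((y ^ 2)⁻¹) := by fun_prop
  refine ae_mono (Measure.restrict_mono hU le_rfl) ((ae_restrict_iUnion_iff _ _).2 fun n => ?_)
  have hpos : 0 < 1 / ((n : ℝ) + 1) := by positivity
  have h1 := setLIntegral_horoInt_lt_top hG hfin hpos (b := n + 1)
  have h2 := ae_lt_top (hw.mul hm1) h1.ne
  filter_upwards [h2, ae_restrict_mem measurableSet_Icc] with y hy hmem
  have hy0 : 0 < y := hpos.trans_le hmem.1
  have h3 : ∫⁻ θ in Ioc (-Real.pi) Real.pi, horoInt G y θ < ⊤ := by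
    refine lt_top_iff_ne_top.2 fun htop => ?_
    simp only [Pi.mul_apply, htop] at hy
    rw [ENNReal.mul_top] at hy
    · exact lt_irrefl _ hy
    · simpa using hy0.ne'
  have hm2 : Measurable fun θ => horoInt G y θ := by
    have := hm.comp ((measurable_const (a := y)).prodMk measurable_id)
    exact this
  exact ae_lt_top hm2 h3.ne

theorem horoInt_const_mul {G : H00 → ℝ≥0∞} (hG : Measurable G) (c : ℝ≥0∞) (y θ : ℝ) :
    horoInt (fun x => c * G x) y θ = c * horoInt G y θ := by
  have hm : Measurable fun x => fibInt G (iwa (uhp x y) θ) :=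
    measurable_comp_iwa_uhp (measurable_fibInt hG) (by fun_prop) (by fun_prop) (by fun_prop)
  rw [horoInt, horoInt, ← lintegral_const_mul _ hm]
  exact lintegral_congr fun x => fibInt_const_mul hG c _

/-- The finiteness statement is applied to ∞·G, which still has integral 0: if ∞ times the horocycle
integral is finite, that integral is zero. Thus null sets of H(0,0) are null on almost every
horocycle. -/
theorem ae_horoInt_eq_zero {G : H00 → ℝ≥0∞} (hG : Measurable G) (h0 : ∫⁻ x, G x ∂muMV = 0) :
    ∀ᵐ y ∂(volume.restrict (Ioi (0 : ℝ))), ∀ᵐ θ ∂(volume.restrict (Ioc (-Real.pi) Real.pi)),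
      horoInt G y θ = 0 := by
  have h1 : ∫⁻ x, ⊤ * G x ∂muMV < ⊤ := by
    rw [lintegral_const_mul _ hG, h0, mul_zero]
    exact ENNReal.zero_lt_top
  filter_upwards [ae_horoInt_lt_top (hG.const_mul ⊤) h1] with y hy
  filter_upwards [hy] with θ hθ
  by_contra hne
  have h2 := horoInt_const_mul hG ⊤ y θ
  rw [ENNReal.top_mul hne] at h2
  exact hθ.ne h2

/-! ### The coefficients `c^{H0}` as constant terms -/

/-- Lebesgue measure on the unit interval. -/
abbrev volI : Measure ℝ := volume.restrict (Ico 0 1)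

theorem lintegral_fract_sub (c : ℝ) {g : ℝ → ℝ≥0∞} :
    ∫⁻ u, g (Int.fract (u - c)) ∂volI = ∫⁻ u, g u ∂volI := by
  have h0 : ∫⁻ u, g u ∂volI = ∫⁻ u, g (Int.fract u) ∂volI :=
    setLIntegral_congr_fun measurableSet_Ico fun u hu => by
      simp only [Int.fract_eq_self.2 ⟨hu.1, hu.2⟩]
  rw [h0, volI, Measure.restrict_congr_set Ico_ae_eq_Ioc]
  have h1 := (isAddFundamentalDomain_Ioc one_pos (-c)).setLIntegral_eq
    (isAddFundamentalDomain_Ioc one_pos 0) (fun u => g (Int.fract u)) (by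
      rintro ⟨_, n, rfl⟩ x
      simp [AddSubgroup.vadd_def])
  have h2 := (measurePreserving_add_right volume (-c)).setLIntegral_comp_emb
    (measurableEmbedding_addRight (-c)) (fun u => g (Int.fract u)) (Ioc 0 1)
  rw [image_add_const_Ioc, zero_add, add_comm 1] at h2
  rw [zero_add] at h1
  rw [← h1, ← h2]
  rfl

theorem lintegral_volBox {f : (Fin 2 → ℝ) → ℝ≥0∞} (hf : Measurable f) :
    ∫⁻ w, f w ∂volBox = ∫⁻ s, ∫⁻ t, f ![s, t] ∂volI ∂volI := by
  have h := (volume_preserving_finTwoArrow ℝ).symm.setLIntegral_comp_preimage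
    measurableSet_box hf
  have hpre : (MeasurableEquiv.finTwoArrow (α := ℝ)).symm ⁻¹' box = Ico 0 1 ×ˢ Ico 0 1 := by
    ext ⟨s, t⟩
    simp [box, MeasurableEquiv.finTwoArrow, Fin.forall_fin_two]
  rw [hpre, Measure.volume_eq_prod, ← Measure.prod_restrict] at h
  have hm : Measurable fun a : ℝ × ℝ => f ((MeasurableEquiv.finTwoArrow (α := ℝ)).symm a) :=
    hf.comp (MeasurableEquiv.measurable _)
  rw [lintegral_prod _ hm.aemeasurable] at h
  exact h.symm

/-- The change of variables between the coordinates `(s, u, x)` of the Jacobi half space at a fixed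
height and the coordinates of the torus bundle over a horocycle. -/
def shear (p : ℝ × ℝ × ℝ) : ℝ × (Fin 2 → ℝ) := (p.2.2, ![p.1, Int.fract (p.2.1 - p.1 * p.2.2)])

theorem measurable_shear : Measurable shear := by
  refine measurable_snd.snd.prodMk (measurable_pi_lambda _ fun i => ?_)
  fin_cases i
  · exact measurable_fst
  · exact measurable_fract.comp (by fun_prop)

/-- For fixed s and x the map is a translation by -sx on the circle. It arises from z = u + isy = sτ
+ (u - sx), which gives the fibre coordinates (s, u - sx). -/
theorem measurePreserving_shear :
    MeasurePreserving shear (volI.prod (volI.prod volI)) (volI.prod volBox) := by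
  refine ⟨measurable_shear, Measure.ext_of_lintegral _ fun f hf => ?_⟩
  have hfs : Measurable fun p => f (shear p) := hf.comp measurable_shear
  rw [lintegral_map hf measurable_shear, lintegral_prod _ hfs.aemeasurable,
    lintegral_prod _ hf.aemeasurable]
  have h1 : ∀ s : ℝ, ∫⁻ q, f (shear (s, q)) ∂(volI.prod volI) =
      ∫⁻ x, ∫⁻ u, f (x, ![s, u]) ∂volI ∂volI := by
    intro s
    have hm : Measurable fun q : ℝ × ℝ => f (shear (s, q)) :=
      hfs.comp (measurable_const.prodMk measurable_id)
    rw [lintegral_prod_symm _ hm.aemeasurable]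
    refine lintegral_congr fun x => ?_
    exact lintegral_fract_sub (s * x) (g := fun u => f (x, ![s, u]))
  have h2 : ∀ x : ℝ, ∫⁻ w, f (x, w) ∂volBox = ∫⁻ s, ∫⁻ u, f (x, ![s, u]) ∂volI ∂volI :=
    fun x => lintegral_volBox (f := fun w => f (x, w)) (hf.comp (measurable_const.prodMk measurable_id))
  simp only [h1, h2]
  have hm2 : Measurable fun q : (ℝ × ℝ) × ℝ => f (q.1.2, ![q.1.1, q.2]) := by
    refine hf.comp (measurable_fst.snd.prodMk (measurable_pi_lambda _ fun i => ?_))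
    fin_cases i
    · exact measurable_fst.fst
    · exact measurable_snd
  exact lintegral_lintegral_swap (f := fun s x => ∫⁻ u, f (x, ![s, u]) ∂volI)
    (Measurable.lintegral_prod_right' (f := fun q : (ℝ × ℝ) × ℝ => f (q.1.2, ![q.1.1, q.2]))
      hm2).aemeasurable

theorem slash_pt (k : ℤ) (φ : ℍ → ℂ → ℂ) (h : SL(2, ℝ)) (w : Fin 2 → ℝ) :
    slash k φ (pt h w) I 0 =
      conj (bot h) ^ (-k) * φ (h • I) (w 0 * ↑(h • I) + w 1) := by
  have h0 := denom_ne_zero (h : GL (Fin 2) ℝ) I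
  rw [← denom_I, slash]
  have hlin : (pt h w).lin = h := by simp [pt, SAff.ofVec, SAff.ofSL]
  have htr : (pt h w).trans = Matrix.vecMul w (h : Matrix (Fin 2) (Fin 2) ℝ) := by
    simp [pt, SAff.ofVec, SAff.ofSL]
  rw [hlin, htr]
  congr 2
  have hcoe : ((h • I : ℍ) : ℂ) * denom h I = h 0 0 * I + h 0 1 := by
    rw [coe_specialLinearGroup_apply]
    simp only [denom] at h0 ⊢
    exact div_mul_cancel₀ _ h0
  rw [div_eq_iff h0, add_mul, mul_assoc, hcoe]
  simp [Matrix.vecMul, dotProduct, Fin.sum_univ_two, denom]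
  ring

theorem fib_lift {k : ℤ} {φ : ℍ → ℂ → ℂ} (hφ : IsAffineModular k φ) (h : SL(2, ℝ))
    (w : Fin 2 → ℝ) : fib (lift k φ hφ) h w =
      conj (bot h) ^ (-k) * φ (h • I) (w 0 * ↑(h • I) + w 1) :=
  slash_pt k φ h w

/-- The automorphy factor in Iwasawa coordinates. -/
def autFactor (k : ℤ) (y θ : ℝ) : ℂ :=
  conj (((√y)⁻¹ : ℝ) * Complex.exp (θ * Complex.I)) ^ (-k)

theorem autFactor_ne_zero (k : ℤ) {y : ℝ} (hy : 0 < y) (θ : ℝ) : autFactor k y θ ≠ 0 := by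
  refine zpow_ne_zero _ ((map_ne_zero _).2 (mul_ne_zero ?_ (Complex.exp_ne_zero _)))
  exact_mod_cast (inv_pos.2 (Real.sqrt_pos.2 hy)).ne'

/-- The fractional part is harmless by periodicity of the fibre. The rotation angle enters only
through the automorphy factor. -/
theorem fib_lift_shear {k : ℤ} {φ : ℍ → ℂ → ℂ} (hφ : IsAffineModular k φ) {y : ℝ} (hy : 0 < y)
    (θ : ℝ) (p : ℝ × ℝ × ℝ) :
    fib (lift k φ hφ) (iwa (uhp (shear p).1 y) θ) (shear p).2 =
      autFactor k y θ * φ (uhp p.2.2 y) (p.2.1 + (p.1 * y : ℝ) * Complex.I) := by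
  obtain ⟨s, u, x⟩ := p
  have hper := isPer_fib (lift k φ hφ) (iwa (uhp x y) θ) ![0, ⌊u - s * x⌋]
    ![s, Int.fract (u - s * x)]
  have hw : (![s, Int.fract (u - s * x)] + fun i => ((![0, ⌊u - s * x⌋] : Fin 2 → ℤ) i : ℝ)) =
      ![s, u - s * x] := by
    ext i
    fin_cases i <;> simp
  rw [hw] at hper
  simp only [shear]
  rw [← hper, fib_lift, bot_iwa, iwa_smul_I, uhp_im x hy, autFactor]
  congr 2
  rw [coe_uhp x hy]
  simp
  ring

theorem cH0_eq (φ : ℍ → ℂ → ℂ) (m : ℤ) {y : ℝ} (hy : 0 < y) :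
    cH0 φ 0 m y = ∫ s, ∫ u, ∫ x, φ (uhp x y) (u + (s * y : ℝ) * Complex.I) * e (-(m * s))
      ∂volI ∂volI ∂volI := by
  have hI : ∀ g : ℝ → ℂ, ∫ x in (0 : ℝ)..1, g x = ∫ x, g x ∂volI := fun g => by
    rw [intervalIntegral.integral_of_le zero_le_one, volI,
      Measure.restrict_congr_set Ico_ae_eq_Ioc]
  rw [cH0, intervalIntegral.integral_comp_div (fun s => cH φ 0 0 y s * e (-(m * s))) hy.ne',
    zero_div, div_self hy.ne', hI, Complex.real_smul, ← mul_assoc, one_div,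
    inv_mul_cancel₀ (by exact_mod_cast hy.ne'), one_mul]
  refine integral_congr_ae (ae_of_all _ fun s => ?_)
  simp only [cH, hI]
  rw [← integral_mul_const]
  refine integral_congr_ae (ae_of_all _ fun u => ?_)
  simp only
  rw [← integral_mul_const]
  refine integral_congr_ae (ae_of_all _ fun x => ?_)
  simp [e, uhp]

theorem measurable_fib_iwa {α : Type} [MeasurableSpace α] {F : H00 → α} (hF : Measurable F) (y θ : ℝ) :
    Measurable fun q : ℝ × (Fin 2 → ℝ) => fib F (iwa (uhp q.1 y) θ) q.2 := by
  have h1 : Measurable fun q : ℝ × (Fin 2 → ℝ) => ((q.1, y, θ) : ℝ × ℝ × ℝ) := by fun_prop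
  have h2 := (measurable_iwa_uhp.comp h1).prodMk measurable_snd
  have := (measurable_fib hF).comp h2
  exact this

theorem horoInt_eq {G : H00 → ℝ≥0∞} (hG : Measurable G) (y θ : ℝ) :
    horoInt G y θ = ∫⁻ q, fib G (iwa (uhp q.1 y) θ) q.2 ∂(volI.prod volBox) := by
  have h3 : Measurable fun q : ℝ × (Fin 2 → ℝ) => fib G (iwa (uhp q.1 y) θ) q.2 :=
    measurable_fib_iwa hG y θ
  rw [lintegral_prod _ h3.aemeasurable]
  rfl

/-- The bridge between the two notions of constant term: after the shear, both are integrals of φ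
against e(-ms) over the same torus bundle on a closed horocycle. All integrability comes from F, on
almost every horocycle. -/
theorem ae_constTerm_eq_cH0 {F : H00 → ℂ} (hF : Measurable F) (h2 : MemLp F 2 muMV) {k : ℤ}
    {φ : ℍ → ℂ → ℂ} (hφ : IsAffineModular k φ) (hFφ : F =ᵐ[muMV] lift k φ hφ) (m : ℤ) :
    ∀ᵐ y ∂(volume.restrict (Ioi (0 : ℝ))), ∀ᵐ θ : ℝ ∂(volume.restrict (Ioc (-Real.pi) Real.pi)),
      constTerm F ![m, 0] (((√y)⁻¹ : ℝ) * Complex.exp (θ * Complex.I)) =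
        autFactor k y θ * cH0 φ 0 m y := by
  -- No measurability of φ is available, so the set where F differs from the lift is enlarged to a
  -- measurable null set.
  set N := toMeasurable muMV {x | ¬ F x = lift k φ hφ x} with hN
  have hNm : MeasurableSet N := measurableSet_toMeasurable _ _
  have hN0 : muMV N = 0 := by rw [hN, measure_toMeasurable]; exact hFφ
  have hGm : Measurable (N.indicator fun _ => (1 : ℝ≥0∞)) := measurable_const.indicator hNm
  have hG0 : ∫⁻ x, N.indicator (fun _ => (1 : ℝ≥0∞)) x ∂muMV = 0 := by
    rw [lintegral_indicator hNm, setLIntegral_const, hN0, mul_zero]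
  have hS : Measurable fun x => ‖F x‖ₑ ^ 2 := hF.enorm.pow_const 2
  filter_upwards [ae_horoInt_eq_zero hGm hG0,
    ae_horoInt_lt_top hS ((memLp_two_iff hF.aestronglyMeasurable).1 h2),
    ae_restrict_mem measurableSet_Ioi] with y hy1 hy2 hy
  have hy : 0 < y := hy
  filter_upwards [hy1, hy2, ae_restrict_mem measurableSet_Ioc] with θ hθ1 hθ2 hθ
  have hQm := measurable_fib_iwa hF y θ
  have hQ2 : MemLp (fun q : ℝ × (Fin 2 → ℝ) => fib F (iwa (uhp q.1 y) θ) q.2) 2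
      (volI.prod volBox) := by
    rw [memLp_two_iff hQm.aestronglyMeasurable]
    rw [horoInt_eq hS] at hθ2
    exact hθ2
  -- The slices have finite measure, so square integrability gives the integrability needed for
  -- Fubini.
  have : IsFiniteMeasure volI := ⟨by simp⟩
  have hQi := hQ2.integrable one_le_two
  have hae : ∀ᵐ q ∂(volI.prod volBox), fib F (iwa (uhp q.1 y) θ) q.2 =
      fib (lift k φ hφ) (iwa (uhp q.1 y) θ) q.2 := by
    rw [horoInt_eq hGm, lintegral_eq_zero_iff (measurable_fib_iwa hGm y θ)] at hθ1
    filter_upwards [hθ1] with q hq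
    by_contra hne
    have : H00.mk (pt (iwa (uhp q.1 y) θ) q.2) ∈ N := subset_toMeasurable _ _ hne
    simp [fib, this] at hq
  have haf := autFactor_ne_zero k hy θ
  have hRi : Integrable (fun q : ℝ × (Fin 2 → ℝ) =>
      fib F (iwa (uhp q.1 y) θ) q.2 * e (-(m * q.2 0))) (volI.prod volBox) := by
    refine hQi.mul_bdd (c := 1) ?_ (ae_of_all _ fun q => (norm_e _).le)
    refine (continuous_e.comp ?_).aestronglyMeasurable
    fun_prop
  have hψ : (fun p : ℝ × ℝ × ℝ => (fun q : ℝ × (Fin 2 → ℝ) =>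
        fib F (iwa (uhp q.1 y) θ) q.2 * e (-(m * q.2 0))) (shear p)) =ᵐ[volI.prod (volI.prod volI)]
      fun p => autFactor k y θ *
        (φ (uhp p.2.2 y) (p.2.1 + (p.1 * y : ℝ) * Complex.I) * e (-(m * p.1))) := by
    filter_upwards [measurePreserving_shear.quasiMeasurePreserving.ae hae] with p hp
    rw [hp, fib_lift_shear hφ hy, mul_assoc]
    rfl
  have hψi := (measurePreserving_shear.integrable_comp_of_integrable hRi).congr hψ
  have hψi' : Integrable (fun p : ℝ × ℝ × ℝ =>
      φ (uhp p.2.2 y) (p.2.1 + (p.1 * y : ℝ) * Complex.I) * e (-(m * p.1)))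
      (volI.prod (volI.prod volI)) := by
    have := hψi.const_mul (autFactor k y θ)⁻¹
    simpa only [inv_mul_cancel_left₀ haf] using this
  have e1 : cH0 φ 0 m y = ∫ p : ℝ × ℝ × ℝ,
      φ (uhp p.2.2 y) (p.2.1 + (p.1 * y : ℝ) * Complex.I) * e (-(m * p.1))
      ∂(volI.prod (volI.prod volI)) := by
    rw [cH0_eq φ m hy, integral_prod _ hψi']
    refine integral_congr_ae ?_
    filter_upwards [hψi'.prod_right_ae] with s hs
    exact (integral_prod _ hs).symm
  rw [e1, ← integral_const_mul, ← integral_congr_ae hψ]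
  have e2 := integral_map (μ := volI.prod (volI.prod volI)) measurable_shear.aemeasurable
    (f := fun q : ℝ × (Fin 2 → ℝ) => fib F (iwa (uhp q.1 y) θ) q.2 * e (-(m * q.2 0)))
    (by rw [measurePreserving_shear.map_eq]; exact hRi.aestronglyMeasurable)
  rw [measurePreserving_shear.map_eq] at e2
  rw [← e2, integral_prod _ hRi, constTerm]
  refine integral_congr_ae (ae_of_all _ fun x => ?_)
  simp only [horo_polar x hy hθ, co, fc, chr]
  simp

theorem ae_iff_polar {Z : Set ℂ} (hZ : MeasurableSet Z) :
    (∀ᵐ v, v ∉ Z) ↔ ∀ᵐ y ∂(volume.restrict (Ioi (0 : ℝ))),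
      ∀ᵐ θ : ℝ ∂(volume.restrict (Ioc (-Real.pi) Real.pi)),
        ((√y)⁻¹ : ℝ) * Complex.exp (θ * Complex.I) ∉ Z := by
  set u : ℂ → ℝ≥0∞ := Z.indicator fun _ => 1
  have hu : Measurable u := measurable_const.indicator hZ
  have hu0 : ∀ v, u v = 0 ↔ v ∉ Z := fun v => by simp [u]
  have hc : Measurable fun p : ℝ × ℝ => ((√p.1)⁻¹ : ℝ) * Complex.exp (p.2 * Complex.I) := by
    fun_prop
  have hm : Measurable fun p : ℝ × ℝ => u (((√p.1)⁻¹ : ℝ) * Complex.exp (p.2 * Complex.I)) :=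
    hu.comp hc
  have hm1 : Measurable fun y : ℝ => ∫⁻ θ in Ioc (-Real.pi) Real.pi,
      u (((√y)⁻¹ : ℝ) * Complex.exp (θ * Complex.I)) := hm.lintegral_prod_right'
  have hw : Measurable fun y : ℝ => ENNReal.ofReal ((y ^ 2)⁻¹) := by fun_prop
  have h1 : (∀ᵐ v, v ∉ Z) ↔ ∫⁻ v, u v = 0 := by
    rw [lintegral_eq_zero_iff hu]
    exact Filter.eventually_congr (ae_of_all _ fun v => (hu0 v).symm)
  have h2 : ∫⁻ v, u v = 0 ↔ 2 * ∫⁻ v, u v = 0 := by simp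
  rw [h1, h2, ← lintegral_polar hu, lintegral_eq_zero_iff (f := fun y : ℝ => ENNReal.ofReal ((y ^ 2)⁻¹) *
    ∫⁻ θ in Ioc (-Real.pi) Real.pi, u (((√y)⁻¹ : ℝ) * Complex.exp (θ * Complex.I))) (hw.mul hm1)]
  refine Filter.eventually_congr ?_
  filter_upwards [ae_restrict_mem measurableSet_Ioi] with y hy
  have hy : 0 < y := hy
  have h3 : ENNReal.ofReal ((y ^ 2)⁻¹) ≠ 0 := by simpa using hy.ne'
  have hm2 : Measurable fun θ : ℝ => u (((√y)⁻¹ : ℝ) * Complex.exp (θ * Complex.I)) := by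
    have := hm.comp ((measurable_const (a := y)).prodMk measurable_id)
    exact this
  simp only [Pi.zero_apply, mul_eq_zero, h3, false_or]
  rw [lintegral_eq_zero_iff hm2]
  exact Filter.eventually_congr (ae_of_all _ fun θ => hu0 _)

/-- The automorphy factor never vanishes and the coefficient does not depend on the angle, so
vanishing for almost all v amounts to vanishing for almost all heights. -/
theorem ae_constTerm_iff {F : H00 → ℂ} (hF : Measurable F) (h2 : MemLp F 2 muMV) {k : ℤ}
    {φ : ℍ → ℂ → ℂ} (hφ : IsAffineModular k φ) (hFφ : F =ᵐ[muMV] lift k φ hφ) (m : ℤ) :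
    (∀ᵐ v, constTerm F ![m, 0] v = 0) ↔
      ∀ᵐ y ∂(volume.restrict (Ioi (0 : ℝ))), cH0 φ 0 m y = 0 := by
  have hZ : MeasurableSet {v | ¬ constTerm F ![m, 0] v = 0} :=
    (measurable_constTerm hF _ (measurableSet_singleton 0)).compl
  have h1 := ae_iff_polar hZ
  simp only [mem_ofPred_eq, not_not] at h1
  rw [h1]
  refine Filter.eventually_congr ?_
  filter_upwards [ae_constTerm_eq_cH0 hF h2 hφ hFφ m, ae_restrict_mem measurableSet_Ioi] with y hy hy0
  have hiff : ∀ᵐ θ : ℝ ∂(volume.restrict (Ioc (-Real.pi) Real.pi)),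
      (constTerm F ![m, 0] (((√y)⁻¹ : ℝ) * Complex.exp (θ * Complex.I)) = 0 ↔
        cH0 φ 0 m y = 0) := by
    filter_upwards [hy] with θ hθ
    rw [hθ, mul_eq_zero]
    simp [autFactor_ne_zero k hy0 θ]
  rw [Filter.eventually_congr hiff]
  have : (ae (volume.restrict (Ioc (-Real.pi) Real.pi))).NeBot := by
    rw [ae_neBot, Ne, Measure.restrict_eq_zero, Real.volume_Ioc]
    simp [Real.pi_pos]
  exact Filter.eventually_const

/-! ### Constant terms at the other frequencies -/

/-- The zero frequency is fixed by the lattice, so its coefficient is an invariant function of h and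
vanishing spreads from one fundamental domain to the whole group. -/
theorem ae_co_zero {F : H00 → ℂ} (hF : Measurable F)
    (h0 : ∀ᵐ h ∂muSL.restrict domSL, co F 0 h = 0) : ∀ᵐ h ∂muSL, co F 0 h = 0 := by
  refine isFundamentalDomain_domSL.measure_zero_of_invariant _ (fun γ => ?_) ?_
  · ext h
    rw [mem_smul_set_iff_inv_smul_mem]
    have := co_smul_smul hF γ⁻¹ 0 h
    rw [smul_zero] at this
    change ¬ co F 0 (γ⁻¹ • h) = 0 ↔ ¬ co F 0 h = 0
    rw [this]
  · rw [← Measure.restrict_apply]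
    · exact h0
    · exact (measurable_co hF 0 (measurableSet_singleton 0)).compl

theorem ae_constTerm_zero {F : H00 → ℂ} (hF : Measurable F)
    (h0 : ∀ᵐ h ∂muSL.restrict domSL, co F 0 h = 0) : ∀ᵐ v, constTerm F ![(0 : ℤ), 0] v = 0 := by
  have h1 := ae_co_zero hF h0
  have hz : ![(0 : ℤ), 0] = 0 := by ext i; fin_cases i <;> rfl
  rw [muSL_eq_map_horo] at h1
  have h2 := ae_of_ae_map measurable_horo.aemeasurable
    ((Measure.absolutelyContinuous_smul (two_ne_zero' ℝ≥0∞)).ae_le h1)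
  have h3 := Measure.ae_ae_of_ae_prod (Measure.measurePreserving_swap.quasiMeasurePreserving.ae h2)
  filter_upwards [h3] with v hv
  rw [constTerm, hz]
  exact integral_eq_zero_of_ae (ae_restrict_of_ae hv)

theorem horo_neg (x : ℝ) {v : ℂ} (hv : v ≠ 0) : horo (x, -v) = (-1 : SL(2, ℤ)) • horo (x, v) := by
  refine SL_ext_of_smul_I_of_bot ?_ ?_
  · rw [modular_smul_smul_I, ModularGroup.SL_neg_smul, one_smul, horo_smul_I, horo_smul_I]
    simp
  · have h1 : ∀ g : SL(2, ℝ), bot ((-1 : SL(2, ℤ)) • g) = -bot g := fun g => by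
      rw [modular_smul_def]
      apply Complex.ext <;> simp [bot]
    rw [bot_horo x (neg_ne_zero.2 hv), h1, bot_horo x hv]

theorem constTerm_neg {F : H00 → ℂ} (hF : Measurable F) (m : ℤ) {v : ℂ} (hv : v ≠ 0) :
    constTerm F ![-m, 0] v = constTerm F ![m, 0] (-v) := by
  refine integral_congr_ae (ae_of_all _ fun x => ?_)
  simp only
  rw [horo_neg x hv]
  have hξ : ![m, 0] = (-1 : SL(2, ℤ)) • ![-m, 0] := by
    ext i
    fin_cases i <;> simp [Matrix.SpecialLinearGroup.smul_def]
  rw [hξ, co_smul_smul hF]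

theorem ae_constTerm_of_freq {F : H00 → ℂ} (hF : Measurable F)
    (h0 : ∀ᵐ h ∂muSL.restrict domSL, co F 0 h = 0)
    (h : ∀ d : ℕ+, ∀ᵐ v, constTerm F (freq d) v = 0) (m : ℤ) :
    ∀ᵐ v, constTerm F ![m, 0] v = 0 := by
  rcases lt_trichotomy m 0 with hm | rfl | hm
  · obtain ⟨d, rfl⟩ : ∃ d : ℕ+, m = -(d : ℤ) :=
      ⟨⟨m.natAbs, by omega⟩, by simp only [PNat.mk_coe]; omega⟩
    have hne : ∀ᵐ v : ℂ, v ≠ 0 := by simp [ae_iff, measure_singleton]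
    filter_upwards [(Measure.measurePreserving_neg (volume : Measure ℂ)).quasiMeasurePreserving.ae
      (h d), hne] with v hv hv0
    rw [constTerm_neg hF _ hv0]
    exact hv
  · exact ae_constTerm_zero hF h0
  · obtain ⟨d, rfl⟩ : ∃ d : ℕ+, m = (d : ℤ) :=
      ⟨⟨m.natAbs, by omega⟩, by simp only [PNat.mk_coe]; omega⟩
    exact h d

/-! ### The rotation action -/

theorem ofSL_mul (g h : SL(2, ℝ)) : SAff.ofSL (g * h) = SAff.ofSL g * SAff.ofSL h := by
  ext1 <;> simp [SAff.ofSL]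

/-- Right multiplication by a rotation. -/
def rotH (θ : ℝ) : H00 → H00 :=
  H00.descend (fun g => H00.mk (g * SAff.ofSL (rot θ))) (fun γ g => by
    rw [mul_assoc, H00.mk_intCast_mul])

theorem rotH_mk (θ : ℝ) (g : SAff ℝ) : rotH θ (H00.mk g) = H00.mk (g * SAff.ofSL (rot θ)) := rfl

theorem H00.mk_surjective : Function.Surjective H00.mk := Quotient.mk''_surjective

theorem measurable_rotH (θ : ℝ) : Measurable (rotH θ) := fun _ hs =>
  (measurable_H00_mk.comp (measurable_mul_const (SAff.ofSL (rot θ)))) hs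

theorem rotH_rotH (a b : ℝ) (x : H00) : rotH a (rotH b x) = rotH (b + a) x := by
  obtain ⟨g, rfl⟩ := H00.mk_surjective x
  rw [rotH_mk, rotH_mk, rotH_mk, mul_assoc, ← ofSL_mul, ← rot_add]

theorem rotH_zero (x : H00) : rotH 0 x = x := by
  obtain ⟨g, rfl⟩ := H00.mk_surjective x
  have : SAff.ofSL (1 : SL(2, ℝ)) = 1 := rfl
  rw [rotH_mk, rot_zero, this, mul_one]

theorem rotH_periodic (x : H00) : Function.Periodic (fun θ => rotH θ x) (2 * Real.pi) := fun θ => by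
  obtain ⟨g, rfl⟩ := H00.mk_surjective x
  simp only [rotH_mk, rot_periodic θ]

theorem pt_mul_rot (h : SL(2, ℝ)) (w : Fin 2 → ℝ) (θ : ℝ) :
    pt h w * SAff.ofSL (rot θ) = pt (h * rot θ) w := by
  rw [pt, mul_assoc, ← ofSL_mul, pt]

theorem rotH_mk_pt (h : SL(2, ℝ)) (w : Fin 2 → ℝ) (θ : ℝ) :
    rotH θ (H00.mk (pt h w)) = H00.mk (pt (h * rot θ) w) := by
  rw [rotH_mk, pt_mul_rot]

theorem isFundamentalDomain_preimage_mul_rot (θ : ℝ) :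
    IsFundamentalDomain SL(2, ℤ) ((fun h : SL(2, ℝ) => h * rot θ) ⁻¹' domSL) muSL :=
  isFundamentalDomain_domSL.preimage_of_equiv
    (measurePreserving_muSL_mul_rot θ).quasiMeasurePreserving (e := id) Function.bijective_id
    fun γ h => by simp only [id, modular_smul_def, mul_assoc]

/-- Right translation commutes with the lattice, so it carries `domSL` to another fundamental
domain, over which the invariant integrand has the same integral. -/
theorem measurePreserving_rotH (θ : ℝ) : MeasurePreserving (rotH θ) muMV muMV := by
  refine measurePreserving_of_lintegral (measurable_rotH θ) fun G hG => ?_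
  rw [lintegral_muMV (F := fun x => G (rotH θ x)) (hG.comp (measurable_rotH θ)), lintegral_muMV hG]
  have h1 : ∀ h, ∫⁻ w, fib (fun x => G (rotH θ x)) h w ∂volBox = fibInt G (h * rot θ) := by
    intro h
    simp only [fib, rotH_mk_pt]
    rfl
  simp only [h1]
  have h2 := (measurePreserving_muSL_mul_rot (-θ)).setLIntegral_comp_preimage
    (s := domSL) measurableSet_domSL (f := fun h => fibInt G (h * rot θ))
    ((measurable_fibInt hG).comp (measurable_mul_const _))
  rw [← h2]
  simp only [mul_assoc, ← rot_add, neg_add_cancel, rot_zero, mul_one]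
  exact (isFundamentalDomain_preimage_mul_rot (-θ)).setLIntegral_eq isFundamentalDomain_domSL _
    (fibInt_smul hG)

/-! ### Isotypic components -/

/-- The measure `dθ` on a full circle. -/
abbrev volRot : Measure ℝ := volume.restrict (Ioc (-Real.pi) Real.pi)

/-- The component of weight `k` of a function for the rotation action. -/
def ktype (k : ℤ) (F : H00 → ℂ) (x : H00) : ℂ :=
  (2 * Real.pi : ℝ)⁻¹ * ∫ θ : ℝ, Complex.exp (-(k * θ) * Complex.I) * F (rotH θ x) ∂volRot

theorem measurable_ktype (k : ℤ) {F : H00 → ℂ} (hF : Measurable F) : Measurable (ktype k F) := by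
  have h1 : Measurable fun q : SAff ℝ × ℝ => q.1 * SAff.ofSL (rot q.2) :=
    measurable_fst.mul (measurable_ofSL.comp (measurable_rot.comp measurable_snd))
  have h2 : Measurable fun q : SAff ℝ × ℝ => F (H00.mk (q.1 * SAff.ofSL (rot q.2))) :=
    hF.comp (measurable_H00_mk.comp h1)
  have h3 : Measurable fun q : SAff ℝ × ℝ => Complex.exp (-(k * q.2) * Complex.I) := by fun_prop
  have h4 : Measurable fun g : SAff ℝ => ktype k F (H00.mk g) :=
    ((h3.mul h2).stronglyMeasurable.integral_prod_right (ν := volRot)).measurable.const_mul _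
  exact fun s hs => h4 hs

theorem integral_volRot_shift {u : ℝ → ℂ} (hu : Function.Periodic u (2 * Real.pi)) (α : ℝ) :
    ∫ θ, u (θ + α) ∂volRot = ∫ θ, u θ ∂volRot := by
  have hle : -Real.pi ≤ Real.pi := by linarith [Real.pi_pos]
  rw [volRot, ← intervalIntegral.integral_of_le hle, ← intervalIntegral.integral_of_le hle,
    intervalIntegral.integral_comp_add_right]
  have := hu.intervalIntegral_add_eq (-Real.pi + α) (-Real.pi)
  have e1 : -Real.pi + α + 2 * Real.pi = Real.pi + α := by ring
  have e2 : -Real.pi + 2 * Real.pi = Real.pi := by ring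
  rwa [e1, e2] at this

/-- The identity holds at every x, even where the integrand is not integrable and the integral
defaults to zero. Exact modularity of the associated φ relies on this. -/
theorem ktype_rotH (k : ℤ) (F : H00 → ℂ) (α : ℝ) (x : H00) :
    ktype k F (rotH α x) = Complex.exp (k * α * Complex.I) * ktype k F x := by
  have hper : Function.Periodic
      (fun θ : ℝ => Complex.exp (-(k * θ) * Complex.I) * F (rotH θ x)) (2 * Real.pi) := by
    intro θ
    have h1 := rotH_periodic x θ
    simp only at h1
    simp only [h1]
    congr 1
    refine Eq.trans ?_ (Complex.exp_periodic.int_mul (-k) _)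
    congr 1
    push_cast
    ring
  rw [ktype, ktype, ← integral_volRot_shift hper α, mul_left_comm,
    ← integral_const_mul (Complex.exp (k * α * Complex.I))]
  congr 1
  refine integral_congr_ae (ae_of_all _ fun θ => ?_)
  simp only
  rw [rotH_rotH, add_comm α θ, ← mul_assoc, ← Complex.exp_add]
  congr 2
  push_cast
  ring

/-! ### Equivariant functions are lifts -/

/-- The function on the Jacobi half space attached to a function on `H(0,0)`. -/
def unlift (k : ℤ) (F : H00 → ℂ) (τ : ℍ) (z : ℂ) : ℂ :=
  conj (bot τ.toSL2R) ^ k * fib F τ.toSL2R ![z.im / τ.im, z.re - z.im / τ.im * τ.re]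

theorem pt_lin_vecMul (g : SAff ℝ) : g = pt g.lin (Matrix.vecMul g.trans
    ((g.lin⁻¹ : SL(2, ℝ)) : Matrix (Fin 2) (Fin 2) ℝ)) := by
  ext1
  · simp [pt, SAff.ofVec, SAff.ofSL]
  · simp only [pt, SAff.ofVec, SAff.ofSL, SAff.mul_trans, Matrix.vecMul_vecMul, add_zero,
      ← Matrix.SpecialLinearGroup.coe_mul, inv_mul_cancel, Matrix.SpecialLinearGroup.coe_one,
      Matrix.vecMul_one]

/-- In Iwasawa form the equivariance of F supplies the angular part of the automorphy factor, and
the power of `bot` in `unlift` cancels the radial part. -/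
theorem slash_unlift {k : ℤ} {F : H00 → ℂ}
    (hF : ∀ α x, F (rotH α x) = Complex.exp (k * α * Complex.I) * F x) (g : SAff ℝ) :
    slash k (unlift k F) g I 0 = F (H00.mk g) := by
  rw [pt_lin_vecMul g]
  generalize g.lin = h
  generalize Matrix.vecMul g.trans _ = w
  rw [slash_pt, unlift]
  set τ := h • I with hτ
  set θ := Complex.arg (bot h)
  have hh : h = τ.toSL2R * rot θ := eq_iwa h
  have him : (w 0 * (τ : ℂ) + w 1).im / τ.im = w 0 := by
    simp [τ.im_ne_zero]
  have hre : (w 0 * (τ : ℂ) + w 1).re - w 0 * τ.re = w 1 := by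
    simp
  have hw : ![w 0, w 1] = w := by ext i; fin_cases i <;> rfl
  have hb : bot h = bot τ.toSL2R * Complex.exp (θ * Complex.I) := by
    conv_lhs => rw [hh]
    exact bot_mul_rot _ _
  have hne : conj (bot τ.toSL2R) ≠ 0 := (map_ne_zero _).2 (bot_ne_zero _)
  rw [him, hre, hw]
  have h1 : F (H00.mk (pt h w)) = Complex.exp (k * θ * Complex.I) * fib F τ.toSL2R w := by
    rw [fib, ← hF, rotH_mk_pt, ← hh]
  rw [h1, hb, map_mul, mul_zpow, ← Complex.exp_conj, map_mul, Complex.conj_ofReal, Complex.conj_I,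
    ← Complex.exp_int_mul]
  have h2 : conj (bot τ.toSL2R) ^ (-k) * conj (bot τ.toSL2R) ^ k = 1 := by
    rw [← zpow_add₀ hne, neg_add_cancel, zpow_zero]
  have h3 : (((-k : ℤ) : ℂ) * (θ * -Complex.I)) = k * θ * Complex.I := by push_cast; ring
  rw [h3]
  linear_combination (Complex.exp (k * θ * Complex.I) * fib F τ.toSL2R w) * h2

/-- Every (τ, z) is the image of (i, 0) under some `pt`, so modularity can be tested at (i, 0),
where it is the left invariance of F. -/
theorem isAffineModular_unlift {k : ℤ} {F : H00 → ℂ}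
    (hF : ∀ α x, F (rotH α x) = Complex.exp (k * α * Complex.I) * F x) :
    IsAffineModular k (unlift k F) := by
  intro γ
  ext τ z
  set w : Fin 2 → ℝ := ![z.im / τ.im, z.re - z.im / τ.im * τ.re]
  have hz : w 0 * (τ : ℂ) + w 1 = z := by
    apply Complex.ext <;> simp [w, τ.im_ne_zero]
  have key : ∀ ψ, slash k ψ (pt τ.toSL2R w) I 0 = conj (bot τ.toSL2R) ^ (-k) * ψ τ z := by
    intro ψ
    rw [slash_pt, toSL2R_smul_I, hz]
  have h1 := key (slash k (unlift k F) (SAff.intCast γ))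
  rw [← slash_mul, slash_unlift hF, H00.mk_intCast_mul, ← slash_unlift hF, key] at h1
  exact (mul_left_cancel₀ (zpow_ne_zero _ ((map_ne_zero _).2 (bot_ne_zero _))) h1).symm

theorem lift_unlift {k : ℤ} {F : H00 → ℂ}
    (hF : ∀ α x, F (rotH α x) = Complex.exp (k * α * Complex.I) * F x) :
    lift k (unlift k F) (isAffineModular_unlift hF) = F := by
  ext x
  obtain ⟨g, rfl⟩ := H00.mk_surjective x
  exact slash_unlift hF g

/-! ### Pairing with isotypic components -/

theorem enorm_integral_sq_le {α : Type*} [MeasurableSpace α] (μ : Measure α) {f : α → ℂ}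
    (hf : AEStronglyMeasurable f μ) :
    ‖∫ x, f x ∂μ‖ₑ ^ 2 ≤ (∫⁻ x, ‖f x‖ₑ ^ 2 ∂μ) * μ univ := by
  have hJ := ENNReal.lintegral_mul_le_Lp_mul_Lq μ Real.HolderConjugate.two_two
    hf.enorm (measurable_const (a := (1 : ℝ≥0∞))).aemeasurable
  simp only [Pi.mul_apply, mul_one, ENNReal.one_rpow, lintegral_const, one_mul] at hJ
  calc ‖∫ x, f x ∂μ‖ₑ ^ 2 ≤ (∫⁻ x, ‖f x‖ₑ ∂μ) ^ 2 := by
        gcongr; exact enorm_integral_le_lintegral_enorm _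
    _ ≤ ((∫⁻ x, ‖f x‖ₑ ^ (2 : ℝ) ∂μ) ^ (1 / 2 : ℝ) * μ univ ^ (1 / 2 : ℝ)) ^ 2 := by gcongr
    _ = (∫⁻ x, ‖f x‖ₑ ^ 2 ∂μ) * μ univ := by
        rw [mul_pow, ← ENNReal.rpow_natCast, ← ENNReal.rpow_natCast, ← ENNReal.rpow_mul,
          ← ENNReal.rpow_mul]
        norm_num

theorem measurable_rotated {α : Type} [MeasurableSpace α] {F : H00 → α} (hF : Measurable F) :
    Measurable fun q : (SL(2, ℝ) × (Fin 2 → ℝ)) × ℝ => F (rotH q.2 (proj q.1)) := by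
  have h1 : Measurable fun q : (SL(2, ℝ) × (Fin 2 → ℝ)) × ℝ => q.1.1 * rot q.2 :=
    (measurable_fst.comp measurable_fst).mul (measurable_rot.comp measurable_snd)
  have h2 := (measurable_fib hF).comp (h1.prodMk (measurable_snd.comp measurable_fst))
  have h3 : (fun q : (SL(2, ℝ) × (Fin 2 → ℝ)) × ℝ => F (rotH q.2 (proj q.1))) =
      fun q => fib F (q.1.1 * rot q.2) q.1.2 := by
    ext q
    rw [proj, rotH_mk_pt, fib]
  rw [h3]
  exact h2

theorem volRot_univ : volRot univ = ENNReal.ofReal (2 * Real.pi) := by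
  rw [Measure.restrict_apply_univ, Real.volume_Ioc]
  congr 1
  ring

theorem lintegral_rotated {G : H00 → ℝ≥0∞} (hG : Measurable G) :
    ∫⁻ q, G (rotH q.2 (proj q.1)) ∂(muDom.prod volRot) =
      (∫⁻ x, G x ∂muMV) * ENNReal.ofReal (2 * Real.pi) := by
  rw [lintegral_prod_symm _ (measurable_rotated hG).aemeasurable]
  have h1 : ∀ θ : ℝ, ∫⁻ p, G (rotH θ (proj p)) ∂muDom = ∫⁻ x, G x ∂muMV := by
    intro θ
    exact ((measurePreserving_rotH θ).comp measurePreserving_proj).lintegral_comp hG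
  simp only [h1]
  rw [lintegral_const, volRot_univ]

theorem memLp_rotated {F : H00 → ℂ} (hF : Measurable F) (h2 : MemLp F 2 muMV) :
    MemLp (fun q : (SL(2, ℝ) × (Fin 2 → ℝ)) × ℝ => F (rotH q.2 (proj q.1))) 2
      (muDom.prod volRot) := by
  rw [memLp_two_iff (measurable_rotated hF).aestronglyMeasurable,
    lintegral_rotated (G := fun x => ‖F x‖ₑ ^ 2) (hF.enorm.pow_const 2)]
  exact ENNReal.mul_lt_top ((memLp_two_iff hF.aestronglyMeasurable).1 h2) ENNReal.ofReal_lt_top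

theorem norm_exp_neg_mul_I (k : ℤ) (θ : ℝ) : ‖Complex.exp (-(k * θ) * Complex.I)‖ = 1 := by
  have := Complex.norm_exp_ofReal_mul_I (-(k * θ))
  push_cast at this
  exact this

theorem measurable_rotated_right {F : H00 → ℂ} (hF : Measurable F)
    (p : SL(2, ℝ) × (Fin 2 → ℝ)) : Measurable fun θ : ℝ => F (rotH θ (proj p)) := by
  have := (measurable_rotated hF).comp ((measurable_const (a := p)).prodMk measurable_id)
  exact this

theorem memLp_ktype (k : ℤ) {F : H00 → ℂ} (hF : Measurable F) (h2 : MemLp F 2 muMV) :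
    MemLp (ktype k F) 2 muMV := by
  have hm := measurable_ktype k hF
  rw [memLp_two_iff hm.aestronglyMeasurable,
    ← measurePreserving_proj.lintegral_comp (hm.enorm.pow_const 2)]
  have hfin := (memLp_two_iff (measurable_rotated hF).aestronglyMeasurable).1 (memLp_rotated hF h2)
  rw [lintegral_prod _ ((measurable_rotated hF).enorm.pow_const 2).aemeasurable] at hfin
  set C : ℝ≥0∞ := ‖(((2 * Real.pi : ℝ)⁻¹ : ℝ) : ℂ)‖ₑ ^ 2 * ENNReal.ofReal (2 * Real.pi)
  have hle : ∀ p, ‖ktype k F (proj p)‖ₑ ^ 2 ≤ C * ∫⁻ θ, ‖F (rotH θ (proj p))‖ₑ ^ 2 ∂volRot := by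
    intro p
    have hm3 : Measurable fun θ : ℝ => Complex.exp (-(k * θ) * Complex.I) * F (rotH θ (proj p)) :=
      Measurable.mul (by fun_prop) (measurable_rotated_right hF p)
    have h3 := enorm_integral_sq_le volRot hm3.aestronglyMeasurable
    have h4 : ∀ θ : ℝ, ‖Complex.exp (-(k * θ) * Complex.I) * F (rotH θ (proj p))‖ₑ =
        ‖F (rotH θ (proj p))‖ₑ := by
      intro θ
      rw [enorm_mul, ← ofReal_norm, norm_exp_neg_mul_I, ENNReal.ofReal_one, one_mul]
    simp only [h4, volRot_univ] at h3
    rw [ktype, enorm_mul, mul_pow]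
    refine (mul_le_mul_right h3 _).trans (le_of_eq ?_)
    push_cast [C]
    ring
  refine (lintegral_mono hle).trans_lt ?_
  rw [lintegral_const_mul _ (((measurable_rotated hF).enorm.pow_const 2).lintegral_prod_right')]
  refine ENNReal.mul_lt_top (ENNReal.mul_lt_top ?_ ENNReal.ofReal_lt_top) hfin
  exact ENNReal.pow_lt_top enorm_lt_top

theorem integral_muMV_proj {F : H00 → ℂ} (hF : Measurable F) :
    ∫ x, F x ∂muMV = ∫ p, F (proj p) ∂muDom := by
  rw [muMV_eq_map_proj, integral_map measurable_proj.aemeasurable hF.aestronglyMeasurable]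

theorem measurable_conj_mul {F G : H00 → ℂ} (hF : Measurable F) (hG : Measurable G) :
    Measurable fun x => conj (G x) * F x :=
  (Complex.continuous_conj.measurable.comp hG).mul hF

theorem integral_conj_mul_ktype (k : ℤ) {F G : H00 → ℂ} (hF : Measurable F) (h2 : MemLp F 2 muMV)
    (hG : Measurable G) (hG2 : MemLp G 2 muMV) :
    ∫ x, conj (G x) * ktype k F x ∂muMV = (2 * Real.pi : ℝ)⁻¹ *
      ∫ θ : ℝ, Complex.exp (-(k * θ) * Complex.I) *
        ∫ x, conj (G x) * F (rotH θ x) ∂muMV ∂volRot := by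
  have hfinite : IsFiniteMeasure volRot := ⟨by rw [volRot_univ]; exact ENNReal.ofReal_lt_top⟩
  have hGp : MemLp (fun p => G (proj p)) 2 muDom :=
    hG2.comp_measurePreserving measurePreserving_proj
  have hint0 : Integrable (fun q : (SL(2, ℝ) × (Fin 2 → ℝ)) × ℝ =>
      conj (G (proj q.1)) * F (rotH q.2 (proj q.1))) (muDom.prod volRot) :=
    integrable_conj_mul (hGp.comp_fst volRot) (memLp_rotated hF h2)
  have hint : Integrable (fun q : (SL(2, ℝ) × (Fin 2 → ℝ)) × ℝ =>
      Complex.exp (-(k * q.2) * Complex.I) * (conj (G (proj q.1)) * F (rotH q.2 (proj q.1))))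
      (muDom.prod volRot) := by
    refine hint0.bdd_mul (c := 1) ?_ (ae_of_all _ fun q => (norm_exp_neg_mul_I k q.2).le)
    have : Continuous fun q : ℝ => Complex.exp (-(k * q) * Complex.I) := by fun_prop
    exact (this.measurable.comp measurable_snd).aestronglyMeasurable
  rw [integral_muMV_proj (measurable_conj_mul (measurable_ktype k hF) hG)]
  have e1 : ∀ θ : ℝ, ∫ x, conj (G x) * F (rotH θ x) ∂muMV =
      ∫ p, conj (G (proj p)) * F (rotH θ (proj p)) ∂muDom := fun θ =>
    integral_muMV_proj (F := fun x => conj (G x) * F (rotH θ x))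
      (measurable_conj_mul (hF.comp (measurable_rotH θ)) hG)
  simp only [e1, ← integral_const_mul (Complex.exp _)]
  rw [← integral_integral_swap hint, ← integral_const_mul]
  refine integral_congr_ae (ae_of_all _ fun p => ?_)
  simp only [ktype]
  rw [mul_left_comm, ← integral_const_mul (conj (G (proj p)))]
  congr 1
  refine integral_congr_ae (ae_of_all _ fun θ => ?_)
  simp only
  ring

theorem integral_conj_mul_comp_rotH {F G : H00 → ℂ} (hF : Measurable F) (hG : Measurable G)
    (θ : ℝ) : ∫ x, conj (G x) * F (rotH θ x) ∂muMV = ∫ x, conj (G (rotH (-θ) x)) * F x ∂muMV := by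
  have h := integral_map (μ := muMV) (measurable_rotH (-θ)).aemeasurable
    (f := fun x => conj (G x) * F (rotH θ x))
    (measurable_conj_mul (hF.comp (measurable_rotH θ)) hG).aestronglyMeasurable
  rw [(measurePreserving_rotH (-θ)).map_eq] at h
  rw [h]
  simp only [rotH_rotH, neg_add_cancel, rotH_zero]

/-- By Fubini and invariance of the measure each rotation can be moved to the left factor, where
equivariance cancels the exponential. This is the orthogonality of the projection `ktype k`. -/
theorem integral_conj_ktype_mul_self (k : ℤ) {F : H00 → ℂ} (hF : Measurable F)
    (h2 : MemLp F 2 muMV) :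
    ∫ x, conj (ktype k F x) * ktype k F x ∂muMV = ∫ x, conj (ktype k F x) * F x ∂muMV := by
  rw [integral_conj_mul_ktype k hF h2 (measurable_ktype k hF) (memLp_ktype k hF h2)]
  have h1 : ∀ θ : ℝ, Complex.exp (-(k * θ) * Complex.I) *
      ∫ x, conj (ktype k F x) * F (rotH θ x) ∂muMV = ∫ x, conj (ktype k F x) * F x ∂muMV := by
    intro θ
    rw [integral_conj_mul_comp_rotH hF (measurable_ktype k hF), ← integral_const_mul]
    refine integral_congr_ae (ae_of_all _ fun x => ?_)
    simp only [ktype_rotH, map_mul, ← Complex.exp_conj, Complex.conj_ofReal, Complex.conj_I,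
      map_intCast]
    rw [← mul_assoc, ← mul_assoc, ← Complex.exp_add]
    have : -(k * θ) * Complex.I + k * ((-θ : ℝ) : ℂ) * -Complex.I = 0 := by push_cast; ring
    rw [this, Complex.exp_zero, one_mul]
  simp only [h1]
  rw [integral_const, Measure.real, volRot_univ, ENNReal.toReal_ofReal (by positivity),
    Complex.real_smul, ← mul_assoc, ← Complex.ofReal_mul, inv_mul_cancel₀ (by positivity),
    Complex.ofReal_one, one_mul]

/-! ### A function is determined by its isotypic components -/

theorem ae_eq_zero_of_integral_exp_mul {g : ℝ → ℂ} (h2 : MemLp g 2 volRot)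
    (h : ∀ k : ℤ, ∫ θ : ℝ, Complex.exp (-(k * θ) * Complex.I) * g θ ∂volRot = 0) :
    ∫⁻ θ, ‖g θ‖ₑ ^ 2 ∂volRot = 0 := by
  have hlt : -Real.pi < Real.pi := by linarith [Real.pi_pos]
  have hs := hasSum_sq_fourierCoeffOn hlt h2
  have h0 : ∀ k : ℤ, fourierCoeffOn hlt g k = 0 := by
    intro k
    rw [fourierCoeffOn_eq_integral, intervalIntegral.integral_of_le hlt.le]
    have : ∀ θ : ℝ, fourier (-k) (θ : AddCircle (Real.pi - -Real.pi)) • g θ =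
        Complex.exp (-(k * θ) * Complex.I) * g θ := by
      intro θ
      rw [fourier_coe_apply, smul_eq_mul]
      congr 2
      have : (Real.pi : ℂ) ≠ 0 := by exact_mod_cast Real.pi_ne_zero
      push_cast
      field_simp
      ring
    simp only [this]
    rw [h k, smul_zero]
  simp only [h0, norm_zero, ne_eq, OfNat.ofNat_ne_zero, not_false_eq_true, zero_pow] at hs
  have h1 := hs.unique hasSum_zero
  rw [smul_eq_zero, intervalIntegral.integral_of_le hlt.le] at h1
  have h3 : ∫ θ, ‖g θ‖ ^ 2 ∂volRot = 0 := h1.resolve_left (by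
    have := Real.pi_pos
    exact inv_ne_zero (by linarith))
  rw [integral_eq_zero_iff_of_nonneg (fun θ => by positivity) h2.norm.integrable_sq] at h3
  rw [lintegral_congr_ae (g := fun _ => 0), lintegral_zero]
  filter_upwards [h3] with θ hθ
  have : ‖g θ‖ ^ 2 = 0 := hθ
  simpa using this

/-- On almost every rotation orbit the function of θ is square integrable with all Fourier
coefficients zero, hence zero. Since rotations preserve the measure, the total over all orbits is 2π
times the squared norm of F. -/
theorem ae_eq_zero_of_ktype {F : H00 → ℂ} (hF : Measurable F) (h2 : MemLp F 2 muMV)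
    (h : ∀ k, ∀ᵐ x ∂muMV, ktype k F x = 0) : ∀ᵐ x ∂muMV, F x = 0 := by
  have hm := (measurable_rotated hF).enorm.pow_const 2
  have hfin := (memLp_two_iff (measurable_rotated hF).aestronglyMeasurable).1 (memLp_rotated hF h2)
  rw [lintegral_prod _ hm.aemeasurable] at hfin
  have hk : ∀ᵐ p ∂muDom, ∀ k, ktype k F (proj p) = 0 :=
    ae_all_iff.2 fun k => measurePreserving_proj.quasiMeasurePreserving.ae (h k)
  have h0 : ∫⁻ q, ‖F (rotH q.2 (proj q.1))‖ₑ ^ 2 ∂(muDom.prod volRot) = 0 := by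
    rw [lintegral_prod _ hm.aemeasurable]
    rw [lintegral_congr_ae (g := fun _ => 0), lintegral_zero]
    filter_upwards [hk, ae_lt_top hm.lintegral_prod_right' hfin.ne] with p hp hp2
    refine ae_eq_zero_of_integral_exp_mul ?_ fun k => ?_
    · exact (memLp_two_iff (measurable_rotated_right hF p).aestronglyMeasurable).2 hp2
    · have := hp k
      rw [ktype] at this
      refine (mul_eq_zero.1 this).resolve_left ?_
      exact_mod_cast inv_ne_zero (by positivity)
  rw [lintegral_rotated (G := fun x => ‖F x‖ₑ ^ 2) (hF.enorm.pow_const 2)] at h0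
  have h1 : ∫⁻ x, ‖F x‖ₑ ^ 2 ∂muMV = 0 := by
    refine (mul_eq_zero.1 h0).resolve_right ?_
    simpa using Real.pi_pos
  rw [lintegral_eq_zero_iff (hF.enorm.pow_const 2)] at h1
  filter_upwards [h1] with x hx
  simpa using hx

/-! ### Invariance of the Siegel–Veech transforms and of the genuine part -/

theorem SVrel_rotH (M : ℕ+) (f : (Fin 2 → ℝ) → ℂ) (θ : ℝ) (x : H00) :
    SVrel M f (rotH θ x) = SVrel M (fun v => f (vecMulHomeo (rot θ) v)) x := by
  obtain ⟨g, rfl⟩ := H00.mk_surjective x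
  rw [rotH_mk, SVrel_mk, SVrel_mk]
  refine tsum_congr fun l => congrArg f ?_
  simp [vecMulHomeo, SAff.ofSL, Matrix.add_vecMul, Matrix.smul_vecMul, Matrix.vecMul_vecMul]

theorem IsTestFunction.comp_vecMulHomeo {f : (Fin 2 → ℝ) → ℂ} (hf : IsTestFunction f)
    (h : SL(2, ℝ)) : IsTestFunction fun v => f (vecMulHomeo h v) := by
  refine ⟨?_, hf.2.1.comp_homeomorph _, ?_⟩
  · refine hf.1.comp (contDiff_pi.2 fun i => ?_)
    simp only [vecMulHomeo, Homeomorph.homeomorph_mk_coe, Equiv.coe_fn_mk, Matrix.vecMul,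
      dotProduct, Fin.sum_univ_two]
    fun_prop
  · exact ((measurePreserving_vecMul h).integral_comp'
      (f := (vecMulHomeo h).toMeasurableEquiv) f).trans hf.2.2

/-- Moved to the other side, a rotation turns `SVrel M f` into the transform of the rotated test
function, so the inner integral vanishes for every θ. -/
theorem integral_conj_SVrel_mul_ktype {F : H00 → ℂ} (hF : Measurable F) (h2 : MemLp F 2 muMV)
    (hperp : ∀ (M : ℕ+) (f : (Fin 2 → ℝ) → ℂ), IsTestFunction f →
      ∫ x, conj (SVrel M f x) * F x ∂muMV = 0) (k : ℤ) (M : ℕ+) {f : (Fin 2 → ℝ) → ℂ}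
    (hf : IsTestFunction f) : ∫ x, conj (SVrel M f x) * ktype k F x ∂muMV = 0 := by
  have hm := measurable_SVrel M hf.continuous.measurable
  rw [integral_conj_mul_ktype k hF h2 hm (memLp_SVrel M hf)]
  simp only [integral_conj_mul_comp_rotH hF hm, SVrel_rotH, hperp M _ (hf.comp_vecMulHomeo _)]
  simp

/-- Forgetting the second point commutes with rotations, so a rotated pullback is still constant on
the fibres and remains orthogonal to F. -/
theorem toLp_ktype_mem_genuinePart {F : H00 → ℂ} (hF : Measurable F) (h2 : MemLp F 2 muMV)
    (h0 : ∀ᵐ h ∂muSL.restrict domSL, co F 0 h = 0) (k : ℤ) :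
    (memLp_ktype k hF h2).toLp (ktype k F) ∈ genuinePart := by
  rw [genuinePart, Submodule.mem_orthogonal]
  rintro _ ⟨ψ, rfl⟩
  have hψ := measurable_coeFn_Lp ψ
  have hmp : MeasurePreserving forget muMV muMV0 := ⟨measurable_forget, rfl⟩
  have hG : Measurable fun x => ψ (forget x) := hψ.comp measurable_forget
  have hG2 : MemLp (fun x => ψ (forget x)) 2 muMV := (Lp.memLp ψ).comp_measurePreserving hmp
  have e1 : inner ℂ (pullback.toLinearMap ψ) ((memLp_ktype k hF h2).toLp (ktype k F)) =
      ∫ x, conj (ψ (forget x)) * ktype k F x ∂muMV := by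
    rw [inner_L2_eq]
    refine integral_congr_ae ?_
    filter_upwards [Lp.coeFn_compMeasurePreserving ψ hmp, (memLp_ktype k hF h2).coeFn_toLp]
      with x hx hx'
    rw [hx']
    congr 2
  rw [e1, integral_conj_mul_ktype k hF h2 hG hG2]
  have e2 : ∀ θ : ℝ, ∫ x, conj (ψ (forget x)) * F (rotH θ x) ∂muMV = 0 := by
    intro θ
    have hGr : Measurable fun x => ψ (forget (rotH (-θ) x)) := hG.comp (measurable_rotH _)
    have hGr2 : MemLp (fun x => ψ (forget (rotH (-θ) x))) 2 muMV :=
      hG2.comp_measurePreserving (measurePreserving_rotH (-θ))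
    rw [integral_conj_mul_comp_rotH hF hG, integral_muMV
      (F := fun x => conj (ψ (forget (rotH (-θ) x))) * F x) (measurable_conj_mul hF hGr)
      (integrable_conj_mul hGr2 h2)]
    refine integral_eq_zero_of_ae ?_
    filter_upwards [h0] with h hh
    have e3 : ∀ w, fib (fun x => conj (ψ (forget (rotH (-θ) x))) * F x) h w =
        conj (ψ (H0.mk (h * rot (-θ)))) * fib F h w := by
      intro w
      have := fib_comp_forget ψ (h * rot (-θ)) w
      simp only [fib, rotH_mk_pt] at this ⊢
      rw [this]
    simp only [e3]
    rw [integral_const_mul, ← co_zero, hh, mul_zero]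
    rfl
  simp [e2]

/-! ### The orthogonal decomposition -/

theorem toLp_SVrel_mem_SVspanAll (M : ℕ+) {f : (Fin 2 → ℝ) → ℂ} (hf : IsTestFunction f) :
    (memLp_SVrel M hf).toLp (SVrel M f) ∈ SVspanAll := by
  refine Submodule.le_topologicalClosure _ (Submodule.subset_span (mem_iUnion.2 ⟨M, ?_⟩))
  exact Submodule.le_topologicalClosure _
    (Submodule.subset_span ⟨f, hf, (memLp_SVrel M hf).coeFn_toLp⟩)

theorem SVspanAll_le {K : Submodule ℂ L2H00} (hK : IsClosed (K : Set L2H00))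
    (h : ∀ (M : ℕ+) (f : (Fin 2 → ℝ) → ℂ) (F : L2H00), IsTestFunction f →
      F =ᵐ[muMV] SVrel M f → F ∈ K) : SVspanAll ≤ K := by
  refine Submodule.topologicalClosure_minimal _ (Submodule.span_le.2 (iUnion_subset fun M => ?_)) hK
  refine Submodule.topologicalClosure_minimal _ (Submodule.span_le.2 ?_) hK
  rintro F ⟨f, hf, hF⟩
  exact h M f F hf hF

theorem isClosed_genuinePart : IsClosed (genuinePart : Set L2H00) :=
  Submodule.isClosed_orthogonal _

theorem SVspanAll_le_genuinePart : SVspanAll ≤ genuinePart :=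
  SVspanAll_le isClosed_genuinePart fun _ _ _ hf hF => mem_genuinePart_of_ae_eq_SVrel hf hF

theorem cuspPart_le_genuinePart : cuspPart ≤ genuinePart :=
  Submodule.topologicalClosure_minimal _ (Submodule.span_le.2 fun _ hF => hF.1) isClosed_genuinePart

theorem inner_eq_integral_SVrel {M : ℕ+} {f : (Fin 2 → ℝ) → ℂ} {S : L2H00}
    (hS : S =ᵐ[muMV] SVrel M f) (F : L2H00) :
    inner ℂ S F = ∫ x, conj (SVrel M f x) * F x ∂muMV := by
  rw [inner_L2_eq]
  refine integral_congr_ae ?_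
  filter_upwards [hS] with x hx
  rw [hx]

theorem cuspPart_isOrtho_SVspanAll : cuspPart ⟂ SVspanAll := by
  refine Submodule.topologicalClosure_minimal _ (Submodule.span_le.2 ?_)
    (Submodule.isClosed_orthogonal _)
  rintro F ⟨hgen, k, φ, hφ, hvan, hFφ⟩
  rw [SetLike.mem_coe, Submodule.mem_orthogonal]
  have hle : SVspanAll ≤ (ℂ ∙ F)ᗮ := by
    refine SVspanAll_le (Submodule.isClosed_orthogonal _) fun M f S hf hS => ?_
    rw [Submodule.mem_orthogonal_singleton_iff_inner_left, inner_eq_integral_SVrel hS]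
    refine integral_conj_SVrel_mul_eq_zero (measurable_coeFn_Lp F) (Lp.memLp F)
      ((mem_genuinePart_iff F).1 hgen) (fun d => ?_) hf M
    exact (ae_constTerm_iff (measurable_coeFn_Lp F) (Lp.memLp F) hφ hFφ d).2 (hvan d)
  exact fun S hS => Submodule.mem_orthogonal_singleton_iff_inner_left.1 (hle hS)

/-- Orthogonality to the Siegel–Veech transforms forces the constant terms of the component to
vanish, and equivariance makes it the lift of its own `unlift`, which is therefore a cusp form. -/
theorem toLp_ktype_mem_cuspPart {F : H00 → ℂ} (hF : Measurable F) (h2 : MemLp F 2 muMV)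
    (h0 : ∀ᵐ h ∂muSL.restrict domSL, co F 0 h = 0)
    (hperp : ∀ (M : ℕ+) (f : (Fin 2 → ℝ) → ℂ), IsTestFunction f →
      ∫ x, conj (SVrel M f x) * F x ∂muMV = 0) (k : ℤ) :
    (memLp_ktype k hF h2).toLp (ktype k F) ∈ cuspPart := by
  refine Submodule.le_topologicalClosure _ (Submodule.subset_span ?_)
  have hm := measurable_ktype k hF
  have hm2 := memLp_ktype k hF h2
  have hgen := toLp_ktype_mem_genuinePart hF h2 h0 k
  have hk0 : ∀ᵐ h ∂muSL.restrict domSL, co (ktype k F) 0 h = 0 := by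
    filter_upwards [(mem_genuinePart_iff _).1 hgen, co_congr_ae hm2.coeFn_toLp] with h hh hh'
    rw [← hh', hh]
  have hrot := ktype_rotH k F
  have hlift : ktype k F =ᵐ[muMV] lift k (unlift k (ktype k F)) (isAffineModular_unlift hrot) := by
    rw [lift_unlift hrot]
  refine ⟨hgen, k, unlift k (ktype k F), isAffineModular_unlift hrot, fun m => ?_,
    hm2.coeFn_toLp.trans hlift⟩
  refine (ae_constTerm_iff hm hm2 _ hlift m).1 (ae_constTerm_of_freq hm hk0 (fun d => ?_) m)
  exact ae_constTerm_eq_zero hm hm2 hk0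
    (fun M f hf => integral_conj_SVrel_mul_ktype hF h2 hperp k M hf) d

theorem eq_zero_of_mem_genuinePart_of_orthogonal {F : L2H00} (hgen : F ∈ genuinePart)
    (hS : F ∈ SVspanAllᗮ) (hC : F ∈ cuspPartᗮ) : F = 0 := by
  have hF := measurable_coeFn_Lp F
  have h2 := Lp.memLp F
  have h0 := (mem_genuinePart_iff F).1 hgen
  have hperp : ∀ (M : ℕ+) (f : (Fin 2 → ℝ) → ℂ), IsTestFunction f →
      ∫ x, conj (SVrel M f x) * F x ∂muMV = 0 := fun M f hf => by
    rw [← inner_eq_integral_SVrel (memLp_SVrel M hf).coeFn_toLp F]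
    exact (Submodule.mem_orthogonal _ _).1 hS _ (toLp_SVrel_mem_SVspanAll M hf)
  have hk : ∀ k, ∀ᵐ x ∂muMV, ktype k F x = 0 := by
    intro k
    have hm2 := memLp_ktype k hF h2
    have h1 := (Submodule.mem_orthogonal _ _).1 hC _ (toLp_ktype_mem_cuspPart hF h2 h0 hperp k)
    -- Orthogonality of F to its component becomes, through the projection identity, the vanishing
    -- of the component's norm.
    rw [inner_L2_eq, integral_congr_ae (g := fun x => conj (ktype k F x) * F x) (by
      filter_upwards [hm2.coeFn_toLp] with x hx
      rw [hx]), ← integral_conj_ktype_mul_self k hF h2] at h1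
    have h3 : hm2.toLp (ktype k F) = 0 := by
      rw [← inner_self_eq_zero (𝕜 := ℂ), inner_L2_eq, ← h1]
      refine integral_congr_ae ?_
      filter_upwards [hm2.coeFn_toLp] with x hx
      rw [hx]
    filter_upwards [hm2.coeFn_toLp, Lp.eq_zero_iff_ae_eq_zero.1 h3] with x hx hx'
    rw [← hx, hx']
    rfl
  exact (Lp.eq_zero_iff_ae_eq_zero).2 (ae_eq_zero_of_ktype hF h2 hk)

theorem cuspPart_sup_SVspanAll : cuspPart ⊔ SVspanAll = genuinePart := by
  refine le_antisymm (sup_le cuspPart_le_genuinePart SVspanAll_le_genuinePart) fun F hF => ?_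
  have : CompleteSpace cuspPart := (Submodule.isClosed_topologicalClosure _).completeSpace_coe
  have : CompleteSpace SVspanAll := (Submodule.isClosed_topologicalClosure _).completeSpace_coe
  have hortho := cuspPart_isOrtho_SVspanAll
  have hC := Submodule.starProjection_apply_mem cuspPart F
  have hS := Submodule.starProjection_apply_mem SVspanAll F
  have hC' := Submodule.sub_starProjection_mem_orthogonal (K := cuspPart) F
  have hS' := Submodule.sub_starProjection_mem_orthogonal (K := SVspanAll) F
  set c := cuspPart.starProjection F
  set s := SVspanAll.starProjection F
  -- The two spaces are closed and orthogonal, so removing both projections leaves a genuine vector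
  -- orthogonal to each of them.
  have h0 : F - c - s = 0 := by
    refine eq_zero_of_mem_genuinePart_of_orthogonal ?_ ?_ ?_
    · exact Submodule.sub_mem _ (Submodule.sub_mem _ hF (cuspPart_le_genuinePart hC))
        (SVspanAll_le_genuinePart hS)
    · rw [sub_right_comm]
      exact Submodule.sub_mem _ hS' (hortho hC)
    · exact Submodule.sub_mem _ hC' (hortho.symm hS)
  have : F = c + s := by rw [sub_sub, sub_eq_zero] at h0; exact h0
  rw [this]
  exact Submodule.add_mem_sup hC hS

end TwoPointTori

end

open TwoPointTori
theorem theorem1p5 :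
    (∀ (M : ℕ+) (f : (Fin 2 → ℝ) → ℂ), IsTestFunction f → MemLp (SVrel M f) 2 muMV) ∧
      cuspPart ⟂ SVspanAll ∧ cuspPart ⊔ SVspanAll = genuinePart :=
  ⟨fun M _ hf => memLp_SVrel M hf, cuspPart_isOrtho_SVspanAll, cuspPart_sup_SVspanAll⟩
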